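/- Let $r \geq 2$ be an integer. The product over all primes $$\prod_p \left(1-\frac1p\right)^{r+1}\left(1+\frac{r+1}{p-1}\right)$$ converges, and there is a real polynomial $\mathcal{P}_r$, depending only on $r$, of degree $r$ and with leading coefficient $$\frac{1}{r!}\prod_p \left(1-\frac1p\right)^{r+1}\left(1+\frac{r+1}{p-1}\right),$$ such that for every $\varepsilon>0$, as the real variable $x\to\infty$, $$\sum_{n_1\leq x,\dotsc,n_r\leq x} \mu(n_1\dotsb n_r)^2\left\lfloor \frac{x}{n_1\dotsb n_r}\right\rfloor = x\,\mathcal{P}_r(\log x) + O_{r,\varepsilon}\!\left(x^{1-\frac{3}{r+7}+\varepsilon}\right),$$ where the sum runs over all $r$-tuples of positive integers $n_i\leq x$ and $\mu$ is the Möbius function. -/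

import Mathlib

/-- The sum over all `r`-tuples `(n₁, …, n_r)` of positive integers `nᵢ ≤ x` of
`μ(n₁ ⋯ n_r)² ⌊x / (n₁ ⋯ n_r)⌋`. -/
noncomputable def moebiusSqFloorSum (r : ℕ) (x : ℝ) : ℤ :=
  ∑ n ∈ Fintype.piFinset (fun _ : Fin r => Finset.Icc 1 ⌊x⌋₊),
    (ArithmeticFunction.moebius (∏ i, n i)) ^ 2 * ⌊x / ((∏ i, n i : ℕ) : ℝ)⌋

/-- The factor at `p` of the Euler product: `(1 - 1/p)^(r+1) (1 + (r+1)/(p-1))`. -/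
noncomputable def eulerFactor (r : ℕ) (p : Nat.Primes) : ℝ :=
  (1 - 1 / (p : ℝ)) ^ (r + 1) * (1 + ((r : ℝ) + 1) / ((p : ℝ) - 1))

/-! ### The arithmetic of `k ^ ω(n)` -/

section Arithmetic

open ArithmeticFunction Finset
open scoped ArithmeticFunction.Moebius ArithmeticFunction.omega ArithmeticFunction.zeta

/-! The floor counts the multiples of n₁⋯n_r up to x. Exchanging the sums, each m ≤ x is weighted by
the number of r-tuples whose product is squarefree and divides m. A squarefree d has r^ω(d) ordered
factorizations into r factors, and the binomial theorem over the primes of m gives total weight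
(r+1)^ω(m) (`moebiusSqFloorSum_eq`). So the problem is to sum (r+1)^ω(m) over m ≤ x.

The Dirichlet series is ζ(s)^(r+1) H(s). The local factor of H at p is (1 + rX)(1 - X)^r with X =
p^(-s); it has no linear term, so H converges absolutely for Re s > 1/2, and H(1) is the Euler
product of the theorem. The pole of order r+1 at s = 1 produces x P(log x) with leading coefficient
H(1)/r!, and H(1) ≠ 0 makes the degree exactly r.

For the error term, put x = e^y and take Laplace transforms. Subtracting the main term removes the
polar part at 1 and leaves a function g(s)/s with g holomorphic in Re s > 1/2. Near the line Re s =
1/2 the Weyl bound |ζ(σ+it)| ≪ (1+|t|)^(1/6) for σ > 1/2 (`exists_norm_riemannZeta_le`) gives |g| ≪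
(1+|t|)^((r+1)/6). It is proved by van der Corput's method: the Kusmin–Landau inequality, the second
derivative test, and one Weyl differencing step applied to sums of n^(-it).

In place of a truncated Perron formula, the error term is integrated r+2 times, so that the inverse
Laplace integral converges absolutely and can be moved to Re s = 1/2 + e. Taking an (r+2)-fold
difference of step δ then bounds averages of the error by x^(1/2+e) δ^(-(r+1)/6-e)
(`norm_fwdDiff_iterate_primitive_le`). Monotonicity of the summatory function turns averages into
pointwise bounds at the cost of the variation of the main term, about x^(1+e) δ
(`abs_re_le_of_fwdDiff_bound`). With δ = x^(-ρ) the two balance when 1 - ρ = 1/2 + ρ(r+1)/6, that is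
ρ = 3/(r+7). -/

/-- The arithmetic function `n ↦ k ^ ω(n)`. -/
noncomputable def omegaPow (k : ℕ) : ArithmeticFunction ℤ :=
  ⟨fun n => if n = 0 then 0 else (k : ℤ) ^ ω n, by simp⟩

theorem omegaPow_apply {k n : ℕ} (hn : n ≠ 0) : omegaPow k n = (k : ℤ) ^ ω n := by
  simp [omegaPow, hn]

theorem omegaPow_nonneg (k n : ℕ) : 0 ≤ omegaPow k n := by
  rcases eq_or_ne n 0 with rfl | hn
  · simp
  · rw [omegaPow_apply hn]; positivity

theorem isMultiplicative_omegaPow (k : ℕ) : (omegaPow k).IsMultiplicative := by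
  refine IsMultiplicative.iff_ne_zero.2 ⟨by simp [omegaPow_apply], fun {m n} hm hn h => ?_⟩
  rw [omegaPow_apply hm, omegaPow_apply hn, omegaPow_apply (mul_ne_zero hm hn),
    cardDistinctFactors_mul h, pow_add]

/-- Squarefree divisors of m correspond to subsets of its set of prime factors, so this is the
binomial expansion of (r + 1)^ω(m). -/
theorem sum_squarefree_divisors_pow_omega (r : ℕ) {m : ℕ} (hm : m ≠ 0) :
    ∑ d ∈ m.divisors with Squarefree d, r ^ ω d = (r + 1) ^ ω m := by
  rw [Nat.sum_divisors_filter_squarefree hm]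
  have h1 : (UniqueFactorizationMonoid.normalizedFactors m).toFinset = m.primeFactors := by
    rw [Nat.factors_eq]; rfl
  have hω : ω m = #m.primeFactors := by
    rw [cardDistinctFactors_apply, ← List.card_toFinset]; rfl
  rw [h1, hω, ← Finset.sum_pow_mul_eq_add_pow r 1]
  refine Finset.sum_congr rfl fun t ht => ?_
  have ht' : ∀ p ∈ t, p.Prime := fun p hp => Nat.prime_of_mem_primeFactors (mem_powerset.1 ht hp)
  have h2 : t.val.prod = ∏ p ∈ t, p := by simp
  rw [h2, cardDistinctFactors_prod (fun p hp q hq hpq => ?_), one_pow, mul_one,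
    Finset.sum_congr rfl (fun p hp => cardDistinctFactors_apply_prime (ht' p hp))]
  · simp
  · exact (Nat.coprime_primes (ht' p hp) (ht' q hq)).2 hpq

/-- Group the tuples by their product d. Each prime of a squarefree d goes to exactly one of the r
factors, hence r^ω(d) tuples. Since m ≤ X, the box constraint on the entries is automatic. -/
theorem card_tuples_squarefree_dvd (r X : ℕ) {m : ℕ} (hm : m ≠ 0) (hmX : m ≤ X) :
    #{n ∈ Fintype.piFinset (fun _ : Fin r => Finset.Icc 1 X) |
      Squarefree (∏ i, n i) ∧ (∏ i, n i) ∣ m} = (r + 1) ^ ω m := by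
  rw [← sum_squarefree_divisors_pow_omega r hm]
  rw [Finset.card_eq_sum_card_fiberwise (f := fun n => ∏ i, n i)
    (t := m.divisors.filter Squarefree)]
  · refine Finset.sum_congr rfl fun d hd => ?_
    rw [mem_filter, Nat.mem_divisors] at hd
    rw [← Nat.card_finMulAntidiag_of_squarefree hd.2]
    congr 1
    ext n
    simp only [mem_filter, Fintype.mem_piFinset, mem_Icc, Nat.mem_finMulAntidiag]
    constructor
    · rintro ⟨-, rfl⟩; exact ⟨rfl, hd.2.ne_zero⟩
    · rintro ⟨rfl, -⟩
      refine ⟨⟨fun i => ?_, hd.2, hd.1.1⟩, rfl⟩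
      have hi : n i ∣ m := (Finset.dvd_prod_of_mem n (mem_univ i)).trans hd.1.1
      exact ⟨Nat.pos_of_ne_zero (ne_zero_of_dvd_ne_zero hm hi),
        (Nat.le_of_dvd (Nat.pos_of_ne_zero hm) hi).trans hmX⟩
  · intro n hn
    simp only [coe_filter, Fintype.mem_piFinset, Set.mem_ofPred_eq, Nat.mem_divisors] at hn ⊢
    exact ⟨⟨hn.2.2, hm⟩, hn.2.1⟩

theorem moebiusSqFloorSum_eq (r : ℕ) {x : ℝ} (hx : 0 ≤ x) :
    moebiusSqFloorSum r x = ∑ m ∈ Finset.Icc 1 ⌊x⌋₊, omegaPow (r + 1) m := by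
  have key : ∀ m ∈ Finset.Icc 1 ⌊x⌋₊, omegaPow (r + 1) m =
      ∑ n ∈ Fintype.piFinset (fun _ : Fin r => Finset.Icc 1 ⌊x⌋₊),
        (if Squarefree (∏ i, n i) ∧ (∏ i, n i) ∣ m then (1 : ℤ) else 0) := by
    intro m hm
    rw [Finset.mem_Icc] at hm
    have hm0 : m ≠ 0 := by omega
    rw [omegaPow_apply hm0, ← Finset.sum_filter, Finset.sum_const,
      card_tuples_squarefree_dvd r _ hm0 hm.2]
    simp
  rw [Finset.sum_congr rfl key, Finset.sum_comm, moebiusSqFloorSum]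
  refine Finset.sum_congr rfl fun n hn => ?_
  rw [moebius_sq]
  by_cases hsq : Squarefree (∏ i, n i)
  · have hpos : 0 < ∏ i, n i := Nat.pos_of_ne_zero hsq.ne_zero
    simp only [hsq, true_and, if_true, one_mul]
    rw [← Finset.sum_filter, Finset.sum_const, nsmul_eq_mul, mul_one]
    have hc : #{m ∈ Finset.Icc 1 ⌊x⌋₊ | (∏ i, n i) ∣ m} = ⌊x⌋₊ / ∏ i, n i := by
      have := Nat.Ioc_filter_dvd_card_eq_div ⌊x⌋₊ (∏ i, n i)
      rwa [show Finset.Ioc 0 ⌊x⌋₊ = Finset.Icc 1 ⌊x⌋₊ from rfl] at this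
    rw [hc, ← Nat.floor_div_natCast, Int.natCast_floor_eq_floor (by positivity)]
  · simp [hsq]

/-- The generating series of the values of an arithmetic function at the powers of `p`. -/
noncomputable def bellSeries (p : ℕ) (f : ArithmeticFunction ℤ) : PowerSeries ℤ :=
  PowerSeries.mk fun j => f (p ^ j)

theorem bellSeries_mul {p : ℕ} (hp : p.Prime) (f g : ArithmeticFunction ℤ) :
    bellSeries p (f * g) = bellSeries p f * bellSeries p g := by
  ext n
  rw [PowerSeries.coeff_mul]
  simp only [bellSeries, PowerSeries.coeff_mk, mul_apply]
  rw [Nat.sum_divisorsAntidiagonal (fun a b => f a * g b), Nat.sum_divisors_prime_pow hp,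
    Finset.Nat.sum_antidiagonal_eq_sum_range_succ (fun a b => f (p ^ a) * g (p ^ b))]
  refine Finset.sum_congr rfl fun i hi => ?_
  rw [Nat.pow_div (by simpa [Nat.lt_succ_iff] using hi) hp.pos]

theorem bellSeries_pow {p : ℕ} (hp : p.Prime) (f : ArithmeticFunction ℤ) (n : ℕ) :
    bellSeries p (f ^ n) = bellSeries p f ^ n := by
  induction n with
  | zero =>
    ext j
    rcases j with _ | j
    · simp [bellSeries]
    · simp [bellSeries, one_apply, PowerSeries.coeff_one, hp.ne_one]
  | succ n ih => rw [pow_succ, bellSeries_mul hp, ih, pow_succ]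

theorem bellSeries_moebius {p : ℕ} (hp : p.Prime) :
    bellSeries p μ = 1 - PowerSeries.X := by
  ext j
  rcases j with _ | _ | j
  · simp [bellSeries]
  · simp [bellSeries, PowerSeries.coeff_one, moebius_apply_prime hp]
  · simp [bellSeries, PowerSeries.coeff_one, PowerSeries.coeff_X,
      moebius_apply_prime_pow hp (Nat.succ_ne_zero _)]

theorem bellSeries_omegaPow {p : ℕ} (hp : p.Prime) (k : ℕ) :
    bellSeries p (omegaPow k) * (1 - PowerSeries.X) =
      1 + PowerSeries.C ((k : ℤ) - 1) * PowerSeries.X := by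
  have hv : ∀ j, omegaPow k (p ^ (j + 1)) = k := fun j => by
    rw [omegaPow_apply (pow_ne_zero _ hp.ne_zero),
      cardDistinctFactors_apply_prime_pow hp (by simp), pow_one]
  ext j
  rw [mul_sub, mul_one, map_sub]
  rcases j with _ | _ | j
  · simp [bellSeries, (isMultiplicative_omegaPow k).1]
  · simpa [bellSeries, PowerSeries.coeff_one, PowerSeries.coeff_succ_mul_X,
      (isMultiplicative_omegaPow k).1] using hv 0
  · simp only [bellSeries, PowerSeries.coeff_succ_mul_X, PowerSeries.coeff_mk, hv]
    rw [map_add, PowerSeries.coeff_succ_mul_X, PowerSeries.coeff_one, PowerSeries.coeff_C]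
    simp

/-- The polynomial `(1 + r X) (1 - X) ^ r`. -/
noncomputable def localPoly (r : ℕ) : Polynomial ℤ :=
  (1 + Polynomial.C (r : ℤ) * Polynomial.X) * (1 - Polynomial.X) ^ r

/-- The quotient of `n ↦ (r + 1) ^ ω(n)` by the `(r + 1)`-fold divisor function. -/
noncomputable def quotientFun (r : ℕ) : ArithmeticFunction ℤ := omegaPow (r + 1) * μ ^ (r + 1)

theorem isMultiplicative_quotientFun (r : ℕ) : (quotientFun r).IsMultiplicative :=
  (isMultiplicative_omegaPow _).mul isMultiplicative_moebius.pow

theorem zeta_pow_mul_quotientFun (r : ℕ) :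
    (ζ : ArithmeticFunction ℤ) ^ (r + 1) * quotientFun r = omegaPow (r + 1) := by
  rw [quotientFun, mul_left_comm, ← mul_pow, coe_zeta_mul_moebius, one_pow, mul_one]

/-- Of the r + 1 factors 1 - X coming from μ^(r+1), one cancels the denominator of the Bell series
(1 + rX)/(1 - X) of (r+1)^ω, and r remain. -/
theorem quotientFun_prime_pow (r : ℕ) {p : ℕ} (hp : p.Prime) (j : ℕ) :
    quotientFun r (p ^ j) = (localPoly r).coeff j := by
  have h : bellSeries p (quotientFun r) = (localPoly r : PowerSeries ℤ) := by
    rw [quotientFun, bellSeries_mul hp, bellSeries_pow hp, bellSeries_moebius hp, pow_succ',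
      ← mul_assoc, bellSeries_omegaPow hp, localPoly]
    push_cast
    simp
  have := congrArg (PowerSeries.coeff j) h
  simpa [bellSeries] using this

theorem localPoly_coeff_zero (r : ℕ) : (localPoly r).coeff 0 = 1 := by
  simp [localPoly, Polynomial.coeff_zero_eq_eval_zero]

/-- This vanishing is what moves absolute convergence of the quotient series from Re s > 1 to Re s >
1/2. -/
theorem localPoly_coeff_one (r : ℕ) : (localPoly r).coeff 1 = 0 := by
  have h : Polynomial.eval 0 (Polynomial.derivative (localPoly r)) = 0 := by
    simp [localPoly, Polynomial.derivative_mul, Polynomial.derivative_pow]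
  rw [← Polynomial.coeff_zero_eq_eval_zero, Polynomial.coeff_derivative] at h
  simpa using h

theorem localPoly_eval_inv_prime (r : ℕ) (p : Nat.Primes) :
    Polynomial.aeval ((p : ℝ)⁻¹) (localPoly r) = eulerFactor r p := by
  have hp : (1 : ℝ) < p := by exact_mod_cast p.2.one_lt
  have h1 : (p : ℝ) - 1 ≠ 0 := by linarith
  have h0 : (p : ℝ) ≠ 0 := by linarith
  simp only [localPoly, eulerFactor, map_mul, map_add, map_one, map_pow, map_sub,
    Polynomial.aeval_C, Polynomial.aeval_X, one_div, pow_succ]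
  simp
  field_simp
  ring

end Arithmetic

/-! ### Dirichlet series and the Euler product -/

section DirichletSeries

open ArithmeticFunction Finset
open scoped ArithmeticFunction.zeta

/-- A nonnegative multiplicative function is summable as soon as its Euler factors exceed `1` by
a summable amount. -/
theorem summable_of_multiplicative_of_tsum_prime_pow_le {f : ℕ → ℝ} (hf0 : ∀ n, 0 ≤ f n)
    (hz : f 0 = 0) (h1 : f 1 = 1) (hmul : ∀ {m n : ℕ}, m.Coprime n → f (m * n) = f m * f n)
    (hs : ∀ {p : ℕ}, p.Prime → Summable fun e => f (p ^ e)) {b : ℕ → ℝ} (hb : Summable b)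
    (hb0 : ∀ n, 0 ≤ b n) (hle : ∀ {p : ℕ}, p.Prime → ∑' e, f (p ^ e) ≤ 1 + b p) :
    Summable f := by
  refine summable_of_sum_range_le (c := Real.exp (∑' n, b n)) hf0 fun N => ?_
  -- Every positive n < N is N-smooth, so the partial sum up to N is at most the finite Euler
  -- product over primes below N, and 1 + b ≤ exp b bounds that uniformly.
  have h := EulerProduct.summable_and_hasSum_smoothNumbers_prod_primesBelow_tsum (f := f) h1 hmul
    (fun hp => by simpa [abs_of_nonneg, hf0] using hs hp) N
  have hbound : ∏ p ∈ N.primesBelow, ∑' e, f (p ^ e) ≤ Real.exp (∑' n, b n) := by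
    calc ∏ p ∈ N.primesBelow, ∑' e, f (p ^ e) ≤ ∏ p ∈ N.primesBelow, Real.exp (b p) := by
          refine Finset.prod_le_prod (fun p _ => tsum_nonneg fun e => hf0 _) fun p hp => ?_
          have := Real.add_one_le_exp (b p)
          linarith [hle (Nat.prime_of_mem_primesBelow hp)]
      _ = Real.exp (∑ p ∈ N.primesBelow, b p) := (Real.exp_sum _ _).symm
      _ ≤ _ := Real.exp_le_exp.2 (hb.sum_le_tsum _ fun _ _ => hb0 _)
  refine le_trans ?_ hbound
  rw [← h.2.tsum_eq, ← Finset.sum_filter_add_sum_filter_not (range N) (fun n => n = 0)]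
  have hzero : ∑ n ∈ range N with n = 0, f n = 0 :=
    Finset.sum_eq_zero fun n hn => by rw [(mem_filter.1 hn).2, hz]
  rw [hzero, zero_add]
  have hmem : ∀ n ∈ (range N).filter (fun n => ¬ n = 0), n ∈ N.smoothNumbers := fun n hn => by
    rw [mem_filter, mem_range] at hn
    exact Nat.mem_smoothNumbers_of_lt (Nat.pos_of_ne_zero hn.2) hn.1
  rw [← Finset.sum_subtype_of_mem f hmem]
  exact h.2.summable.sum_le_tsum _ fun _ _ => hf0 _

/-- With q = p^(-σ) ≤ 1 and no linear term, the Euler factor of the absolute values exceeds 1 by at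
most B q², where B is the sum of the absolute coefficients; p^(-2σ) is summable because 2σ > 1. -/
theorem summable_quotientFun (r : ℕ) {σ : ℝ} (hσ : 1 / 2 < σ) :
    Summable fun n : ℕ => |(quotientFun r n : ℝ)| * (n : ℝ) ^ (-σ) := by
  set B : ℝ := ∑ j ∈ (localPoly r).support, |((localPoly r).coeff j : ℝ)| with hB
  have hB0 : 0 ≤ B := Finset.sum_nonneg fun _ _ => abs_nonneg _
  have hval : ∀ {p : ℕ}, p.Prime → ∀ e, |(quotientFun r (p ^ e) : ℝ)| * ((p ^ e : ℕ) : ℝ) ^ (-σ) =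
      |((localPoly r).coeff e : ℝ)| * ((p : ℝ) ^ (-σ)) ^ e := fun {p} hp e => by
    rw [quotientFun_prime_pow r hp, Nat.cast_pow, ← Real.rpow_natCast, ← Real.rpow_natCast,
      ← Real.rpow_mul (by positivity), ← Real.rpow_mul (by positivity), mul_comm (e : ℝ)]
  have hfin : ∀ {p : ℕ}, p.Prime → HasSum
      (fun e => |(quotientFun r (p ^ e) : ℝ)| * ((p ^ e : ℕ) : ℝ) ^ (-σ))
      (∑ e ∈ (localPoly r).support, |((localPoly r).coeff e : ℝ)| * ((p : ℝ) ^ (-σ)) ^ e) :=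
    fun {p} hp => by
      simp_rw [hval hp]
      refine hasSum_sum_of_ne_finset_zero fun e he => ?_
      rw [Polynomial.notMem_support_iff.1 he]; simp
  refine summable_of_multiplicative_of_tsum_prime_pow_le
    (f := fun n : ℕ => |(quotientFun r n : ℝ)| * (n : ℝ) ^ (-σ))
    (b := fun n => B * (n : ℝ) ^ (-(2 * σ))) (fun n => by positivity) (by simp)
    (by simp [(isMultiplicative_quotientFun r).1]) (fun {m n} hmn => ?_)
    (fun hp => (hfin hp).summable) ((Real.summable_nat_rpow.2 (by linarith)).mul_left B)
    (fun n => by positivity) (fun {p} hp => ?_)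
  · rw [(isMultiplicative_quotientFun r).2 hmn]
    push_cast
    rw [abs_mul, Real.mul_rpow (by positivity) (by positivity)]
    ring
  · rw [(hfin hp).tsum_eq]
    have hp1 : (1 : ℝ) ≤ p := by exact_mod_cast hp.one_lt.le
    have h0 : 0 ∈ (localPoly r).support := by
      rw [Polynomial.mem_support_iff, localPoly_coeff_zero]; simp
    have hq0 : 0 ≤ (p : ℝ) ^ (-σ) := by positivity
    have hq1 : (p : ℝ) ^ (-σ) ≤ 1 := Real.rpow_le_one_of_one_le_of_nonpos hp1 (by linarith)
    rw [← Finset.add_sum_erase _ _ h0, localPoly_coeff_zero]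
    simp only [Int.cast_one, abs_one, pow_zero, mul_one, add_le_add_iff_left]
    calc ∑ e ∈ (localPoly r).support.erase 0, |((localPoly r).coeff e : ℝ)| * ((p : ℝ) ^ (-σ)) ^ e
        ≤ ∑ e ∈ (localPoly r).support.erase 0,
            |((localPoly r).coeff e : ℝ)| * ((p : ℝ) ^ (-(2 * σ))) := by
          refine Finset.sum_le_sum fun e he => ?_
          rcases e with _ | _ | e
          · simp at he
          · simp [localPoly_coeff_one]
          · refine mul_le_mul_of_nonneg_left ?_ (abs_nonneg _)
            rw [show (p : ℝ) ^ (-(2 * σ)) = ((p : ℝ) ^ (-σ)) ^ 2 by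
              rw [← Real.rpow_natCast, ← Real.rpow_mul (by positivity)]; congr 1; push_cast; ring]
            exact pow_le_pow_of_le_one hq0 hq1 (by omega)
      _ ≤ _ := by
          rw [← Finset.sum_mul]
          refine mul_le_mul_of_nonneg_right ?_ (by positivity)
          exact Finset.sum_le_sum_of_subset_of_nonneg (Finset.erase_subset _ _)
            fun _ _ _ => abs_nonneg _

theorem hasProd_eulerFactor (r : ℕ) :
    HasProd (eulerFactor r) (∑' n : ℕ, (quotientFun r n : ℝ) * (n : ℝ)⁻¹) := by
  have hs := summable_quotientFun r (σ := 1) (by norm_num)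
  have h := EulerProduct.eulerProduct_hasProd
    (f := fun n : ℕ => (quotientFun r n : ℝ) * (n : ℝ)⁻¹)
    (by simp [(isMultiplicative_quotientFun r).1])
    (fun {m n} hmn => by
      rw [(isMultiplicative_quotientFun r).2 hmn]; push_cast; rw [mul_inv]; ring)
    (by simpa [Real.rpow_neg_one, abs_mul] using hs) (by simp)
  have hfac : eulerFactor r = fun p : Nat.Primes =>
      ∑' e, (quotientFun r ((p : ℕ) ^ e) : ℝ) * (((p : ℕ) ^ e : ℕ) : ℝ)⁻¹ := by
    funext p
    rw [← localPoly_eval_inv_prime, Polynomial.aeval_eq_sum_range' (Nat.lt_succ_self _),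
      tsum_eq_sum (s := range ((localPoly r).natDegree + 1))]
    · refine Finset.sum_congr rfl fun e _ => ?_
      rw [quotientFun_prime_pow r p.2]
      simp
    · intro e he
      rw [quotientFun_prime_pow r p.2, Polynomial.coeff_eq_zero_of_natDegree_lt
        (by simpa [Nat.lt_succ_iff] using he)]
      simp
  rw [hfac]
  exact h

/-- The Dirichlet series of `quotientFun r`. -/
noncomputable def quotientSeries (r : ℕ) (s : ℂ) : ℂ := LSeries (fun n => (quotientFun r n : ℂ)) s

theorem LSeriesSummable_quotientFun (r : ℕ) {s : ℂ} (hs : 1 / 2 < s.re) :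
    LSeriesSummable (fun n => (quotientFun r n : ℂ)) s := by
  refine Summable.of_norm ((summable_quotientFun r hs).congr fun n => ?_)
  rw [LSeries.norm_term_eq]
  rcases eq_or_ne n 0 with rfl | hn
  · simp
  · rw [if_neg hn, Real.rpow_neg (by positivity), div_eq_mul_inv]
    congr 1
    simp

theorem differentiableOn_quotientSeries (r : ℕ) :
    DifferentiableOn ℂ (quotientSeries r) {s | 1 / 2 < s.re} := by
  have h : LSeries.abscissaOfAbsConv (fun n => (quotientFun r n : ℂ)) ≤ ((1 / 2 : ℝ) : EReal) :=
    LSeries.abscissaOfAbsConv_le_of_forall_lt_LSeriesSummable fun y hy =>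
      LSeriesSummable_quotientFun r (by simpa using hy)
  intro s hs
  refine (LSeries_hasDerivAt (lt_of_le_of_lt h ?_)).differentiableAt.differentiableWithinAt
  exact_mod_cast hs

theorem quotientSeries_one (r : ℕ) :
    quotientSeries r 1 = ((∏' p : Nat.Primes, eulerFactor r p : ℝ) : ℂ) := by
  rw [(hasProd_eulerFactor r).tprod_eq, Complex.ofReal_tsum, quotientSeries, LSeries]
  refine tsum_congr fun n => ?_
  rcases eq_or_ne n 0 with rfl | hn
  · simp
  · rw [LSeries.term_of_ne_zero hn]; simp [div_eq_mul_inv]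

theorem exists_norm_quotientSeries_le (r : ℕ) {σ : ℝ} (hσ : 1 / 2 < σ) :
    ∃ C : ℝ, 0 ≤ C ∧ ∀ s : ℂ, σ ≤ s.re → ‖quotientSeries r s‖ ≤ C := by
  have hsum := (LSeriesSummable_quotientFun r (s := σ) (by simpa using hσ)).norm
  refine ⟨∑' n, ‖LSeries.term (fun n => (quotientFun r n : ℂ)) σ n‖,
    tsum_nonneg fun n => norm_nonneg _, fun s hs => ?_⟩
  refine tsum_of_norm_bounded hsum.hasSum fun n => LSeries.norm_term_le_of_re_le_re _ ?_ n
  simpa using hs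

theorem LSeriesHasSum_zeta_pow {s : ℂ} (hs : 1 < s.re) (n : ℕ) :
    LSeriesHasSum (fun m => (((ζ : ArithmeticFunction ℤ) ^ n) m : ℂ)) s (riemannZeta s ^ n) := by
  have hz : LSeriesHasSum (fun m => ((ζ : ArithmeticFunction ℂ) m : ℂ)) s (riemannZeta s) := by
    have := LSeriesHasSum_zeta hs
    simpa using this
  have h : ∀ n : ℕ, LSeriesHasSum (fun m => ((ζ : ArithmeticFunction ℂ) ^ n) m) s
      (riemannZeta s ^ n) := fun n => by
    induction n with
    | zero =>
      have h1 : LSeriesHasSum (LSeries.delta) s 1 := by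
        rw [LSeriesHasSum]
        convert hasSum_single (f := LSeries.term LSeries.delta s) 1 ?_ using 1
        · simp [LSeries.term, LSeries.delta]
        · intro m hm
          rcases eq_or_ne m 0 with rfl | h0
          · simp
          · simp [LSeries.term_of_ne_zero h0, LSeries.delta, hm]
      rw [pow_zero, pow_zero]
      convert h1 using 2 with m
      simp [one_apply, LSeries.delta]
    | succ n ih =>
      rw [pow_succ, pow_succ]
      exact LSeriesHasSum_mul ih hz
  convert h n using 2 with m
  have : (((ζ : ArithmeticFunction ℤ) ^ n : ArithmeticFunction ℤ) : ArithmeticFunction ℂ) =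
      (ζ : ArithmeticFunction ℂ) ^ n := by
    induction n with
    | zero => simp
    | succ n ih => rw [pow_succ, pow_succ, intCoe_mul, ih]; congr 1
  rw [← this, intCoe_apply]

theorem LSeriesHasSum_omegaPow (r : ℕ) {s : ℂ} (hs : 1 < s.re) :
    LSeriesHasSum (fun m => (omegaPow (r + 1) m : ℂ)) s
      (riemannZeta s ^ (r + 1) * quotientSeries r s) := by
  have h1 := LSeriesHasSum_zeta_pow hs (r + 1)
  have h2 : LSeriesHasSum (fun n => (quotientFun r n : ℂ)) s (quotientSeries r s) :=
    (LSeriesSummable_quotientFun r (by linarith)).LSeriesHasSum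
  have h := LSeriesHasSum_mul (f := (((ζ : ArithmeticFunction ℤ) ^ (r + 1) :
    ArithmeticFunction ℤ) : ArithmeticFunction ℂ)) (g := (quotientFun r : ArithmeticFunction ℂ))
    (by simpa using h1) (by simpa using h2)
  rw [← intCoe_mul, zeta_pow_mul_quotientFun] at h
  simpa using h

end DirichletSeries

/-! ### Exponential sums -/

section ExponentialSums

open Finset Real

/-- The additive character `x ↦ exp(2πix)`. -/
noncomputable def addChar (x : ℝ) : ℂ := Complex.exp ((2 * π * x : ℝ) * Complex.I)

theorem norm_addChar (x : ℝ) : ‖addChar x‖ = 1 := Complex.norm_exp_ofReal_mul_I _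

theorem addChar_add (x y : ℝ) : addChar (x + y) = addChar x * addChar y := by
  rw [addChar, addChar, addChar, ← Complex.exp_add]; congr 1; push_cast; ring

theorem addChar_int (m : ℤ) : addChar m = 1 := by
  rw [addChar, ← Complex.exp_int_mul_two_pi_mul_I m]; congr 1; push_cast; ring

theorem conj_addChar (x : ℝ) : (starRingEnd ℂ) (addChar x) = addChar (-x) := by
  rw [addChar, addChar, ← Complex.exp_conj, map_mul, Complex.conj_ofReal, Complex.conj_I]
  congr 1; push_cast; ring

/-- The second factor is the inverse of e(δ) - 1 in cotangent form. Its real part is constant, so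
only the monotone cotangent varies in the Kusmin–Landau argument. -/
theorem addChar_sub_one_mul {δ : ℝ} (h : sin (π * δ) ≠ 0) :
    (addChar δ - 1) * (-(1 / 2) - Complex.I / 2 * ((cos (π * δ) / sin (π * δ) : ℝ) : ℂ)) = 1 := by
  have h1 : addChar δ = ((cos (π * δ) : ℝ) + (sin (π * δ) : ℝ) * Complex.I) ^ 2 := by
    rw [Complex.ofReal_cos, Complex.ofReal_sin, ← Complex.exp_mul_I, addChar, ← Complex.exp_nat_mul]
    congr 1; push_cast; ring
  have h2 : ((sin (π * δ) : ℝ) : ℂ) ^ 2 + ((cos (π * δ) : ℝ) : ℂ) ^ 2 = 1 := by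
    exact_mod_cast sin_sq_add_cos_sq (π * δ)
  have h3 : ((sin (π * δ) : ℝ) : ℂ) ≠ 0 := by exact_mod_cast h
  rw [h1, Complex.ofReal_div]
  generalize ((cos (π * δ) : ℝ) : ℂ) = c at *
  generalize ((sin (π * δ) : ℝ) : ℂ) = s at *
  field_simp
  have hI : Complex.I ^ 2 = -1 := Complex.I_sq
  have hI3 : Complex.I ^ 3 = -Complex.I := by rw [pow_succ, hI]; ring
  ring_nf
  rw [hI3, hI]
  linear_combination (s - c * Complex.I) * h2

theorem sin_pi_mul_ge {θ δ : ℝ} (h1 : θ ≤ δ) (h2 : δ ≤ 1 - θ) (hθ : 0 < θ) :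
    2 * θ ≤ sin (π * δ) := by
  have hπ := pi_pos
  rcases le_total δ (1 / 2) with h | h
  · have := mul_le_sin (x := π * δ) (by nlinarith) (by nlinarith)
    have h3 : 2 / π * (π * δ) = 2 * δ := by field_simp
    linarith
  · have := mul_le_sin (x := π * (1 - δ)) (by nlinarith) (by nlinarith)
    have h3 : 2 / π * (π * (1 - δ)) = 2 * (1 - δ) := by field_simp
    rw [show π * (1 - δ) = π - π * δ by ring, sin_pi_sub] at this
    rw [show π * (1 - δ) = π - π * δ by ring] at h3
    linarith

theorem cot_antitone {a b : ℝ} (hab : a ≤ b) (hb : b - a ≤ π) (h1 : 0 < sin a) (h2 : 0 < sin b) :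
    cos b / sin b ≤ cos a / sin a := by
  rw [div_le_div_iff₀ h2 h1]
  have := sin_nonneg_of_nonneg_of_le_pi (x := b - a) (by linarith) hb
  rw [sin_sub] at this
  linarith

/-- The **Kusmin–Landau inequality**. -/
theorem norm_sum_addChar_le_of_diff_mem {x : ℕ → ℝ} {N : ℕ} {θ : ℝ} (hθ : 0 < θ)
    (h : ∀ n < N, θ ≤ x (n + 1) - x n ∧ x (n + 1) - x n ≤ 1 - θ)
    (hmono : ∀ n, n + 1 < N → x (n + 1) - x n ≤ x (n + 2) - x (n + 1)) :
    ‖∑ n ∈ range N, addChar (x n)‖ ≤ 2 / θ := by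
  set κ : ℕ → ℝ := fun n => cos (π * (x (n + 1) - x n)) / sin (π * (x (n + 1) - x n)) with hκ
  set c : ℕ → ℂ := fun n => -(1 / 2) - Complex.I / 2 * (κ n : ℂ) with hc
  have hsin : ∀ n < N, 2 * θ ≤ sin (π * (x (n + 1) - x n)) :=
    fun n hn => sin_pi_mul_ge (h n hn).1 (h n hn).2 hθ
  -- Each term becomes a difference with a slowly varying weight, ready for summation by parts.
  have hce : ∀ n < N, addChar (x n) = c n * (addChar (x (n + 1)) - addChar (x n)) := fun n hn => by
    have h1 := addChar_sub_one_mul (δ := x (n + 1) - x n) (by linarith [hsin n hn])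
    have h2 : addChar (x (n + 1)) = addChar (x (n + 1) - x n) * addChar (x n) := by
      rw [← addChar_add]; congr 1; ring
    rw [h2]
    linear_combination (-addChar (x n)) * h1
  have hκb : ∀ n < N, |κ n| ≤ 1 / (2 * θ) := fun n hn => by
    have hs := hsin n hn
    rw [hκ, abs_div, abs_of_pos (by linarith : 0 < sin (π * (x (n + 1) - x n)))]
    exact div_le_div₀ zero_le_one (abs_cos_le_one _) (by linarith) hs
  have hcb : ∀ n < N, ‖c n‖ ≤ 1 / 2 + |κ n| / 2 := fun n hn => by
    refine (norm_sub_le _ _).trans (le_of_eq ?_)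
    simp
    ring
  have hstep : ∀ n, n + 1 < N → ‖c n - c (n + 1)‖ = (κ n - κ (n + 1)) / 2 := fun n hn => by
    have hle : κ (n + 1) ≤ κ n := by
      have hd := hmono n hn
      have h1 := h n (by omega)
      have h2 := h (n + 1) hn
      refine cot_antitone (by gcongr) ?_ (by linarith [hsin n (by omega)])
        (by linarith [hsin (n + 1) hn])
      nlinarith [pi_pos]
    have : c n - c (n + 1) = -(Complex.I / 2 * ((κ n - κ (n + 1) : ℝ) : ℂ)) := by
      simp only [hc]; push_cast; ring
    rw [this, norm_neg, norm_mul, Complex.norm_real, Real.norm_of_nonneg (by linarith)]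
    simp
    ring
  -- Summation by parts, one step at a time. The differences increase, so the cotangents decrease
  -- and the total variation of `c` telescopes to (κ 0 - κ n)/2.
  have hind : ∀ n < N, ‖∑ i ∈ range (n + 1), addChar (x i) - c n * addChar (x (n + 1))‖ ≤
      ‖c 0‖ + (κ 0 - κ n) / 2 := fun n => by
    induction n with
    | zero =>
      intro hn
      have := hce 0 hn
      rw [show ∑ i ∈ range (0 + 1), addChar (x i) - c 0 * addChar (x (0 + 1)) =
        -(c 0 * addChar (x 0)) by simp only [zero_add, sum_range_one] at this ⊢
                                  linear_combination this]
      simp [norm_addChar]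
    | succ n ih =>
      intro hn
      have h1 := ih (by omega)
      have h2 := hce (n + 1) hn
      rw [sum_range_succ, show ∑ i ∈ range (n + 1), addChar (x i) + addChar (x (n + 1)) -
        c (n + 1) * addChar (x (n + 1 + 1)) = (∑ i ∈ range (n + 1), addChar (x i) -
          c n * addChar (x (n + 1))) + (c n - c (n + 1)) * addChar (x (n + 1)) by
            linear_combination h2]
      refine (norm_add_le _ _).trans ?_
      rw [norm_mul, norm_addChar, mul_one, hstep n hn]
      linarith
  rcases Nat.eq_zero_or_pos N with rfl | hN
  · simp; positivity
  · obtain ⟨n, rfl⟩ : ∃ n, N = n + 1 := ⟨N - 1, by omega⟩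
    have h1 := hind n (by omega)
    have h2 := norm_add_le (∑ i ∈ range (n + 1), addChar (x i) - c n * addChar (x (n + 1)))
      (c n * addChar (x (n + 1)))
    rw [sub_add_cancel, norm_mul, norm_addChar, mul_one] at h2
    have h3 := hcb n (by omega)
    have h4 := hcb 0 (by omega)
    have h5 := hκb n (by omega)
    have h6 := hκb 0 (by omega)
    have h7 := le_abs_self (κ 0)
    have h8 := neg_abs_le (κ n)
    have h9 : θ ≤ 1 := by linarith [h n (by omega)]
    have h10 : 1 ≤ 1 / θ := by rw [le_div_iff₀ hθ]; linarith
    have h11 : 1 / (2 * θ) = 1 / θ / 2 := by field_simp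
    have h12 : 2 / θ = 2 * (1 / θ) := by ring
    linarith

/-- The Kusmin–Landau inequality over an interval of integers, with differences in the middle of
`[m, m + 1]`. -/
theorem norm_sum_addChar_le_of_ordConnected {x : ℕ → ℝ} {s : Finset ℕ} {θ : ℝ} (hθ : 0 < θ)
    (m : ℤ) (hs : ∀ a ∈ s, ∀ b ∈ s, ∀ n, a ≤ n → n ≤ b → n ∈ s)
    (h : ∀ n ∈ s, m + θ ≤ x (n + 1) - x n ∧ x (n + 1) - x n ≤ m + 1 - θ)
    (hmono : ∀ n ∈ s, n + 1 ∈ s → x (n + 1) - x n ≤ x (n + 2) - x (n + 1)) :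
    ‖∑ n ∈ s, addChar (x n)‖ ≤ 2 / θ := by
  rcases s.eq_empty_or_nonempty with rfl | hne
  · simp; positivity
  set a := s.min' hne with ha
  set b := s.max' hne with hb
  have hmem : ∀ n, n ∈ s ↔ a ≤ n ∧ n < b + 1 := fun n =>
    ⟨fun hn => ⟨s.min'_le n hn, Nat.lt_succ_of_le (s.le_max' n hn)⟩,
      fun hn => hs a (s.min'_mem hne) b (s.max'_mem hne) n hn.1 (by omega)⟩
  have hs' : s = Ico a (b + 1) := by ext n; rw [hmem, mem_Ico]
  -- Subtracting the integer m n leaves e(x) unchanged and moves the differences from [m + θ, m + 1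
  -- - θ] to [θ, 1 - θ].
  have hper : ∀ n : ℕ, addChar (x (a + n)) = addChar (x (a + n) - m * n) := fun n => by
    have h1 := addChar_add (x (a + n) - m * n) ((m * n : ℤ) : ℝ)
    rw [addChar_int, mul_one] at h1
    rw [← h1]; congr 1; push_cast; ring
  rw [hs', sum_Ico_eq_sum_range, Finset.sum_congr rfl fun n _ => hper n]
  refine norm_sum_addChar_le_of_diff_mem (x := fun n => x (a + n) - m * n) hθ (fun n hn => ?_)
    (fun n hn => ?_)
  · have := h (a + n) ((hmem _).2 (by omega))
    simp only [← add_assoc]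
    push_cast
    constructor <;> linarith
  · have := hmono (a + n) ((hmem _).2 (by omega)) ((hmem _).2 (by omega))
    simp only [← add_assoc]
    push_cast
    linarith

end ExponentialSums

/-! ### The second derivative test and Weyl differencing -/

section ExponentialSums

open Finset Real

theorem card_le_of_separated {d : ℕ → ℝ} {s : Finset ℕ} {l θ u : ℝ} (hl : 0 < l) (hθ : 0 ≤ θ)
    (hsep : ∀ i ∈ s, ∀ j ∈ s, i ≤ j → ((j : ℝ) - i) * l ≤ d j - d i)
    (hs : ∀ n ∈ s, u ≤ d n ∧ d n ≤ u + θ) : (#s : ℝ) ≤ θ / l + 1 := by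
  rcases s.eq_empty_or_nonempty with rfl | hne
  · simp; positivity
  have hsub : s ⊆ Icc (s.min' hne) (s.max' hne) := fun n hn =>
    mem_Icc.2 ⟨s.min'_le n hn, s.le_max' n hn⟩
  have hle : s.min' hne ≤ s.max' hne := s.min'_le _ (s.max'_mem hne)
  have h1 := hsep _ (s.min'_mem hne) _ (s.max'_mem hne) hle
  have h2 := hs _ (s.min'_mem hne)
  have h3 := hs _ (s.max'_mem hne)
  have h4 : (#s : ℝ) ≤ (s.max' hne : ℝ) - s.min' hne + 1 := by
    have := card_le_card hsub
    rw [Nat.card_Icc] at this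
    have h5 : #s + s.min' hne ≤ s.max' hne + 1 := by omega
    have : (#s : ℝ) + s.min' hne ≤ s.max' hne + 1 := by exact_mod_cast h5
    linarith
  have h6 : (s.max' hne : ℝ) - s.min' hne ≤ θ / l := by
    rw [le_div_iff₀ hl]; linarith
  linarith

/-- **Van der Corput's second derivative test**, in terms of second differences. -/
theorem norm_sum_addChar_le_of_second_diff {x : ℕ → ℝ} {N : ℕ} {l A : ℝ} (hl : 0 < l)
    (hl1 : l ≤ 1) (hA : 0 ≤ A)
    (h : ∀ n, n + 1 < N → l ≤ (x (n + 2) - x (n + 1)) - (x (n + 1) - x n) ∧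
      (x (n + 2) - x (n + 1)) - (x (n + 1) - x n) ≤ A) :
    ‖∑ n ∈ range N, addChar (x n)‖ ≤ 6 * (A * N + 2) / √l := by
  set d : ℕ → ℝ := fun n => x (n + 1) - x n with hd
  have hsep : ∀ i j, i ≤ j → j < N → ((j : ℝ) - i) * l ≤ d j - d i ∧
      d j - d i ≤ ((j : ℝ) - i) * A := fun i j hij => by
    induction j, hij using Nat.le_induction with
    | base => intro _; simp
    | succ j hij ih =>
      intro hj
      have h1 := ih (by omega)
      have h2 := h j hj
      have h3 : d (j + 1) - d j = (x (j + 2) - x (j + 1)) - (x (j + 1) - x j) := rfl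
      push_cast
      constructor <;> nlinarith
  have hsl : 0 < √l := Real.sqrt_pos.2 hl
  have hsl1 : √l ≤ 1 := Real.sqrt_le_one.2 hl1
  have hdiv : √l / l = 1 / √l := by
    rw [div_eq_div_iff hl.ne' hsl.ne', one_mul, Real.mul_self_sqrt hl.le]
  have hone : 1 ≤ 1 / √l := by rw [le_div_iff₀ hsl]; linarith
  have hmon : ∀ i j, i ≤ j → j < N → d i ≤ d j := fun i j hij hj => by
    have h1 := (hsep i j hij hj).1
    have h2 : (0 : ℝ) ≤ ((j : ℝ) - i) * l :=
      mul_nonneg (sub_nonneg.2 (by exact_mod_cast hij)) hl.le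
    linarith
  rcases Nat.eq_zero_or_pos N with rfl | hN
  · simp; positivity
  -- Split the indices with difference in [m, m + 1) into three pieces. Within √l of either end
  -- there are at most √l/l + 1 ≤ 2/√l indices, counted trivially; in the middle Kusmin–Landau with
  -- θ = √l gives 2/√l again.
  have hfib : ∀ m : ℤ, ‖∑ n ∈ range N with ⌊d n⌋ = m, addChar (x n)‖ ≤ 6 / √l := fun m => by
    set s := (range N).filter (fun n => ⌊d n⌋ = m) with hs
    have hmem : ∀ n ∈ s, n < N ∧ (m : ℝ) ≤ d n ∧ d n < m + 1 := fun n hn => by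
      rw [hs, mem_filter, mem_range, Int.floor_eq_iff] at hn
      exact hn
    have hcard : ∀ (t : Finset ℕ) (u : ℝ), t ⊆ s → (∀ n ∈ t, u ≤ d n ∧ d n ≤ u + √l) →
        ‖∑ n ∈ t, addChar (x n)‖ ≤ 2 / √l := fun t u ht hu => by
      calc ‖∑ n ∈ t, addChar (x n)‖ ≤ ∑ n ∈ t, 1 :=
            norm_sum_le_of_le _ fun n _ => (norm_addChar _).le
        _ = (#t : ℝ) := by simp
        _ ≤ √l / l + 1 := card_le_of_separated hl hsl.le
            (fun i _ j hj hij => (hsep i j hij (hmem j (ht hj)).1).1) hu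
        _ ≤ 2 / √l := by rw [hdiv]; linarith [show 2 / √l = 2 * (1 / √l) by ring]
    rw [← sum_filter_add_sum_filter_not s (fun n => d n < m + √l),
      ← sum_filter_add_sum_filter_not (s.filter fun n => ¬ d n < m + √l)
        (fun n => m + 1 - √l < d n)]
    have h1 := hcard (s.filter fun n => d n < m + √l) m (filter_subset _ _) fun n hn => by
      rw [mem_filter] at hn
      exact ⟨(hmem n hn.1).2.1, hn.2.le⟩
    have h2 := hcard ((s.filter fun n => ¬ d n < m + √l).filter fun n => m + 1 - √l < d n)
      (m + 1 - √l) ((filter_subset _ _).trans (filter_subset _ _)) fun n hn => by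
        rw [mem_filter, mem_filter] at hn
        refine ⟨hn.2.le, ?_⟩
        have := (hmem n hn.1.1).2.2
        linarith
    have hiff : ∀ n, n ∈ (s.filter fun n => ¬ d n < m + √l).filter
        (fun n => ¬ m + 1 - √l < d n) ↔ n < N ∧ m + √l ≤ d n ∧ d n ≤ m + 1 - √l := fun n => by
      rw [mem_filter, mem_filter, not_lt, not_lt]
      constructor
      · rintro ⟨⟨h1, h2⟩, h3⟩
        exact ⟨(hmem n h1).1, h2, h3⟩
      · rintro ⟨h1, h2, h3⟩
        refine ⟨⟨?_, h2⟩, h3⟩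
        rw [hs, mem_filter, mem_range, Int.floor_eq_iff]
        exact ⟨h1, by linarith, by linarith⟩
    have h3 := norm_sum_addChar_le_of_ordConnected (x := x)
      (s := (s.filter fun n => ¬ d n < m + √l).filter fun n => ¬ m + 1 - √l < d n) hsl m
      (fun a ha b hb n han hnb => by
        rw [hiff] at ha hb ⊢
        have h1 := hmon a n han (by omega)
        have h2 := hmon n b hnb hb.1
        exact ⟨by omega, by linarith, by linarith⟩)
      (fun n hn => ((hiff n).1 hn).2)
      (fun n _ hn => hmon n (n + 1) (by omega) ((hiff _).1 hn).1)
    have h4 := norm_add_le (∑ n ∈ (s.filter fun n => ¬ d n < m + √l).filter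
      (fun n => m + 1 - √l < d n), addChar (x n)) (∑ n ∈ (s.filter fun n => ¬ d n < m + √l).filter
      (fun n => ¬ m + 1 - √l < d n), addChar (x n))
    refine (norm_add_le _ _).trans ?_
    have h5 : 6 / √l = 2 / √l + 2 / √l + 2 / √l := by ring
    linarith
  have hmaps : ∀ n ∈ range N, ⌊d n⌋ ∈ Icc ⌊d 0⌋ ⌊d (N - 1)⌋ := fun n hn => by
    rw [mem_range] at hn
    exact mem_Icc.2 ⟨Int.floor_le_floor (hmon 0 n (by omega) hn),
      Int.floor_le_floor (hmon n (N - 1) (by omega) (by omega))⟩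
  rw [← sum_fiberwise_of_maps_to hmaps]
  calc ‖∑ m ∈ Icc ⌊d 0⌋ ⌊d (N - 1)⌋, ∑ n ∈ range N with ⌊d n⌋ = m, addChar (x n)‖
      ≤ ∑ m ∈ Icc ⌊d 0⌋ ⌊d (N - 1)⌋, 6 / √l := norm_sum_le_of_le _ fun m _ => hfib m
    _ = (#(Icc ⌊d 0⌋ ⌊d (N - 1)⌋) : ℝ) * (6 / √l) := by simp
    -- The differences increase by at most A N in total, so their floors take at most A N + 2
    -- values.
    _ ≤ (A * N + 2) * (6 / √l) := by
        refine mul_le_mul_of_nonneg_right ?_ (by positivity)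
        rw [Int.card_Icc]
        have hle : ⌊d 0⌋ ≤ ⌊d (N - 1)⌋ := Int.floor_le_floor (hmon 0 (N - 1) (by omega) (by omega))
        have h1 : (((⌊d (N - 1)⌋ + 1 - ⌊d 0⌋).toNat : ℤ) : ℝ) = ⌊d (N - 1)⌋ + 1 - ⌊d 0⌋ := by
          rw [Int.toNat_of_nonneg (by omega)]; push_cast; ring
        have h2 := (hsep 0 (N - 1) (by omega) (by omega)).2
        have h3 := Int.floor_le (d (N - 1))
        have h4 := Int.sub_one_lt_floor (d 0)
        rw [← Int.cast_natCast, h1]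
        have h6 : (((N - 1 : ℕ) : ℝ) - (0 : ℕ)) * A ≤ A * N := by
          rw [Nat.cast_sub (by omega)]; push_cast; nlinarith
        linarith
    _ = _ := by ring

/-- With truncated subtraction, h - h' + (h' - h) is |h - h'|; a nonzero distance is attained at
most once on each side of h. -/
theorem sum_natDist_le (f : ℕ → ℝ) (hf : ∀ d, 0 ≤ f d) {H h : ℕ} (hh : h < H) :
    ∑ h' ∈ range H, f (h - h' + (h' - h)) ≤ f 0 + 2 * ∑ d ∈ Ico 1 H, f d := by
  have hlt : ∑ h' ∈ range H with h' < h, f (h - h' + (h' - h)) ≤ ∑ d ∈ Ico 1 H, f d := by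
    rw [← Finset.sum_image (s := (range H).filter (· < h)) (g := fun h' => h - h' + (h' - h))
      (f := f) (fun a ha b hb hab => by
        simp only [coe_filter, Set.mem_ofPred_eq] at ha hb hab; omega)]
    refine Finset.sum_le_sum_of_subset_of_nonneg (fun d hd => ?_) fun _ _ _ => hf _
    simp only [mem_image, mem_filter, mem_range, mem_Ico] at hd ⊢
    obtain ⟨a, ha, rfl⟩ := hd
    omega
  have hgt : ∑ h' ∈ range H with h < h', f (h - h' + (h' - h)) ≤ ∑ d ∈ Ico 1 H, f d := by
    rw [← Finset.sum_image (s := (range H).filter (h < ·)) (g := fun h' => h - h' + (h' - h))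
      (f := f) (fun a ha b hb hab => by
        simp only [coe_filter, Set.mem_ofPred_eq] at ha hb hab; omega)]
    refine Finset.sum_le_sum_of_subset_of_nonneg (fun d hd => ?_) fun _ _ _ => hf _
    simp only [mem_image, mem_filter, mem_range, mem_Ico] at hd ⊢
    obtain ⟨a, ha, rfl⟩ := hd
    omega
  have hsplit : ∑ h' ∈ range H, f (h - h' + (h' - h)) =
      ∑ h' ∈ range H with h' < h, f (h - h' + (h' - h)) +
        (f 0 + ∑ h' ∈ range H with h < h', f (h - h' + (h' - h))) := by
    rw [← Finset.sum_filter_add_sum_filter_not (range H) (· < h)]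
    congr 1
    rw [show (range H).filter (fun h' => ¬ h' < h) =
      insert h ((range H).filter (fun h' => h < h')) by
        ext n; simp only [mem_filter, mem_insert, mem_range]; omega, Finset.sum_insert (by simp)]
    simp
  linarith

/-- The **Weyl–van der Corput inequality**. -/
theorem mul_norm_sum_sq_le {z : ℕ → ℂ} (hz : ∀ n, ‖z n‖ ≤ 1) (L : ℕ) {H : ℕ} (hH : 0 < H)
    {B : ℕ → ℝ} (hB : ∀ d, 0 ≤ B d) (hcorr : ∀ d ∈ Ico 1 H,
      ‖∑ n ∈ range (L - d), z (n + d) * (starRingEnd ℂ) (z n)‖ ≤ B d) :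
    (H : ℝ) * ‖∑ n ∈ range L, z n‖ ^ 2 ≤ (L + H) * (L + 2 * ∑ d ∈ Ico 1 H, B d) := by
  -- `Z h` is the sequence shifted by h and padded with zeros. Summing over all H shifts gives H
  -- copies of the sum, spread over L + H positions; Cauchy–Schwarz over the positions and expansion
  -- of the square leave the correlations at distance |h - h'|.
  set Z : ℕ → ℕ → ℂ := fun h m => if h ≤ m ∧ m < L + h then z (m - h) else 0 with hZ
  have hshift : ∀ (h K : ℕ) (g : ℕ → ℂ), K + h ≤ L + H →
      ∑ m ∈ range (L + H), (if h ≤ m ∧ m < K + h then g (m - h) else 0) =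
        ∑ n ∈ range K, g n := fun h K g hK => by
    rw [← Finset.sum_filter]
    refine Finset.sum_nbij' (fun m => m - h) (fun n => n + h) ?_ ?_ ?_ ?_ ?_ <;>
      intro a ha <;> simp only [mem_filter, mem_range] at ha ⊢ <;> omega
  have hsumZ : ∀ h < H, ∑ m ∈ range (L + H), Z h m = ∑ n ∈ range L, z n := fun h hh =>
    hshift h L z (by omega)
  set Bt : ℕ → ℝ := fun d => if d = 0 then (L : ℝ) else B d with hBt
  have hBt0 : ∀ d, 0 ≤ Bt d := fun d => by
    simp only [hBt]; split_ifs
    · positivity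
    · exact hB d
  have hcorr' : ∀ h < H, ∀ h' < H, h ≤ h' →
      ‖∑ m ∈ range (L + H), Z h m * (starRingEnd ℂ) (Z h' m)‖ ≤ Bt (h' - h) := by
    intro h hh h' hh' hle
    have h1 : ∑ m ∈ range (L + H), Z h m * (starRingEnd ℂ) (Z h' m) =
        ∑ n ∈ range (L - (h' - h)), z (n + (h' - h)) * (starRingEnd ℂ) (z n) := by
      rw [← hshift h' (L - (h' - h)) (fun n => z (n + (h' - h)) * (starRingEnd ℂ) (z n)) (by omega)]
      refine Finset.sum_congr rfl fun m _ => ?_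
      simp only [hZ]
      by_cases h2 : h' ≤ m ∧ m < L - (h' - h) + h'
      · rw [if_pos (by omega), if_pos (by omega), if_pos h2,
          show m - h' + (h' - h) = m - h by omega]
      · rw [if_neg h2]
        by_cases h3 : h ≤ m ∧ m < L + h
        · rw [if_neg (by omega : ¬ (h' ≤ m ∧ m < L + h'))]; simp
        · rw [if_neg h3, zero_mul]
    rw [h1]
    rcases Nat.eq_zero_or_pos (h' - h) with h0 | h0
    · rw [h0]
      simp only [hBt, if_true, add_zero, Nat.sub_zero]
      calc ‖∑ n ∈ range L, z n * (starRingEnd ℂ) (z n)‖ ≤ ∑ n ∈ range L, 1 := by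
            refine norm_sum_le_of_le _ fun n _ => ?_
            rw [norm_mul, RCLike.norm_conj]
            exact mul_le_one₀ (hz n) (norm_nonneg _) (hz n)
        _ = L := by simp
    · simp only [hBt, if_neg h0.ne']
      exact hcorr _ (mem_Ico.2 ⟨h0, by omega⟩)
  have hcorr'' : ∀ h < H, ∀ h' < H,
      (∑ m ∈ range (L + H), Z h m * (starRingEnd ℂ) (Z h' m)).re ≤ Bt (h - h' + (h' - h)) := by
    intro h hh h' hh'
    refine (Complex.re_le_norm _).trans ?_
    rcases le_total h h' with hle | hle
    · rw [show h - h' + (h' - h) = h' - h by omega]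
      exact hcorr' h hh h' hh' hle
    · rw [show h - h' + (h' - h) = h - h' by omega, ← RCLike.norm_conj, map_sum]
      simp only [map_mul, Complex.conj_conj]
      rw [Finset.sum_congr rfl fun m _ => mul_comm ((starRingEnd ℂ) (Z h m)) (Z h' m)]
      exact hcorr' h' hh' h hh hle
  have hsq : ∑ m ∈ range (L + H), ‖∑ h ∈ range H, Z h m‖ ^ 2 ≤
      H * (L + 2 * ∑ d ∈ Ico 1 H, B d) := by
    have h1 : ∀ m, ‖∑ h ∈ range H, Z h m‖ ^ 2 =
        ∑ h ∈ range H, ∑ h' ∈ range H, (Z h m * (starRingEnd ℂ) (Z h' m)).re := fun m => by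
      have h2 : ((‖∑ h ∈ range H, Z h m‖ ^ 2 : ℝ) : ℂ) =
          (∑ h ∈ range H, Z h m) * (starRingEnd ℂ) (∑ h ∈ range H, Z h m) := by
        rw [Complex.mul_conj, Complex.normSq_eq_norm_sq]
      rw [map_sum, Finset.sum_mul_sum] at h2
      have := congrArg Complex.re h2
      rw [Complex.ofReal_re] at this
      rw [this]; simp
    calc ∑ m ∈ range (L + H), ‖∑ h ∈ range H, Z h m‖ ^ 2
        = ∑ h ∈ range H, ∑ h' ∈ range H,
            (∑ m ∈ range (L + H), Z h m * (starRingEnd ℂ) (Z h' m)).re := by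
          simp_rw [h1, Complex.re_sum]
          rw [Finset.sum_comm]
          exact Finset.sum_congr rfl fun h _ => Finset.sum_comm
      _ ≤ ∑ h ∈ range H, ∑ h' ∈ range H, Bt (h - h' + (h' - h)) :=
          Finset.sum_le_sum fun h hh => Finset.sum_le_sum fun h' hh' =>
            hcorr'' h (mem_range.1 hh) h' (mem_range.1 hh')
      _ ≤ ∑ h ∈ range H, ((L : ℝ) + 2 * ∑ d ∈ Ico 1 H, B d) := by
          refine Finset.sum_le_sum fun h hh => ?_
          refine (sum_natDist_le Bt hBt0 (mem_range.1 hh)).trans (le_of_eq ?_)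
          have : ∑ d ∈ Ico 1 H, Bt d = ∑ d ∈ Ico 1 H, B d :=
            Finset.sum_congr rfl fun d hd => by
              simp only [hBt]; rw [if_neg (by have := (mem_Ico.1 hd).1; omega)]
          rw [this]; simp [hBt]
      _ = _ := by rw [Finset.sum_const, card_range, nsmul_eq_mul]
  have hmain : (H : ℝ) ^ 2 * ‖∑ n ∈ range L, z n‖ ^ 2 ≤
      (L + H) * (H * (L + 2 * ∑ d ∈ Ico 1 H, B d)) := by
    have h1 : (H : ℂ) * ∑ n ∈ range L, z n = ∑ m ∈ range (L + H), ∑ h ∈ range H, Z h m := by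
      rw [Finset.sum_comm, Finset.sum_congr rfl fun h hh => hsumZ h (mem_range.1 hh)]; simp
    have h2 : (H : ℝ) * ‖∑ n ∈ range L, z n‖ ≤
        ∑ m ∈ range (L + H), ‖∑ h ∈ range H, Z h m‖ := by
      rw [← Complex.norm_natCast, ← norm_mul, h1]
      exact norm_sum_le _ _
    rw [← mul_pow]
    calc ((H : ℝ) * ‖∑ n ∈ range L, z n‖) ^ 2
        ≤ (∑ m ∈ range (L + H), ‖∑ h ∈ range H, Z h m‖) ^ 2 := by gcongr
      _ ≤ #(range (L + H)) * ∑ m ∈ range (L + H), ‖∑ h ∈ range H, Z h m‖ ^ 2 :=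
          sq_sum_le_card_mul_sum_sq
      _ ≤ _ := by
          rw [card_range]; push_cast
          exact mul_le_mul_of_nonneg_left hsq (by positivity)
  have hH' : (0 : ℝ) < H := by exact_mod_cast hH
  refine le_of_mul_le_mul_left ?_ hH'
  linarith

end ExponentialSums

/-! ### Derivative tests for the phase -c log n on a dyadic block -/

section LogarithmicPhase

open Finset Real

theorem second_diff_log_bounds {v : ℝ} (hv : 0 < v) :
    1 / (v + 1) ^ 2 ≤ 2 * log (v + 1) - log v - log (v + 2) ∧
      2 * log (v + 1) - log v - log (v + 2) ≤ 1 / (v * (v + 2)) := by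
  have h1 : 2 * log (v + 1) - log v - log (v + 2) = log ((v + 1) ^ 2 / (v * (v + 2))) := by
    rw [log_div (by positivity) (by positivity), log_pow, log_mul (by positivity) (by positivity)]
    push_cast; ring
  rw [h1]
  constructor
  · refine le_trans (le_of_eq ?_) (one_sub_inv_le_log_of_pos (by positivity))
    field_simp; ring
  · refine (log_le_sub_one_of_pos (by positivity)).trans (le_of_eq ?_)
    field_simp; ring

/-- A second difference of log equals -log(1 - 1/(v+1)²), so the quantity is the logarithm of a
single ratio (1 - b)/(1 - a), squeezed by 1 - 1/u ≤ log u ≤ u - 1. The hypothesis v ≥ 1 forces a ≤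
1/4, whence 1/(1 - a) ≤ 4/3. -/
theorem third_diff_log_bounds {v d : ℝ} (hv : 1 ≤ v) (hd : 0 ≤ d) :
    1 / (v + 1) ^ 2 - 1 / (v + d + 1) ^ 2 ≤
        (2 * log (v + 1) - log v - log (v + 2)) -
          (2 * log (v + d + 1) - log (v + d) - log (v + d + 2)) ∧
      (2 * log (v + 1) - log v - log (v + 2)) -
          (2 * log (v + d + 1) - log (v + d) - log (v + d + 2)) ≤
        4 / 3 * (1 / (v + 1) ^ 2 - 1 / (v + d + 1) ^ 2) := by
  have h0 : ∀ u : ℝ, 1 ≤ u → 2 * log (u + 1) - log u - log (u + 2) =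
      -log (1 - 1 / (u + 1) ^ 2) := fun u hu => by
    have h2 : 1 - 1 / (u + 1) ^ 2 = (u * (u + 2)) / (u + 1) ^ 2 := by field_simp; ring
    rw [h2, log_div (by positivity) (by positivity), log_pow,
      log_mul (by positivity) (by positivity)]
    push_cast; ring
  rw [h0 v hv, h0 (v + d) (by linarith)]
  set a := 1 / (v + 1) ^ 2 with ha
  set b := 1 / (v + d + 1) ^ 2 with hb
  have ha4 : a ≤ 1 / 4 := by
    rw [ha]; exact one_div_le_one_div_of_le (by norm_num) (by nlinarith)
  have hba : b ≤ a := one_div_le_one_div_of_le (by positivity) (by gcongr; linarith)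
  have hb0 : 0 < b := by positivity
  have h1 : -log (1 - a) - -log (1 - b) = log ((1 - b) / (1 - a)) := by
    rw [log_div (by linarith) (by linarith)]; ring
  rw [h1]
  have hpos : 0 < (1 - b) / (1 - a) := div_pos (by linarith) (by linarith)
  constructor
  · refine le_trans ?_ (one_sub_inv_le_log_of_pos hpos)
    rw [inv_div, one_sub_div (by linarith), le_div_iff₀ (by linarith)]
    nlinarith
  · refine (log_le_sub_one_of_pos hpos).trans ?_
    rw [div_sub_one (by linarith), div_le_iff₀ (by linarith)]
    nlinarith

/-- The phase `-c log(M + n)`. -/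
noncomputable def logPhase (c : ℝ) (M n : ℕ) : ℝ := -(c * log ((M : ℝ) + n))

theorem logPhase_second_diff (c : ℝ) (M n : ℕ) :
    (logPhase c M (n + 2) - logPhase c M (n + 1)) - (logPhase c M (n + 1) - logPhase c M n) =
      c * (2 * log ((M + n : ℝ) + 1) - log (M + n : ℝ) - log ((M + n : ℝ) + 2)) := by
  simp only [logPhase]
  push_cast
  rw [← add_assoc, ← add_assoc]
  ring

/-- On a block of length at most M starting at M, the second differences lie between c/(4M²) and
c/M²; `hcM` is the requirement l ≤ 1 of the second derivative test. -/
theorem norm_sum_logPhase_le_second {c : ℝ} (hc : 0 < c) {M L : ℕ} (hM : 1 ≤ M) (hL : L ≤ M)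
    (hcM : c ≤ 4 * (M : ℝ) ^ 2) :
    ‖∑ n ∈ range L, addChar (logPhase c M n)‖ ≤ 12 * √c + 24 * M / √c := by
  have hM0 : (0 : ℝ) < M := by exact_mod_cast hM
  have h := norm_sum_addChar_le_of_second_diff (x := logPhase c M) (N := L)
    (l := c / (4 * (M : ℝ) ^ 2)) (A := c / (M : ℝ) ^ 2) (by positivity)
    ((div_le_one (by positivity)).2 hcM) (by positivity) (fun n hn => by
      rw [logPhase_second_diff]
      have h1 := second_diff_log_bounds (v := M + n) (by positivity)
      have h2 : (M : ℝ) + n + 1 ≤ 2 * M := by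
        have : M + n + 1 ≤ 2 * M := by omega
        exact_mod_cast this
      have hn0 : (0 : ℝ) ≤ n := by positivity
      constructor
      · rw [div_eq_mul_one_div]
        refine mul_le_mul_of_nonneg_left (le_trans ?_ h1.1) hc.le
        refine one_div_le_one_div_of_le (by positivity) ?_
        nlinarith
      · rw [div_eq_mul_one_div c ((M : ℝ) ^ 2)]
        refine mul_le_mul_of_nonneg_left (h1.2.trans ?_) hc.le
        refine one_div_le_one_div_of_le (by positivity) ?_
        nlinarith)
  refine h.trans ?_
  have hs : √(c / (4 * (M : ℝ) ^ 2)) = √c / (2 * M) := by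
    rw [show 4 * (M : ℝ) ^ 2 = (2 * M) ^ 2 by ring, sqrt_div hc.le, sqrt_sq (by positivity)]
  have hsc : 0 < √c := sqrt_pos.2 hc
  have hLM : (L : ℝ) ≤ M := by exact_mod_cast hL
  rw [hs, div_div_eq_mul_div, div_le_iff₀ hsc, add_mul, div_mul_cancel₀ _ hsc.ne',
    mul_assoc 12, mul_self_sqrt hc.le]
  have h1 : c / (M : ℝ) ^ 2 * L ≤ c / M := by
    calc c / (M : ℝ) ^ 2 * L ≤ c / (M : ℝ) ^ 2 * M := by gcongr
      _ = c / M := by field_simp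
  calc 6 * (c / (M : ℝ) ^ 2 * L + 2) * (2 * M) ≤ 6 * (c / M + 2) * (2 * M) := by gcongr
    _ = 12 * c + 24 * M := by field_simp; ring

/-- For long blocks the first differences lie in [-c/M, -c/(2M)], inside [-1/2, 0), so Kusmin–Landau
applies once to the whole block, with m = -1 and θ = c/(2M). -/
theorem norm_sum_logPhase_le_first {c : ℝ} (hc : 0 < c) {M L : ℕ} (hM : 1 ≤ M) (hL : L ≤ M)
    (hcM : 2 * c ≤ M) :
    ‖∑ n ∈ range L, addChar (logPhase c M n)‖ ≤ 4 * M / c := by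
  have hM0 : (0 : ℝ) < M := by exact_mod_cast hM
  have hdiff : ∀ n, logPhase c M (n + 1) - logPhase c M n =
      -(c * log (((M : ℝ) + n + 1) / (M + n))) := fun n => by
    rw [log_div (by positivity) (by positivity)]
    simp only [logPhase]
    push_cast
    rw [← add_assoc]; ring
  have h := norm_sum_addChar_le_of_ordConnected (x := logPhase c M) (s := range L)
    (θ := c / (2 * M)) (by positivity) (-1)
    (fun a _ b hb n _ hnb => by rw [mem_range] at hb ⊢; omega)
    (fun n hn => by
      rw [hdiff]
      have hn0 : (0 : ℝ) ≤ n := by positivity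
      have h2 : (M : ℝ) + n + 1 ≤ 2 * M := by
        have : M + n + 1 ≤ 2 * M := by rw [mem_range] at hn; omega
        exact_mod_cast this
      have hpos : 0 < ((M : ℝ) + n + 1) / (M + n) := by positivity
      have hu : log (((M : ℝ) + n + 1) / (M + n)) ≤ 1 / M := by
        refine (log_le_sub_one_of_pos hpos).trans ?_
        rw [div_sub_one (by positivity)]
        exact div_le_div₀ zero_le_one (by linarith) hM0 (by linarith)
      have hl : 1 / (2 * M) ≤ log (((M : ℝ) + n + 1) / (M + n)) := by
        refine le_trans ?_ (one_sub_inv_le_log_of_pos hpos)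
        rw [inv_div, one_sub_div (by positivity)]
        exact div_le_div₀ (by linarith) (by linarith) (by positivity) h2
      have h3 := mul_le_mul_of_nonneg_left hu hc.le
      have h4 := mul_le_mul_of_nonneg_left hl hc.le
      have h5 : c * (1 / M) ≤ 1 / 2 := by
        rw [mul_one_div, div_le_iff₀ hM0]; linarith
      have h6 : c / (2 * M) = c * (1 / M) / 2 := by field_simp
      have h7 : c * (1 / (2 * M)) = c / (2 * M) := by ring
      push_cast
      constructor <;> linarith)
    (fun n _ _ => by
      have h1 := logPhase_second_diff c M n
      have h2 := second_diff_log_bounds (v := M + n) (by positivity)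
      have h3 : 0 ≤ c * (2 * log ((M + n : ℝ) + 1) - log (M + n : ℝ) - log ((M + n : ℝ) + 2)) :=
        mul_nonneg hc.le (le_trans (by positivity) h2.1)
      linarith)
  refine h.trans (le_of_eq ?_)
  field_simp; ring

/-- The differenced phase has second differences of size c d/M³, a third derivative of the original
phase, so the second derivative test bounds the correlations needed by Weyl differencing. -/
theorem norm_sum_logPhase_corr_le {c : ℝ} (hc : 0 < c) {M L d : ℕ} (hM : 1 ≤ M) (hL : L ≤ M)
    (hd : 1 ≤ d) (hcd : c * d ≤ 4 * (M : ℝ) ^ 3) :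
    ‖∑ n ∈ range (L - d), addChar (logPhase c M (n + d)) *
        (starRingEnd ℂ) (addChar (logPhase c M n))‖ ≤
      36 * √(c * d) / √M + 24 * (M * √M) / √(c * d) := by
  have hM0 : (0 : ℝ) < M := by exact_mod_cast hM
  have hd0 : (0 : ℝ) < d := by exact_mod_cast hd
  -- Conjugation reverses the sign of the phase, making its second differences positive.
  have hconj : ‖∑ n ∈ range (L - d), addChar (logPhase c M (n + d)) *
        (starRingEnd ℂ) (addChar (logPhase c M n))‖ =
      ‖∑ n ∈ range (L - d), addChar (logPhase c M n - logPhase c M (n + d))‖ := by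
    rw [← RCLike.norm_conj, map_sum]
    congr 1
    refine Finset.sum_congr rfl fun n _ => ?_
    rw [map_mul, Complex.conj_conj, conj_addChar, ← addChar_add]
    congr 1; ring
  have h := norm_sum_addChar_le_of_second_diff
    (x := fun n => logPhase c M n - logPhase c M (n + d)) (N := L - d)
    (l := c * d / (4 * (M : ℝ) ^ 3)) (A := 3 * (c * d) / (M : ℝ) ^ 3) (by positivity)
    ((div_le_one (by positivity)).2 hcd) (by positivity) (fun n hn => by
      have e1 := logPhase_second_diff c M n
      have e2 := logPhase_second_diff c M (n + d)
      have h1 := third_diff_log_bounds (v := (M : ℝ) + n) (d := d)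
        (by have : (1 : ℝ) ≤ M := by exact_mod_cast hM
            have : (0 : ℝ) ≤ n := by positivity
            linarith) hd0.le
      have e3 : (logPhase c M (n + 2) - logPhase c M (n + 2 + d) -
          (logPhase c M (n + 1) - logPhase c M (n + 1 + d))) -
          (logPhase c M (n + 1) - logPhase c M (n + 1 + d) -
          (logPhase c M n - logPhase c M (n + d))) =
          c * ((2 * log ((M : ℝ) + n + 1) - log ((M : ℝ) + n) - log ((M : ℝ) + n + 2)) -
          (2 * log ((M : ℝ) + n + d + 1) - log ((M : ℝ) + n + d) -
            log ((M : ℝ) + n + d + 2))) := by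
        rw [show n + 2 + d = n + d + 2 by ring, show n + 1 + d = n + d + 1 by ring]
        push_cast at e2
        rw [← add_assoc] at e2
        linear_combination e1 - e2
      rw [e3]
      set w : ℝ := (M : ℝ) + n + 1 with hw
      have hw' : (M : ℝ) + n + d + 1 = w + d := by rw [hw]; ring
      have hn0 : (0 : ℝ) ≤ n := by positivity
      have hwM : (M : ℝ) ≤ w := by linarith
      have hwd : w + d ≤ 2 * M := by
        have : M + n + 1 + d ≤ 2 * M := by omega
        rw [hw]; exact_mod_cast this
      rw [hw'] at h1 ⊢
      have hw0 : 0 < w := by linarith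
      have hform : 1 / w ^ 2 - 1 / (w + d) ^ 2 = d * (2 * w + d) / (w ^ 2 * (w + d) ^ 2) := by
        field_simp; ring
      have hlow : d / (4 * (M : ℝ) ^ 3) ≤ 1 / w ^ 2 - 1 / (w + d) ^ 2 := by
        rw [hform, show d / (4 * (M : ℝ) ^ 3) = d * (2 * w) / (w ^ 2 * (8 * M ^ 3 / w)) by
          field_simp; ring]
        have : (w + d) ^ 2 ≤ 8 * (M : ℝ) ^ 3 / w := by
          rw [le_div_iff₀ hw0]
          calc (w + d) ^ 2 * w ≤ (2 * M) ^ 2 * (2 * M) := by gcongr; linarith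
            _ = 8 * (M : ℝ) ^ 3 := by ring
        gcongr
        linarith
      have hup : 4 / 3 * (1 / w ^ 2 - 1 / (w + d) ^ 2) ≤ 3 * d / (M : ℝ) ^ 3 := by
        rw [hform]
        calc 4 / 3 * (d * (2 * w + d) / (w ^ 2 * (w + d) ^ 2))
            ≤ 4 / 3 * (d * (2 * (w + d)) / (w ^ 2 * (w + d) ^ 2)) := by gcongr; linarith
          _ = 8 / 3 * d / (w ^ 2 * (w + d)) := by field_simp; ring
          _ ≤ 3 * d / ((M : ℝ) ^ 2 * M) := by gcongr <;> linarith
          _ = _ := by ring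
      constructor
      · rw [mul_div_assoc]
        exact mul_le_mul_of_nonneg_left (hlow.trans h1.1) hc.le
      · rw [show 3 * (c * d) / (M : ℝ) ^ 3 = c * (3 * d / (M : ℝ) ^ 3) by ring]
        exact mul_le_mul_of_nonneg_left (h1.2.trans hup) hc.le)
  rw [hconj]
  refine h.trans ?_
  have hcd0 : 0 < c * d := by positivity
  have hsM : 0 < √(M : ℝ) := sqrt_pos.2 hM0
  have hsc : 0 < √(c * d) := sqrt_pos.2 hcd0
  have hMs : (M : ℝ) = √M * √M := (mul_self_sqrt hM0.le).symm
  have hcs : c * d = √(c * d) * √(c * d) := (mul_self_sqrt hcd0.le).symm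
  have hs : √(c * d / (4 * (M : ℝ) ^ 3)) = √(c * d) / (2 * (M * √M)) := by
    rw [sqrt_div hcd0.le]
    congr 1
    rw [sqrt_eq_iff_mul_self_eq (by positivity) (by positivity)]
    linear_combination (4 * (M : ℝ) ^ 2) * hMs
  have hLM : ((L - d : ℕ) : ℝ) ≤ M := by
    have : L - d ≤ M := by omega
    exact_mod_cast this
  rw [hs, div_div_eq_mul_div, div_le_iff₀ hsc, add_mul, div_mul_cancel₀ _ hsc.ne']
  calc 6 * (3 * (c * d) / (M : ℝ) ^ 3 * ((L - d : ℕ) : ℝ) + 2) * (2 * (M * √M))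
      ≤ 6 * (3 * (c * d) / (M : ℝ) ^ 3 * M + 2) * (2 * (M * √M)) := by gcongr
    _ = 36 * (c * d) * √M / M + 24 * (M * √M) := by field_simp; ring
    _ = 36 * √(c * d) / √M * √(c * d) + 24 * (M * √M) := by
        congr 1
        rw [div_mul_eq_mul_div, div_eq_div_iff hM0.ne' hsM.ne']
        linear_combination (-36 * c * d) * hMs + 36 * (M : ℝ) * hcs

end LogarithmicPhase

/-! ### Sums of n^(-it) of Weyl strength -/

section LogarithmicPhase

open Finset Real

theorem sum_Ico_inv_sqrt_le (n : ℕ) : ∑ d ∈ Ico 1 (n + 1), 1 / √(d : ℝ) ≤ 2 * √(n : ℝ) := by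
  induction n with
  | zero => simp
  | succ n ih =>
    rw [Finset.sum_Ico_succ_top (by omega)]
    have h1 : 0 < √((n + 1 : ℕ) : ℝ) := sqrt_pos.2 (by positivity)
    have h2 : √((n + 1 : ℕ) : ℝ) * √((n + 1 : ℕ) : ℝ) = n + 1 := by
      rw [mul_self_sqrt (by positivity)]; push_cast; ring
    have h3 : √(n : ℝ) * √(n : ℝ) = n := mul_self_sqrt (by positivity)
    have h4 : 1 / √((n + 1 : ℕ) : ℝ) ≤ 2 * √((n + 1 : ℕ) : ℝ) - 2 * √(n : ℝ) := by
      rw [div_le_iff₀ h1]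
      nlinarith [sq_nonneg (√((n + 1 : ℕ) : ℝ) - √(n : ℝ))]
    linarith

theorem norm_sum_logPhase_le_third {c τ : ℝ} (hτ : 1 ≤ τ) (hc1 : τ ^ 6 / 9 ≤ c) (hc2 : c ≤ τ ^ 6)
    {M L : ℕ} (hM1 : τ ^ 2 ≤ M) (hM2 : (M : ℝ) ≤ τ ^ 4) (hL : L ≤ M) :
    ‖∑ n ∈ range L, addChar (logPhase c M n)‖ ≤ 38 * √M * τ := by
  have hτ0 : 0 < τ := by linarith
  have hc : 0 < c := lt_of_lt_of_le (by positivity) hc1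
  have hM0 : (0 : ℝ) < M := lt_of_lt_of_le (by positivity) hM1
  have hM : 1 ≤ M := by exact_mod_cast hM0
  -- With c of size τ⁶, this H makes the correlation sum O(M): its first part is about τ³ H^(3/2)/√M
  -- = M, and its second about M² / τ⁴ ≤ M. The square of the sum is then about M²/H = M τ².
  set H := ⌊(M : ℝ) / τ ^ 2⌋₊ with hHdef
  have hη : 1 ≤ (M : ℝ) / τ ^ 2 := by rw [le_div_iff₀ (by positivity)]; linarith
  have hH1 : 1 ≤ H := Nat.le_floor (by simpa using hη)
  have hHle : (H : ℝ) ≤ M / τ ^ 2 := Nat.floor_le (by positivity)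
  have hHge : (M : ℝ) / τ ^ 2 ≤ 2 * H := by
    have h1 := Nat.lt_floor_add_one ((M : ℝ) / τ ^ 2)
    have h2 : (1 : ℝ) ≤ H := by exact_mod_cast hH1
    rw [← hHdef] at h1
    linarith
  have hHM : (H : ℝ) ≤ M := hHle.trans (div_le_self hM0.le (one_le_pow₀ hτ))
  have hsc1 : τ ^ 3 / 3 ≤ √c := le_sqrt_of_sq_le (by linarith [show (τ ^ 3 / 3) ^ 2 = τ ^ 6 / 9 by ring])
  have hsc2 : √c ≤ τ ^ 3 := sqrt_le_iff.2 ⟨by positivity, by linarith [show (τ ^ 3) ^ 2 = τ ^ 6 by ring]⟩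
  have hsc : 0 < √c := sqrt_pos.2 hc
  set m := √(M : ℝ) with hm
  have hm0 : 0 < m := sqrt_pos.2 hM0
  have hmM : m ^ 2 = M := sq_sqrt hM0.le
  have hmτ : m ≤ τ ^ 2 := sqrt_le_iff.2 ⟨by positivity, by linarith [show (τ ^ 2) ^ 2 = τ ^ 4 by ring]⟩
  set h := √(H : ℝ) with hh
  have hh0 : 0 ≤ h := sqrt_nonneg _
  have hhH : h ^ 2 = H := sq_sqrt (by positivity)
  have hhm : h ≤ m / τ := by
    refine sqrt_le_iff.2 ⟨by positivity, ?_⟩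
    rw [div_pow, hmM]; exact hHle
  set B : ℕ → ℝ := fun d => 36 * √(c * d) / √M + 24 * (M * √M) / √(c * d) with hB
  have key := mul_norm_sum_sq_le (z := fun n => addChar (logPhase c M n))
    (fun n => (norm_addChar _).le) L hH1 (B := B) (fun d => by positivity) (fun d hd => by
      rw [mem_Ico] at hd
      refine norm_sum_logPhase_corr_le hc hM hL hd.1 ?_
      have hdH : (d : ℝ) ≤ M / τ ^ 2 := le_trans (by exact_mod_cast hd.2.le) hHle
      calc c * d ≤ τ ^ 6 * (M / τ ^ 2) := by gcongr
        _ = τ ^ 4 * M := by field_simp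
        _ ≤ (M : ℝ) ^ 2 * M := by
            gcongr
            calc τ ^ 4 = (τ ^ 2) ^ 2 := by ring
              _ ≤ _ := by gcongr
        _ ≤ 4 * (M : ℝ) ^ 3 := by nlinarith [pow_pos hM0 3])
  have hBsum : ∑ d ∈ Ico 1 H, B d ≤ 180 * M := by
    have h1 : ∀ d ∈ Ico 1 H, B d ≤ 36 * √c * h / m + 24 * m ^ 3 / √c * (1 / √(d : ℝ)) := by
      intro d hd
      rw [mem_Ico] at hd
      have hdh : √(d : ℝ) ≤ h := sqrt_le_sqrt (by exact_mod_cast hd.2.le)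
      have hd0 : 0 < √(d : ℝ) := sqrt_pos.2 (by exact_mod_cast hd.1)
      simp only [hB]
      rw [sqrt_mul hc.le, ← hm, ← hmM]
      refine add_le_add ?_ (le_of_eq ?_)
      · rw [mul_assoc]; gcongr
      · field_simp
    calc ∑ d ∈ Ico 1 H, B d
        ≤ ∑ d ∈ Ico 1 H, (36 * √c * h / m + 24 * m ^ 3 / √c * (1 / √(d : ℝ))) :=
          Finset.sum_le_sum h1
      _ = ((H - 1 : ℕ) : ℝ) * (36 * √c * h / m) +
            24 * m ^ 3 / √c * ∑ d ∈ Ico 1 H, 1 / √(d : ℝ) := by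
          rw [Finset.sum_add_distrib, ← Finset.mul_sum]; simp
      _ ≤ (m ^ 2 / τ ^ 2) * (36 * τ ^ 3 * (m / τ) / m) +
            24 * m ^ 3 / (τ ^ 3 / 3) * (2 * (m / τ)) := by
          have hsum : ∑ d ∈ Ico 1 H, 1 / √(d : ℝ) ≤ 2 * h := by
            obtain ⟨n, hn⟩ : ∃ n, H = n + 1 := ⟨H - 1, by omega⟩
            rw [hn]
            refine (sum_Ico_inv_sqrt_le n).trans ?_
            have : √(n : ℝ) ≤ h := sqrt_le_sqrt (by rw [hn]; push_cast; linarith)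
            linarith
          have hH' : ((H - 1 : ℕ) : ℝ) ≤ m ^ 2 / τ ^ 2 := by
            rw [hmM]
            refine le_trans ?_ hHle
            exact_mod_cast Nat.sub_le H 1
          gcongr
          linarith
      _ = 36 * m ^ 2 + 144 * m ^ 2 * (m / τ ^ 2) ^ 2 := by field_simp; ring
      _ ≤ 36 * m ^ 2 + 144 * m ^ 2 * 1 := by
          have : m / τ ^ 2 ≤ 1 := (div_le_one (by positivity)).2 hmτ
          gcongr
          exact pow_le_one₀ (by positivity) this
      _ = 180 * M := by rw [hmM]; ring
  have hLM : (L : ℝ) ≤ M := by exact_mod_cast hL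
  set S := ‖∑ n ∈ range L, addChar (logPhase c M n)‖ with hS
  have h1 : (H : ℝ) * S ^ 2 ≤ 722 * (M : ℝ) ^ 2 := by
    refine key.trans ?_
    calc ((L : ℝ) + H) * (L + 2 * ∑ d ∈ Ico 1 H, B d) ≤ (M + M) * (M + 2 * (180 * M)) := by
          have : 0 ≤ ∑ d ∈ Ico 1 H, B d := Finset.sum_nonneg fun d _ => by positivity
          gcongr
      _ = _ := by ring
  have h2 : (M : ℝ) / τ ^ 2 * S ^ 2 ≤ 2 * (722 * (M : ℝ) ^ 2) := by
    calc (M : ℝ) / τ ^ 2 * S ^ 2 ≤ 2 * H * S ^ 2 := by gcongr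
      _ ≤ _ := by linarith
  -- The constant comes from 2 · 722 = 38².
  have h3 : S ^ 2 ≤ (38 * m * τ) ^ 2 := by
    rw [div_mul_eq_mul_div, div_le_iff₀ (by positivity)] at h2
    have : (M : ℝ) * S ^ 2 ≤ M * (38 * m * τ) ^ 2 := by
      rw [mul_pow, mul_pow, hmM]
      nlinarith
    exact le_of_mul_le_mul_left this hM0
  exact le_of_sq_le_sq h3 (by positivity)

/-- Four ranges all give √M τ: the trivial bound up to τ², Weyl differencing up to τ⁴, the second
derivative test up to τ⁸, and Kusmin–Landau up to τ¹². -/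
theorem norm_sum_logPhase_block_le {c τ : ℝ} (hτ : 1 ≤ τ) (hc1 : τ ^ 6 / 9 ≤ c)
    (hc2 : c ≤ τ ^ 6 / 2) {M L : ℕ} (hM : 1 ≤ M) (hMτ : (M : ℝ) ≤ τ ^ 12) (hL : L ≤ M) :
    ‖∑ n ∈ range L, addChar (logPhase c M n)‖ ≤ 84 * √M * τ := by
  have hτ0 : 0 < τ := by linarith
  have hc : 0 < c := lt_of_lt_of_le (by positivity) hc1
  have hM0 : (0 : ℝ) < M := by exact_mod_cast hM
  have hτ6 : 0 < τ ^ 6 := by positivity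
  set m := √(M : ℝ) with hm
  have hm0 : 0 < m := sqrt_pos.2 hM0
  have hmM : m ^ 2 = M := sq_sqrt hM0.le
  have hmτ0 : 0 < m * τ := by positivity
  rcases le_total (M : ℝ) (τ ^ 2) with h1 | h1
  · calc ‖∑ n ∈ range L, addChar (logPhase c M n)‖ ≤ ∑ n ∈ range L, 1 :=
          norm_sum_le_of_le _ fun n _ => (norm_addChar _).le
      _ = (L : ℝ) := by simp
      _ ≤ M := by exact_mod_cast hL
      _ = m * m := by rw [← hmM]; ring
      _ ≤ m * τ := by
          gcongr
          exact sqrt_le_iff.2 ⟨by positivity, h1⟩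
      _ ≤ 84 * m * τ := by nlinarith
  rcases le_total (M : ℝ) (τ ^ 4) with h2 | h2
  · refine (norm_sum_logPhase_le_third hτ hc1 (by linarith) h1 h2 hL).trans ?_
    nlinarith
  rcases le_total (M : ℝ) (τ ^ 8) with h3 | h3
  · have hτ48 : τ ^ 6 ≤ τ ^ 8 := pow_le_pow_right₀ hτ (by norm_num)
    have hMsq : τ ^ 8 ≤ (M : ℝ) ^ 2 := by
      calc τ ^ 8 = (τ ^ 4) ^ 2 := by ring
        _ ≤ _ := by gcongr
    refine (norm_sum_logPhase_le_second hc hM hL (by linarith)).trans ?_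
    have hsc1 : τ ^ 3 / 3 ≤ √c :=
      le_sqrt_of_sq_le (by linarith [show (τ ^ 3 / 3) ^ 2 = τ ^ 6 / 9 by ring])
    have hsc2 : √c ≤ τ ^ 3 :=
      sqrt_le_iff.2 ⟨by positivity, by linarith [show (τ ^ 3) ^ 2 = τ ^ 6 by ring]⟩
    have hm1 : τ ^ 2 ≤ m := le_sqrt_of_sq_le (by linarith [show (τ ^ 2) ^ 2 = τ ^ 4 by ring])
    have hm2 : m ≤ τ ^ 4 :=
      sqrt_le_iff.2 ⟨by positivity, by linarith [show (τ ^ 4) ^ 2 = τ ^ 8 by ring]⟩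
    calc 12 * √c + 24 * M / √c ≤ 12 * τ ^ 3 + 24 * M / (τ ^ 3 / 3) := by gcongr
      _ = 12 * (τ ^ 2 * τ) + 72 * (m * (m / τ ^ 4) * τ) := by rw [← hmM]; field_simp; ring
      _ ≤ 12 * (m * τ) + 72 * (m * 1 * τ) := by
          have : m / τ ^ 4 ≤ 1 := (div_le_one (by positivity)).2 hm2
          gcongr
      _ = 84 * m * τ := by ring
  · have hτ68 : τ ^ 6 ≤ τ ^ 8 := pow_le_pow_right₀ hτ (by norm_num)
    refine (norm_sum_logPhase_le_first hc hM hL (by linarith)).trans ?_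
    have hm2 : m ≤ τ ^ 6 :=
      sqrt_le_iff.2 ⟨by positivity, by linarith [show (τ ^ 6) ^ 2 = τ ^ 12 by ring]⟩
    calc 4 * M / c ≤ 4 * M / (τ ^ 6 / 9) := by gcongr
      _ = 36 * (m * (m / τ ^ 6)) := by rw [← hmM]; field_simp; ring
      _ ≤ 36 * (m * 1) := by
          have : m / τ ^ 6 ≤ 1 := (div_le_one (by positivity)).2 hm2
          gcongr
      _ ≤ 84 * m * τ := by nlinarith

/-- Peel off the top dyadic block and recurse on the rest, of length at most N/2. Since √(1/2) ≤
18/25, the constant closes up: 300 · 18/25 + 84 = 300. -/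
theorem norm_sum_logPhase_le {c τ : ℝ} (hτ : 1 ≤ τ) (hc1 : τ ^ 6 / 9 ≤ c) (hc2 : c ≤ τ ^ 6 / 2)
    (N : ℕ) (hN : (N : ℝ) ≤ τ ^ 12) :
    ‖∑ n ∈ range N, addChar (logPhase c 1 n)‖ ≤ 300 * τ * √N := by
  have hτ0 : 0 < τ := by linarith
  induction N using Nat.strong_induction_on with
  | _ N ih =>
    rcases Nat.eq_zero_or_pos N with rfl | hN0
    · simp
    set M := (N + 2) / 2 with hM
    have hM1 : 1 ≤ M := by omega
    have hMN : M ≤ N := by omega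
    have hle : N + 1 - M ≤ M := by omega
    have hsplit : ∑ n ∈ range N, addChar (logPhase c 1 n) =
        ∑ n ∈ range (M - 1), addChar (logPhase c 1 n) +
          ∑ n ∈ range (N + 1 - M), addChar (logPhase c M n) := by
      rw [show N = (M - 1) + (N + 1 - M) by omega, Finset.sum_range_add,
        show M - 1 + (N + 1 - M) + 1 - M = N + 1 - M by omega]
      congr 1
      refine Finset.sum_congr rfl fun n _ => ?_
      simp only [logPhase]
      rw [Nat.cast_add, Nat.cast_sub hM1]
      congr 4
      push_cast; ring
    have hMr : (M : ℝ) ≤ N := by exact_mod_cast hMN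
    have h1 := ih (M - 1) (by omega)
      (le_trans (by exact_mod_cast (by omega : M - 1 ≤ N)) hN)
    have h2 := norm_sum_logPhase_block_le hτ hc1 hc2 hM1 (hMr.trans hN) hle
    have h3 : √((M - 1 : ℕ) : ℝ) ≤ 18 / 25 * √(N : ℝ) := by
      refine sqrt_le_iff.2 ⟨by positivity, ?_⟩
      rw [mul_pow, sq_sqrt (by positivity)]
      have : 2 * (M - 1) ≤ N := by omega
      have : 2 * ((M - 1 : ℕ) : ℝ) ≤ N := by exact_mod_cast this
      have : (0 : ℝ) ≤ N := by positivity
      linarith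
    have h4 : √(M : ℝ) ≤ √(N : ℝ) := sqrt_le_sqrt hMr
    rw [hsplit]
    refine (norm_add_le _ _).trans ?_
    calc _ ≤ 300 * τ * √((M - 1 : ℕ) : ℝ) + 84 * √M * τ := add_le_add h1 h2
      _ ≤ 300 * τ * (18 / 25 * √(N : ℝ)) + 84 * √N * τ := by gcongr
      _ = 300 * τ * √N := by ring

/-- Partial summation against a decreasing weight. -/
theorem norm_sum_mul_le_of_antitone {a : ℕ → ℂ} {w b : ℕ → ℝ} (hw : Antitone w)
    (hw0 : ∀ n, 0 ≤ w n) (N : ℕ) (hb0 : 0 ≤ b 0)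
    (hb : ∀ n ≤ N, ‖∑ i ∈ range n, a i‖ ≤ b n) :
    ‖∑ n ∈ range N, (w n : ℂ) * a n‖ ≤ w 0 * b 0 + ∑ n ∈ range N, w n * (b (n + 1) - b n) := by
  rcases N with _ | N
  · simpa using mul_nonneg (hw0 0) hb0
  have hind : ∀ n ≤ N, ‖∑ i ∈ range (n + 1), (w i : ℂ) * a i - w n * ∑ i ∈ range (n + 1), a i‖ ≤
      w 0 * b 0 + ∑ i ∈ range n, w i * (b (i + 1) - b i) - w n * b n := fun n => by
    induction n with
    | zero => intro _; simp
    | succ n ih =>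
      intro hn
      have h1 := ih (by omega)
      have h2 : ∑ i ∈ range (n + 1 + 1), (w i : ℂ) * a i -
          w (n + 1) * ∑ i ∈ range (n + 1 + 1), a i =
          (∑ i ∈ range (n + 1), (w i : ℂ) * a i - w n * ∑ i ∈ range (n + 1), a i) +
            ((w n - w (n + 1) : ℝ) : ℂ) * ∑ i ∈ range (n + 1), a i := by
        rw [sum_range_succ _ (n + 1), sum_range_succ a (n + 1)]; push_cast; ring
      have hd : 0 ≤ w n - w (n + 1) := sub_nonneg.2 (hw (Nat.le_succ n))
      rw [h2]
      refine (norm_add_le _ _).trans ?_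
      rw [norm_mul, Complex.norm_real, Real.norm_of_nonneg hd,
        sum_range_succ (fun i => w i * (b (i + 1) - b i))]
      have h3 := mul_le_mul_of_nonneg_left (hb (n + 1) (by omega)) hd
      linarith
  have h1 := hind N le_rfl
  have h2 := norm_add_le (∑ i ∈ range (N + 1), (w i : ℂ) * a i - w N * ∑ i ∈ range (N + 1), a i)
    (w N * ∑ i ∈ range (N + 1), a i)
  rw [sub_add_cancel, norm_mul, Complex.norm_real, Real.norm_of_nonneg (hw0 N)] at h2
  have h3 := mul_le_mul_of_nonneg_left (hb (N + 1) le_rfl) (hw0 N)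
  rw [sum_range_succ (fun i => w i * (b (i + 1) - b i))]
  linarith

/-- Partial summation against n^(-σ) turns the bound τ√n into τ ∑ n^(-σ-1/2), which converges as σ >
1/2; hence the bound does not depend on N. -/
theorem exists_norm_sum_rpow_mul_logPhase_le {σ : ℝ} (hσ : 1 / 2 < σ) :
    ∃ C : ℝ, 0 ≤ C ∧ ∀ c τ : ℝ, 1 ≤ τ → τ ^ 6 / 9 ≤ c → c ≤ τ ^ 6 / 2 → ∀ N : ℕ,
      (N : ℝ) ≤ τ ^ 12 →
      ‖∑ n ∈ range N, ((((n : ℝ) + 1) ^ (-σ) : ℝ) : ℂ) * addChar (logPhase c 1 n)‖ ≤ C * τ := by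
  have hsum : Summable fun n : ℕ => ((n : ℝ) + 1) ^ (-(σ + 1 / 2)) := by
    have := (summable_nat_add_iff 1).2 (Real.summable_nat_rpow (p := -(σ + 1 / 2)) |>.2 (by linarith))
    simpa using this
  refine ⟨300 * ∑' n : ℕ, ((n : ℝ) + 1) ^ (-(σ + 1 / 2)), mul_nonneg (by norm_num)
    (tsum_nonneg fun n => by positivity), fun c τ hτ hc1 hc2 N hN => ?_⟩
  have hτ0 : 0 < τ := by linarith
  have h := norm_sum_mul_le_of_antitone (a := fun n => addChar (logPhase c 1 n))
    (w := fun n : ℕ => ((n : ℝ) + 1) ^ (-σ)) (b := fun n : ℕ => 300 * τ * √n)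
    (fun m n hmn => Real.rpow_le_rpow_of_nonpos (by positivity)
      (by have : (m : ℝ) ≤ n := by exact_mod_cast hmn
          linarith) (by linarith))
    (fun n => by positivity) N (by simp)
    (fun n hn => norm_sum_logPhase_le hτ hc1 hc2 n (le_trans (by exact_mod_cast hn) hN))
  refine h.trans ?_
  have h2 : ∀ n : ℕ, ((n : ℝ) + 1) ^ (-σ) * (300 * τ * √((n + 1 : ℕ) : ℝ) - 300 * τ * √n) ≤
      300 * τ * ((n : ℝ) + 1) ^ (-(σ + 1 / 2)) := fun n => by
    have hs : 0 < √((n + 1 : ℕ) : ℝ) := sqrt_pos.2 (by positivity)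
    have h3 : √((n + 1 : ℕ) : ℝ) - √n ≤ ((n : ℝ) + 1) ^ (-(1 / 2) : ℝ) := by
      rw [Real.rpow_neg (by positivity), ← Real.sqrt_eq_rpow, ← one_div,
        show (n : ℝ) + 1 = ((n + 1 : ℕ) : ℝ) by push_cast; ring, le_div_iff₀ hs]
      have h4 : √((n + 1 : ℕ) : ℝ) * √((n + 1 : ℕ) : ℝ) = n + 1 := by
        rw [mul_self_sqrt (by positivity)]; push_cast; ring
      have h5 : √(n : ℝ) * √(n : ℝ) = n := mul_self_sqrt (by positivity)
      have h6 : √(n : ℝ) ≤ √((n + 1 : ℕ) : ℝ) := sqrt_le_sqrt (by push_cast; linarith)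
      nlinarith [sqrt_nonneg (n : ℝ)]
    calc ((n : ℝ) + 1) ^ (-σ) * (300 * τ * √((n + 1 : ℕ) : ℝ) - 300 * τ * √n)
        = 300 * τ * (((n : ℝ) + 1) ^ (-σ) * (√((n + 1 : ℕ) : ℝ) - √n)) := by ring
      _ ≤ 300 * τ * (((n : ℝ) + 1) ^ (-σ) * ((n : ℝ) + 1) ^ (-(1 / 2) : ℝ)) := by gcongr
      _ = _ := by
          rw [← Real.rpow_add (by positivity), show -σ + -(1 / 2) = -(σ + 1 / 2) by ring]
  calc _ ≤ ∑ n ∈ range N, 300 * τ * ((n : ℝ) + 1) ^ (-(σ + 1 / 2)) := by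
        simp only [Nat.cast_zero, sqrt_zero, mul_zero, zero_add]
        exact Finset.sum_le_sum fun n _ => h2 n
    _ ≤ 300 * τ * ∑' n : ℕ, ((n : ℝ) + 1) ^ (-(σ + 1 / 2)) := by
        rw [← Finset.mul_sum]
        exact mul_le_mul_of_nonneg_left (hsum.sum_le_tsum _ fun n _ => by positivity) (by positivity)
    _ = _ := by ring

end LogarithmicPhase

/-! ### The Riemann zeta function to the right of the critical line -/

section Zeta

open Finset Complex

/-- The correction terms in the comparison of `(s - 1) ζ(s)` with its Dirichlet polynomials. -/
noncomputable def zetaTerm (n : ℕ) (s : ℂ) : ℂ :=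
  (s - 1) * ((n : ℂ) + 1) ^ (-s) + (((n : ℂ) + 1) ^ (1 - s) - (n : ℂ) ^ (1 - s))

theorem hasDerivAt_ofReal_cpow {u : ℝ} (hu : 0 < u) (a : ℂ) :
    HasDerivAt (fun y : ℝ => (y : ℂ) ^ a) (a * (u : ℂ) ^ (a - 1)) u := by
  have h := (hasDerivAt_id (u : ℂ)).cpow_const (c := a) (Or.inl (by simpa using hu))
  simpa using h.comp_ofReal

/-- The term is the increment over [n, n+1] of a function with derivative (s - 1)((n+1)^(-s) -
y^(-s)). A second use of the mean value inequality bounds the bracket by |s| n^(-3/2). -/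
theorem norm_zetaTerm_le {n : ℕ} (hn : 1 ≤ n) {s : ℂ} (hs : 1 / 2 ≤ s.re) :
    ‖zetaTerm n s‖ ≤ ‖s - 1‖ * ‖s‖ * (n : ℝ) ^ (-(3 / 2) : ℝ) := by
  have hn0 : (0 : ℝ) < n := by exact_mod_cast hn
  have hn1 : (1 : ℝ) ≤ n := by exact_mod_cast hn
  have hmvt : ∀ u ∈ Set.Icc (n : ℝ) (n + 1),
      ‖(((n : ℝ) + 1 : ℝ) : ℂ) ^ (-s) - (u : ℂ) ^ (-s)‖ ≤ ‖s‖ * (n : ℝ) ^ (-(3 / 2) : ℝ) := by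
    intro u hu
    have hbound := (convex_Icc (n : ℝ) (n + 1)).norm_image_sub_le_of_norm_hasDerivWithin_le
      (f := fun y : ℝ => (y : ℂ) ^ (-s)) (f' := fun y : ℝ => -s * (y : ℂ) ^ (-s - 1))
      (C := ‖s‖ * (n : ℝ) ^ (-(3 / 2) : ℝ))
      (fun y hy => (hasDerivAt_ofReal_cpow (hn0.trans_le hy.1) (-s)).hasDerivWithinAt)
      (fun y hy => by
        have hy0 : 0 < y := hn0.trans_le hy.1
        rw [norm_mul, norm_neg, Complex.norm_cpow_eq_rpow_re_of_pos hy0]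
        refine mul_le_mul_of_nonneg_left ?_ (norm_nonneg _)
        calc y ^ (-s - 1).re ≤ y ^ (-(3 / 2) : ℝ) :=
              Real.rpow_le_rpow_of_exponent_le (hn1.trans hy.1) (by simp; linarith)
          _ ≤ (n : ℝ) ^ (-(3 / 2) : ℝ) :=
              Real.rpow_le_rpow_of_nonpos hn0 hy.1 (by norm_num))
      hu (⟨by linarith, le_rfl⟩ : (n : ℝ) + 1 ∈ Set.Icc (n : ℝ) (n + 1))
    refine hbound.trans ?_
    refine mul_le_of_le_one_right (by positivity) ?_
    rw [Real.norm_of_nonneg (by linarith [hu.2])]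
    linarith [hu.1]
  have hbound := (convex_Icc (n : ℝ) (n + 1)).norm_image_sub_le_of_norm_hasDerivWithin_le
    (f := fun y : ℝ => (s - 1) * (((n : ℝ) + 1 : ℝ) : ℂ) ^ (-s) * (y : ℂ) + (y : ℂ) ^ (1 - s))
    (f' := fun y : ℝ => (s - 1) * ((((n : ℝ) + 1 : ℝ) : ℂ) ^ (-s) - (y : ℂ) ^ (-s)))
    (C := ‖s - 1‖ * (‖s‖ * (n : ℝ) ^ (-(3 / 2) : ℝ)))
    (fun y hy => by
      have h1 := hasDerivAt_ofReal_cpow (hn0.trans_le hy.1) (1 - s)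
      have h2 := ((hasDerivAt_id (y : ℂ)).const_mul
        ((s - 1) * (((n : ℝ) + 1 : ℝ) : ℂ) ^ (-s))).comp_ofReal
      refine ((h2.add h1).congr_deriv ?_).hasDerivWithinAt
      rw [show 1 - s - 1 = -s by ring]; ring)
    (fun y hy => by
      rw [norm_mul]
      exact mul_le_mul_of_nonneg_left (hmvt y hy) (norm_nonneg _))
    (⟨le_rfl, by linarith⟩ : (n : ℝ) ∈ Set.Icc (n : ℝ) (n + 1))
    (⟨by linarith, le_rfl⟩ : (n : ℝ) + 1 ∈ Set.Icc (n : ℝ) (n + 1))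
  rw [show (n : ℝ) + 1 - n = 1 by ring, norm_one, mul_one, ← mul_assoc] at hbound
  have he : zetaTerm n s = (s - 1) * (((n : ℝ) + 1 : ℝ) : ℂ) ^ (-s) * (((n : ℝ) + 1 : ℝ) : ℂ) +
      (((n : ℝ) + 1 : ℝ) : ℂ) ^ (1 - s) -
        ((s - 1) * (((n : ℝ) + 1 : ℝ) : ℂ) ^ (-s) * ((n : ℝ) : ℂ) + ((n : ℝ) : ℂ) ^ (1 - s)) := by
    simp only [zetaTerm]
    push_cast
    ring
  rw [he]
  exact hbound

/-- A telescoping majorant, giving an explicit bound for tails of ∑ n^(-3/2). -/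
theorem rpow_neg_three_halves_le {n : ℕ} (hn : 1 ≤ n) :
    (n : ℝ) ^ (-(3 / 2) : ℝ) ≤ 6 * (1 / √(n : ℝ) - 1 / √((n : ℝ) + 1)) := by
  have hn0 : (0 : ℝ) < n := by exact_mod_cast hn
  have hn1 : (1 : ℝ) ≤ n := by exact_mod_cast hn
  set a := √(n : ℝ) with ha
  set b := √((n : ℝ) + 1) with hb
  have ha0 : 0 < a := Real.sqrt_pos.2 hn0
  have hb0 : 0 < b := Real.sqrt_pos.2 (by linarith)
  have haa : a ^ 2 = n := Real.sq_sqrt hn0.le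
  have hbb : b ^ 2 = n + 1 := Real.sq_sqrt (by linarith)
  have hab : a ≤ b := Real.sqrt_le_sqrt (by linarith)
  have hb2 : b ≤ 3 / 2 * a := Real.sqrt_le_iff.2 ⟨by positivity, by nlinarith⟩
  have h1 : (n : ℝ) ^ (-(3 / 2) : ℝ) = 1 / a ^ 3 := by
    rw [Real.rpow_neg hn0.le, ha, Real.sqrt_eq_rpow, ← Real.rpow_natCast, ← Real.rpow_mul hn0.le,
      one_div]
    norm_num
  have h2 : 1 / a - 1 / b = 1 / (a * b * (a + b)) := by
    rw [div_sub_div _ _ ha0.ne' hb0.ne', div_eq_div_iff (by positivity) (by positivity)]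
    have : (b - a) * (a + b) = 1 := by linarith [show (b - a) * (a + b) = b ^ 2 - a ^ 2 by ring]
    linear_combination (a * b) * this
  rw [h1, h2, mul_one_div, div_le_div_iff₀ (by positivity) (by positivity)]
  have h3 : b * (a + b) ≤ 6 * a ^ 2 := by nlinarith
  nlinarith

theorem sum_rpow_neg_three_halves_le {N : ℕ} (hN : 1 ≤ N) (K : ℕ) :
    ∑ n ∈ range K, ((N + n : ℕ) : ℝ) ^ (-(3 / 2) : ℝ) ≤ 6 / √(N : ℝ) := by
  have h : ∑ n ∈ range K, ((N + n : ℕ) : ℝ) ^ (-(3 / 2) : ℝ) ≤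
      6 * (1 / √(N : ℝ) - 1 / √((N + K : ℕ) : ℝ)) := by
    induction K with
    | zero => simp
    | succ K ih =>
      rw [sum_range_succ]
      have := rpow_neg_three_halves_le (n := N + K) (by omega)
      rw [show ((N + (K + 1) : ℕ) : ℝ) = ((N + K : ℕ) : ℝ) + 1 by push_cast; ring]
      linarith
  refine h.trans ?_
  have : 0 ≤ 1 / √((N + K : ℕ) : ℝ) := by positivity
  linarith [show 6 / √(N : ℝ) = 6 * (1 / √(N : ℝ)) by ring]

theorem summable_rpow_neg_three_halves :
    Summable fun n : ℕ => ((n + 1 : ℕ) : ℝ) ^ (-(3 / 2) : ℝ) :=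
  (summable_nat_add_iff 1).2 (Real.summable_nat_rpow.2 (by norm_num))

theorem sum_zetaTerm (s : ℂ) (N : ℕ) :
    ∑ n ∈ range N, zetaTerm (n + 1) s =
      (s - 1) * ∑ n ∈ range (N + 1), ((n : ℂ) + 1) ^ (-s) + ((N : ℂ) + 1) ^ (1 - s) - s := by
  induction N with
  | zero => simp
  | succ N ih =>
    rw [sum_range_succ, ih, sum_range_succ _ (N + 1), zetaTerm]
    push_cast
    ring

theorem tsum_zetaTerm_of_one_lt_re {s : ℂ} (hs : 1 < s.re) :
    s + ∑' n : ℕ, zetaTerm (n + 1) s = riemannZeta₁ s := by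
  have hs1 : s ≠ 1 := by rintro rfl; simp at hs
  have hsum : Summable fun n : ℕ => zetaTerm (n + 1) s :=
    Summable.of_norm_bounded (summable_rpow_neg_three_halves.mul_left (‖s - 1‖ * ‖s‖))
      fun n => norm_zetaTerm_le (by omega) (by linarith)
  have hlim := hsum.hasSum.tendsto_sum_nat
  have hz : HasSum (fun n : ℕ => ((n : ℂ) + 1) ^ (-s)) (riemannZeta s) := by
    rw [zeta_eq_tsum_one_div_nat_add_one_cpow hs]
    have h1 : Summable fun n : ℕ => 1 / ((n : ℂ) + 1) ^ s := by
      have := (summable_nat_add_iff 1).2 (Complex.summable_one_div_nat_cpow.2 hs)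
      simpa using this
    convert h1.hasSum using 2 with n
    rw [cpow_neg, one_div]
  have h2 : Filter.Tendsto (fun N : ℕ => ((N : ℂ) + 1) ^ (1 - s)) Filter.atTop (nhds 0) := by
    rw [tendsto_zero_iff_norm_tendsto_zero]
    have h3 : ∀ N : ℕ, ‖((N : ℂ) + 1) ^ (1 - s)‖ = ((N : ℝ) + 1) ^ (-(s.re - 1)) := fun N => by
      have := Complex.norm_cpow_eq_rpow_re_of_pos (x := (N : ℝ) + 1) (by positivity) (1 - s)
      push_cast at this
      rw [this]; simp
    simp_rw [h3]
    exact (tendsto_rpow_neg_atTop (by linarith)).comp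
      (Filter.tendsto_atTop_add_const_right _ _ tendsto_natCast_atTop_atTop)
  simp_rw [sum_zetaTerm] at hlim
  have h4 := (((hz.tendsto_sum_nat.comp (Filter.tendsto_add_atTop_nat 1)).const_mul (s - 1)).add
    h2).sub_const s
  have h5 := tendsto_nhds_unique hlim h4
  rw [h5, riemannZeta_eq_inv_sub_mul hs1]
  have : s - 1 ≠ 0 := sub_ne_zero.2 hs1
  field_simp
  ring

theorem isOpen_half_plane (a : ℝ) : IsOpen {s : ℂ | a < s.re} :=
  isOpen_lt continuous_const Complex.continuous_re

theorem differentiableOn_tsum_zetaTerm :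
    DifferentiableOn ℂ (fun s => ∑' n : ℕ, zetaTerm (n + 1) s) {s | 1 / 2 < s.re} := by
  intro s₀ hs₀
  have hopen : IsOpen ({s : ℂ | 1 / 2 < s.re} ∩ Metric.ball s₀ 1) :=
    (isOpen_half_plane _).inter Metric.isOpen_ball
  have h := differentiableOn_tsum_of_summable_norm (F := fun (n : ℕ) s => zetaTerm (n + 1) s)
    (u := fun n : ℕ => (‖s₀‖ + 2) * (‖s₀‖ + 2) * ((n + 1 : ℕ) : ℝ) ^ (-(3 / 2) : ℝ))
    (summable_rpow_neg_three_halves.mul_left _) (fun n s _ => ?_) hopen (fun n s hs => ?_)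
  · exact (h.differentiableAt (hopen.mem_nhds ⟨hs₀, Metric.mem_ball_self one_pos⟩)).differentiableWithinAt
  · have h1 : ((n + 1 : ℕ) : ℂ) ≠ 0 := by exact_mod_cast Nat.succ_ne_zero n
    have h2 : ((n + 1 : ℕ) : ℂ) + 1 ≠ 0 := by exact_mod_cast Nat.succ_ne_zero (n + 1)
    unfold zetaTerm
    have e1 : DifferentiableAt ℂ (fun s : ℂ => 1 - s) s := by fun_prop
    have e2 : DifferentiableAt ℂ (fun s : ℂ => -s) s := by fun_prop
    have e3 : DifferentiableAt ℂ (fun s : ℂ => s - 1) s := by fun_prop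
    exact ((e3.mul (e2.const_cpow (Or.inl h2))).add
      ((e1.const_cpow (Or.inl h2)).sub (e1.const_cpow (Or.inl h1)))).differentiableWithinAt
  · refine (norm_zetaTerm_le (by omega) hs.1.le).trans ?_
    have h1 : ‖s‖ ≤ ‖s₀‖ + 1 := by
      have := norm_sub_norm_le s s₀
      have h2 := mem_ball_iff_norm.1 hs.2
      linarith
    have h2 : ‖s - 1‖ ≤ ‖s₀‖ + 2 := by
      have := norm_sub_le s 1
      rw [norm_one] at this
      linarith
    gcongr
    linarith

/-- Both sides are analytic in the half-plane and agree for Re s > 1, so the identity theorem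
extends the formula for (s - 1)ζ(s). -/
theorem add_tsum_zetaTerm {s : ℂ} (hs : 1 / 2 < s.re) :
    s + ∑' n : ℕ, zetaTerm (n + 1) s = riemannZeta₁ s := by
  have h1 : AnalyticOnNhd ℂ (fun s => s + ∑' n : ℕ, zetaTerm (n + 1) s) {s | 1 / 2 < s.re} :=
    (differentiableOn_id.add differentiableOn_tsum_zetaTerm).analyticOnNhd (isOpen_half_plane _)
  have h2 : AnalyticOnNhd ℂ riemannZeta₁ {s | 1 / 2 < s.re} :=
    differentiable_riemannZeta₁.differentiableOn.analyticOnNhd (isOpen_half_plane _)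
  refine h1.eqOn_of_preconnected_of_eventuallyEq h2
    (convex_halfSpace_re_gt (1 / 2)).isPreconnected (z₀ := 2) (by norm_num) ?_ hs
  filter_upwards [(isOpen_half_plane 1).mem_nhds (show (2 : ℂ) ∈ {s : ℂ | 1 < s.re} by norm_num)]
    with z hz
  exact tsum_zetaTerm_of_one_lt_re hz

theorem norm_riemannZeta_le {s : ℂ} (hs : 1 / 2 < s.re) (hs1 : s ≠ 1) (N : ℕ) :
    ‖riemannZeta s‖ ≤ ‖∑ n ∈ range (N + 1), ((n : ℂ) + 1) ^ (-s)‖ +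
      ((N : ℝ) + 1) ^ (1 - s.re) / ‖s - 1‖ + 6 * ‖s‖ / √((N : ℝ) + 1) := by
  have hsub : s - 1 ≠ 0 := sub_ne_zero.2 hs1
  have hnorm : 0 < ‖s - 1‖ := norm_pos_iff.2 hsub
  have hsum : Summable fun n : ℕ => zetaTerm (n + 1) s :=
    Summable.of_norm_bounded (summable_rpow_neg_three_halves.mul_left (‖s - 1‖ * ‖s‖))
      fun n => norm_zetaTerm_le (by omega) hs.le
  have h1 := add_tsum_zetaTerm hs
  rw [← hsum.sum_add_tsum_nat_add N, sum_zetaTerm] at h1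
  have htail : ‖∑' n : ℕ, zetaTerm (n + N + 1) s‖ ≤ ‖s - 1‖ * (6 * ‖s‖ / √((N : ℝ) + 1)) := by
    have hb : Summable fun n : ℕ => ((N + 1 + n : ℕ) : ℝ) ^ (-(3 / 2) : ℝ) := by
      refine ((summable_nat_add_iff N).2 summable_rpow_neg_three_halves).congr fun n => ?_
      rw [show n + N + 1 = N + 1 + n by ring]
    have h2 : ∑' n : ℕ, ((N + 1 + n : ℕ) : ℝ) ^ (-(3 / 2) : ℝ) ≤ 6 / √((N : ℝ) + 1) :=
      Real.tsum_le_of_sum_range_le (fun n => by positivity) fun K => by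
        have := sum_rpow_neg_three_halves_le (N := N + 1) (by omega) K
        simpa using this
    refine (tsum_of_norm_bounded (hb.mul_left (‖s - 1‖ * ‖s‖)).hasSum fun n => ?_).trans ?_
    · have := norm_zetaTerm_le (n := n + N + 1) (by omega) hs.le
      rwa [show ((N + 1 + n : ℕ) : ℝ) = ((n + N + 1 : ℕ) : ℝ) by push_cast; ring]
    · rw [tsum_mul_left]
      calc _ ≤ ‖s - 1‖ * ‖s‖ * (6 / √((N : ℝ) + 1)) := by gcongr
        _ = _ := by ring
  have hz : riemannZeta s = ∑ n ∈ range (N + 1), ((n : ℂ) + 1) ^ (-s) +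
      ((N : ℂ) + 1) ^ (1 - s) / (s - 1) + (∑' n : ℕ, zetaTerm (n + N + 1) s) / (s - 1) := by
    rw [riemannZeta_eq_inv_sub_mul hs1, ← h1]
    field_simp
    ring
  rw [hz]
  refine (norm_add₃_le).trans ?_
  rw [norm_div, norm_div]
  refine add_le_add (add_le_add le_rfl (le_of_eq ?_)) ?_
  · have := Complex.norm_cpow_eq_rpow_re_of_pos (x := (N : ℝ) + 1) (by positivity) (1 - s)
    push_cast at this
    rw [this]; simp
  · rw [div_le_iff₀ hnorm]; linarith

theorem natCast_add_one_cpow_neg (n : ℕ) (σ t : ℝ) :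
    ((n : ℂ) + 1) ^ (-((σ : ℂ) + t * I)) =
      ((((n : ℝ) + 1) ^ (-σ) : ℝ) : ℂ) * addChar (logPhase (t / (2 * Real.pi)) 1 n) := by
  have hn : ((n : ℂ) + 1) ≠ 0 := by exact_mod_cast Nat.succ_ne_zero n
  rw [neg_add, cpow_add _ _ hn]
  congr 1
  · rw [Complex.ofReal_cpow (by positivity)]; push_cast; ring
  · rw [cpow_def_of_ne_zero hn, addChar, logPhase]
    congr 1
    have h1 : Complex.log ((n : ℂ) + 1) = ((Real.log ((n : ℝ) + 1) : ℝ) : ℂ) := by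
      rw [Complex.ofReal_log (by positivity)]; push_cast; ring
    rw [h1, show ((1 : ℕ) : ℝ) + n = (n : ℝ) + 1 by push_cast; ring]
    have hπ : (Real.pi : ℂ) ≠ 0 := by exact_mod_cast Real.pi_ne_zero
    push_cast
    field_simp

theorem exists_norm_riemannZeta_le_of_pos {σ : ℝ} (hσ : 1 / 2 < σ) (hσ1 : σ < 1) :
    ∃ C : ℝ, 0 ≤ C ∧ ∀ t : ℝ, 0 ≤ t →
      ‖riemannZeta (σ + t * I)‖ ≤ C * (1 + t) ^ (1 / 6 : ℝ) := by
  obtain ⟨C, hC, hsum⟩ := exists_norm_sum_rpow_mul_logPhase_le hσ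
  refine ⟨C + 100 + 1 / (1 - σ), add_nonneg (by linarith) (by positivity), fun t ht => ?_⟩
  have hre : ((σ : ℂ) + t * I).re = σ := by simp
  have him : ((σ : ℂ) + t * I).im = t := by simp
  have hne : ((σ : ℂ) + t * I) ≠ 1 := fun h => by
    have := congrArg Complex.re h
    rw [hre] at this; simp at this; linarith
  have hone : 1 ≤ (1 + t) ^ (1 / 6 : ℝ) := Real.one_le_rpow (by linarith) (by norm_num)
  have hinv : 0 ≤ 1 / (1 - σ) := by positivity
  have hsn : ‖(σ : ℂ) + t * I‖ ≤ 1 + t := by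
    refine (norm_add_le _ _).trans ?_
    rw [norm_mul, norm_I, mul_one, Complex.norm_real, Complex.norm_real,
      Real.norm_of_nonneg (by linarith), Real.norm_of_nonneg ht]
    linarith
  rcases le_total t 1 with h1 | h1
  · have h := norm_riemannZeta_le (s := σ + t * I) (by rw [hre]; exact hσ) hne 0
    have h2 : 1 - σ ≤ ‖(σ : ℂ) + t * I - 1‖ := by
      have := Complex.abs_re_le_norm ((σ : ℂ) + t * I - 1)
      rw [sub_re, hre, one_re, abs_sub_comm, abs_of_pos (by linarith)] at this
      exact this
    simp only [zero_add, range_one, sum_singleton, Nat.cast_zero, one_cpow, norm_one,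
      Real.one_rpow, Real.sqrt_one, div_one] at h
    have h3 : 1 / ‖(σ : ℂ) + t * I - 1‖ ≤ 1 / (1 - σ) :=
      one_div_le_one_div_of_le (by linarith) h2
    nlinarith
  · set τ := t ^ (1 / 6 : ℝ) with hτ
    have ht0 : 0 < t := by linarith
    have hτ6 : τ ^ 6 = t := by
      rw [hτ, ← Real.rpow_natCast, ← Real.rpow_mul ht]; norm_num
    have hτ1 : 1 ≤ τ := Real.one_le_rpow h1 (by norm_num)
    have hτ12 : τ ^ 12 = t ^ 2 := by rw [← hτ6]; ring
    have hτle : τ ≤ (1 + t) ^ (1 / 6 : ℝ) := Real.rpow_le_rpow ht (by linarith) (by norm_num)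
    -- A Dirichlet polynomial of length t² = τ¹² is long enough that K^(1-σ)/|s - 1| and |s|/√K are
    -- both bounded, leaving only the exponential sum.
    set K := ⌊t ^ 2⌋₊ with hK
    have hK1 : 1 ≤ K := Nat.le_floor (by rw [Nat.cast_one]; exact one_le_pow₀ h1)
    have hKle : (K : ℝ) ≤ t ^ 2 := Nat.floor_le (by positivity)
    have hKge : t ^ 2 ≤ 4 * K := by
      have h2 := Nat.lt_floor_add_one (t ^ 2)
      rw [← hK] at h2
      have h3 : (1 : ℝ) ≤ K := by exact_mod_cast hK1
      linarith
    have h := norm_riemannZeta_le (s := σ + t * I) (by rw [hre]; exact hσ) hne (K - 1)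
    have hKc : ((K - 1 : ℕ) : ℝ) + 1 = K := by rw [Nat.cast_sub hK1]; simp
    rw [Nat.sub_add_cancel hK1, hKc, hre] at h
    have hπ3 := Real.pi_gt_three
    have hπ4 := Real.pi_lt_four
    have hs1 : ‖∑ n ∈ range K, ((n : ℂ) + 1) ^ (-((σ : ℂ) + t * I))‖ ≤ C * τ := by
      rw [Finset.sum_congr rfl fun n _ => natCast_add_one_cpow_neg n σ t]
      -- Here c = t/(2π), and 1/9 ≤ 1/(2π) ≤ 1/2.
      refine hsum _ τ hτ1 ?_ ?_ K (by rw [hτ12]; exact hKle)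
      · rw [hτ6]; gcongr; linarith
      · rw [hτ6]; gcongr; linarith
    have hs2 : (K : ℝ) ^ (1 - σ) / ‖(σ : ℂ) + t * I - 1‖ ≤ 1 := by
      have h2 : t ≤ ‖(σ : ℂ) + t * I - 1‖ := by
        have := Complex.abs_im_le_norm ((σ : ℂ) + t * I - 1)
        rwa [sub_im, him, one_im, sub_zero, abs_of_pos ht0] at this
      rw [div_le_one (by linarith)]
      refine le_trans ?_ h2
      calc (K : ℝ) ^ (1 - σ) ≤ (K : ℝ) ^ (1 / 2 : ℝ) :=
            Real.rpow_le_rpow_of_exponent_le (by exact_mod_cast hK1) (by linarith)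
        _ ≤ (t ^ 2) ^ (1 / 2 : ℝ) := Real.rpow_le_rpow (by positivity) hKle (by norm_num)
        _ = t := by rw [← Real.sqrt_eq_rpow, Real.sqrt_sq ht]
    have hs3 : 6 * ‖(σ : ℂ) + t * I‖ / √(K : ℝ) ≤ 24 := by
      have hsK : t / 2 ≤ √(K : ℝ) := Real.le_sqrt_of_sq_le (by nlinarith)
      rw [div_le_iff₀ (by linarith)]
      linarith
    nlinarith

/-- The **Weyl bound** for the zeta function on vertical lines to the right of the critical line. -/
theorem exists_norm_riemannZeta_le {σ : ℝ} (hσ : 1 / 2 < σ) (hσ1 : σ < 1) :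
    ∃ C : ℝ, 0 ≤ C ∧ ∀ t : ℝ,
      ‖riemannZeta (σ + t * I)‖ ≤ C * (1 + |t|) ^ (1 / 6 : ℝ) := by
  obtain ⟨C, hC, h⟩ := exists_norm_riemannZeta_le_of_pos hσ hσ1
  refine ⟨C, hC, fun t => ?_⟩
  rcases le_total 0 t with ht | ht
  · rw [abs_of_nonneg ht]; exact h t ht
  · rw [abs_of_nonpos ht]
    have h1 := h (-t) (by linarith)
    have h2 : (σ : ℂ) + ((-t : ℝ) : ℂ) * I = (starRingEnd ℂ) (σ + t * I) := by
      simp [Complex.conj_ofReal]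
    rw [h2, riemannZeta_conj, RCLike.norm_conj] at h1
    exact h1

theorem norm_riemannZeta_le_of_one_le_abs_im {s : ℂ} (hs : 1 / 2 < s.re) (him : 1 ≤ |s.im|) :
    ‖riemannZeta s‖ ≤ 8 * ‖s‖ := by
  have hne : s ≠ 1 := by rintro rfl; simp at him; linarith
  have h := norm_riemannZeta_le hs hne 0
  have h1 : 1 ≤ ‖s - 1‖ := him.trans (by simpa using Complex.abs_im_le_norm (s - 1))
  have h2 : 1 ≤ ‖s‖ := him.trans (Complex.abs_im_le_norm s)
  simp only [zero_add, range_one, sum_singleton, Nat.cast_zero, one_cpow, norm_one,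
    Real.one_rpow, Real.sqrt_one, div_one] at h
  have h3 : 1 / ‖s - 1‖ ≤ 1 := (div_le_one (by linarith)).2 h1
  linarith

end Zeta

/-! ### Laplace transforms and iterated primitives -/

section Laplace

open MeasureTheory Set Complex
open scoped FourierTransform

/-- Measurable functions that vanish on the negative half-line and are `O(exp(b y))`. -/
structure ExpGrowth (b : ℝ) (f : ℝ → ℂ) : Prop where
  meas : AEStronglyMeasurable f volume
  zero : ∀ y < 0, f y = 0
  bound : ∃ C : ℝ, 0 ≤ C ∧ ∀ y, ‖f y‖ ≤ C * Real.exp (b * y)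

/-- The two-sided Laplace transform. -/
noncomputable def laplace (f : ℝ → ℂ) (s : ℂ) : ℂ := ∫ y : ℝ, f y * cexp (-(s * y))

/-- The primitive that vanishes at `-∞`. -/
noncomputable def primitive (f : ℝ → ℂ) (y : ℝ) : ℂ := ∫ v in Iic y, f v

theorem norm_cexp_neg_mul_ofReal (s : ℂ) (y : ℝ) :
    ‖cexp (-(s * y))‖ = Real.exp (-(s.re * y)) := by
  rw [Complex.norm_exp]; simp

theorem integrable_indicator_exp {a : ℝ} (ha : 0 < a) :
    Integrable ((Ici (0 : ℝ)).indicator fun y => Real.exp (-a * y)) := by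
  rw [integrable_indicator_iff measurableSet_Ici, integrableOn_Ici_iff_integrableOn_Ioi]
  exact exp_neg_integrableOn_Ioi 0 ha

theorem ExpGrowth.integrable {b : ℝ} {f : ℝ → ℂ} (hf : ExpGrowth b f) {s : ℂ} (hs : b < s.re) :
    Integrable fun y : ℝ => f y * cexp (-(s * y)) := by
  obtain ⟨C, hC, hb⟩ := hf.bound
  refine ((integrable_indicator_exp (sub_pos.2 hs)).const_mul C).mono'
    (hf.meas.mul (by fun_prop)) (Filter.Eventually.of_forall fun y => ?_)
  rcases lt_or_ge y 0 with hy | hy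
  · rw [hf.zero y hy, zero_mul, norm_zero]
    exact mul_nonneg hC (indicator_nonneg (fun _ _ => (Real.exp_pos _).le) _)
  · rw [norm_mul, norm_cexp_neg_mul_ofReal, indicator_of_mem (mem_Ici.2 hy)]
    calc ‖f y‖ * Real.exp (-(s.re * y)) ≤ C * Real.exp (b * y) * Real.exp (-(s.re * y)) := by
          gcongr; exact hb y
      _ = C * Real.exp (-(s.re - b) * y) := by
          rw [mul_assoc, ← Real.exp_add]; congr 2; ring

theorem ExpGrowth.integrableOn_Iic {b : ℝ} (hb : 0 < b) {f : ℝ → ℂ} (hf : ExpGrowth b f) (y : ℝ) :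
    IntegrableOn f (Iic y) := by
  obtain ⟨C, hC, hbd⟩ := hf.bound
  exact ((integrableOn_exp_mul_Iic hb y).const_mul C).mono' hf.meas.restrict
    (Filter.Eventually.of_forall hbd)

theorem ExpGrowth.intervalIntegrable {b : ℝ} (hb : 0 < b) {f : ℝ → ℂ} (hf : ExpGrowth b f)
    (x y : ℝ) : IntervalIntegrable f volume x y :=
  ((hf.integrableOn_Iic hb (max x y)).mono_set
    (fun _ hz => (uIcc_subset_Icc (⟨min_le_left _ _, le_max_left _ _⟩ : x ∈ Icc (min x y) (max x y))
      ⟨min_le_right _ _, le_max_right _ _⟩ hz).2)).intervalIntegrable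

theorem ExpGrowth.primitive_sub {b : ℝ} (hb : 0 < b) {f : ℝ → ℂ} (hf : ExpGrowth b f) (x y : ℝ) :
    primitive f y - primitive f x = ∫ v in x..y, f v :=
  intervalIntegral.integral_Iic_sub_Iic (hf.integrableOn_Iic hb x) (hf.integrableOn_Iic hb y)

theorem ExpGrowth.continuous_primitive {b : ℝ} (hb : 0 < b) {f : ℝ → ℂ} (hf : ExpGrowth b f) :
    Continuous (primitive f) := by
  have h : primitive f = fun y => primitive f 0 + ∫ v in (0 : ℝ)..y, f v := by
    funext y; rw [← hf.primitive_sub hb]; ring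
  rw [h]
  exact continuous_const.add
    (intervalIntegral.continuous_primitive (hf.intervalIntegrable hb) 0)

theorem primitive_eq_zero {f : ℝ → ℂ} (hf : ∀ y < 0, f y = 0) {y : ℝ} (hy : y ≤ 0) :
    primitive f y = 0 := by
  rw [primitive, integral_Iic_eq_integral_Iio]
  exact setIntegral_eq_zero_of_forall_eq_zero fun v hv => hf v (lt_of_lt_of_le hv hy)

theorem ExpGrowth.primitive {b : ℝ} (hb : 0 < b) {f : ℝ → ℂ} (hf : ExpGrowth b f) :
    ExpGrowth b (primitive f) := by
  refine ⟨(hf.continuous_primitive hb).aestronglyMeasurable,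
    fun y hy => primitive_eq_zero hf.zero hy.le, ?_⟩
  obtain ⟨C, hC, hbd⟩ := hf.bound
  refine ⟨C / b, by positivity, fun y => ?_⟩
  calc ‖∫ v in Iic y, f v‖ ≤ ∫ v in Iic y, C * Real.exp (b * v) :=
        norm_integral_le_of_norm_le ((integrableOn_exp_mul_Iic hb y).const_mul C)
          (Filter.Eventually.of_forall hbd)
    _ = C / b * Real.exp (b * y) := by
        rw [integral_const_mul, integral_exp_mul_Iic hb]; ring

/-- The primitive is the convolution with the Heaviside function; after weighting by exp(-sy) both
factors are integrable, and the Heaviside factor has integral 1/s. -/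
theorem ExpGrowth.laplace_primitive {b : ℝ} (hb : 0 < b) {f : ℝ → ℂ} (hf : ExpGrowth b f) {s : ℂ}
    (hs : b < s.re) : laplace (_root_.primitive f) s = laplace f s / s := by
  set u : ℝ → ℂ := (Ici (0 : ℝ)).indicator fun y => cexp (-s * y) with hu
  have hre : (-s).re < 0 := by simp; linarith
  have hui : Integrable u := by
    rw [hu, integrable_indicator_iff measurableSet_Ici, integrableOn_Ici_iff_integrableOn_Ioi]
    exact integrableOn_exp_mul_complex_Ioi hre 0
  have huI : ∫ y, u y = 1 / s := by
    rw [hu, integral_indicator measurableSet_Ici, integral_Ici_eq_integral_Ioi,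
      integral_exp_mul_complex_Ioi hre]
    simp
  have hconv := integral_convolution (ContinuousLinearMap.mul ℝ ℂ) (ν := volume) (μ := volume)
    (hf.integrable hs) hui
  rw [huI, ContinuousLinearMap.mul_apply', mul_one_div] at hconv
  rw [laplace, laplace, ← hconv]
  refine integral_congr_ae (Filter.Eventually.of_forall fun y => ?_)
  simp only [convolution_def, ContinuousLinearMap.mul_apply']
  rw [_root_.primitive, ← integral_indicator measurableSet_Iic, ← integral_mul_const]
  refine integral_congr_ae (Filter.Eventually.of_forall fun v => ?_)
  simp only [hu]
  by_cases hv : v ≤ y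
  · rw [indicator_of_mem (mem_Iic.2 hv), indicator_of_mem (mem_Ici.2 (sub_nonneg.2 hv)), mul_assoc,
      ← Complex.exp_add]
    congr 2; push_cast; ring
  · rw [indicator_of_notMem (by simpa using hv), indicator_of_notMem (by simpa using hv)]
    simp

theorem ExpGrowth.iterate_primitive {b : ℝ} (hb : 0 < b) {f : ℝ → ℂ} (hf : ExpGrowth b f) (m : ℕ) :
    ExpGrowth b (_root_.primitive^[m] f) := by
  induction m with
  | zero => exact hf
  | succ m ih => rw [Function.iterate_succ_apply']; exact ih.primitive hb

theorem ExpGrowth.laplace_iterate_primitive {b : ℝ} (hb : 0 < b) {f : ℝ → ℂ} (hf : ExpGrowth b f)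
    {s : ℂ} (hs : b < s.re) (m : ℕ) :
    laplace (_root_.primitive^[m] f) s = laplace f s / s ^ m := by
  induction m with
  | zero => simp
  | succ m ih =>
    rw [Function.iterate_succ_apply', (hf.iterate_primitive hb m).laplace_primitive hb hs, ih,
      div_div, pow_succ]

theorem ExpGrowth.sub {b : ℝ} {f g : ℝ → ℂ} (hf : ExpGrowth b f) (hg : ExpGrowth b g) :
    ExpGrowth b (fun y => f y - g y) := by
  obtain ⟨C, hC, h1⟩ := hf.bound
  obtain ⟨D, hD, h2⟩ := hg.bound
  refine ⟨hf.meas.sub hg.meas, fun y hy => by rw [hf.zero y hy, hg.zero y hy, sub_zero],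
    C + D, by positivity, fun y => (norm_sub_le _ _).trans ?_⟩
  rw [add_mul]
  exact add_le_add (h1 y) (h2 y)

theorem ExpGrowth.laplace_sub {b : ℝ} {f g : ℝ → ℂ} (hf : ExpGrowth b f) (hg : ExpGrowth b g)
    {s : ℂ} (hs : b < s.re) :
    laplace (fun y => f y - g y) s = laplace f s - laplace g s := by
  simp only [laplace, sub_mul]
  exact integral_sub (hf.integrable hs) (hg.integrable hs)

/-- Laplace inversion for a continuous function with integrable transform. -/
theorem ExpGrowth.laplace_inversion {b : ℝ} {f : ℝ → ℂ} (hf : ExpGrowth b f)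
    (hcont : Continuous f) {c : ℝ} (hc : b < c)
    (hf_int : Integrable fun t : ℝ => laplace f (c + t * I)) (y : ℝ) :
    f y = 1 / (2 * Real.pi) * ∫ t : ℝ, laplace f (c + t * I) * cexp ((c + t * I) * y) := by
  set F : ℝ → ℂ := fun y => f y * cexp (-((c : ℂ) * y)) with hF
  have hFi : Integrable F := hf.integrable (s := c) (by simpa using hc)
  have hFc : Continuous F := by fun_prop
  have hfour : ∀ ξ : ℝ, 𝓕 F ξ = laplace f (c + ((2 * Real.pi * ξ : ℝ) : ℂ) * I) := fun ξ => by
    rw [Real.fourier_real_eq_integral_exp_smul, laplace]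
    refine integral_congr_ae (Filter.Eventually.of_forall fun v => ?_)
    simp only [hF, smul_eq_mul]
    rw [mul_left_comm, ← Complex.exp_add]
    congr 2; push_cast; ring
  have h2π : (2 * Real.pi) ≠ 0 := by positivity
  have hFint : Integrable (𝓕 F) := by
    have : 𝓕 F = fun ξ : ℝ => laplace f (c + ((2 * Real.pi * ξ : ℝ) : ℂ) * I) := funext hfour
    rw [this]
    exact hf_int.comp_mul_left' h2π
  have hinv := congrFun (hFc.fourierInv_fourier_eq hFi hFint) y
  rw [Real.fourierInv_eq'] at hinv
  have h1 : f y = F y * cexp ((c : ℂ) * y) := by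
    simp only [hF]; rw [mul_assoc, ← Complex.exp_add]; simp
  rw [h1, ← hinv, ← integral_mul_const]
  have hsub := Measure.integral_comp_mul_left
    (fun t : ℝ => laplace f (c + t * I) * cexp ((c + t * I) * y)) (2 * Real.pi)
  rw [abs_of_pos (by positivity)] at hsub
  have h3 : (1 / (2 * Real.pi) : ℂ) * ∫ t : ℝ, laplace f (c + t * I) * cexp ((c + t * I) * y) =
      (2 * Real.pi)⁻¹ • ∫ t : ℝ, laplace f (c + t * I) * cexp ((c + t * I) * y) := by
    rw [Complex.real_smul]; push_cast; rw [one_div]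
  rw [h3, ← hsub]
  refine integral_congr_ae (Filter.Eventually.of_forall fun ξ => ?_)
  simp only [hfour, smul_eq_mul]
  rw [mul_comm (cexp _) (laplace f _), mul_assoc, ← Complex.exp_add]
  congr 2
  simp only [RCLike.inner_apply, conj_trivial]
  push_cast; ring

end Laplace

/-! ### Shifting vertical lines of integration -/

section ContourShift

open MeasureTheory Set Complex Filter Topology

theorem integrable_vertical_of_bound {f : ℂ → ℂ} {σ K : ℝ}
    (hf : Continuous fun t : ℝ => f (σ + t * I))
    (hb : ∀ t : ℝ, ‖f (σ + t * I)‖ ≤ K * (1 + t ^ 2)⁻¹) :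
    Integrable fun t : ℝ => f (σ + t * I) :=
  (integrable_inv_one_add_sq.const_mul K).mono' hf.aestronglyMeasurable (Eventually.of_forall hb)

theorem continuous_vertical {f : ℂ → ℂ} {S : Set ℂ} (hf : ContinuousOn f S) {σ : ℝ}
    (h : ∀ t : ℝ, (σ + t * I : ℂ) ∈ S) : Continuous fun t : ℝ => f (σ + t * I) :=
  hf.comp_continuous (by fun_prop) h

/-- Shifting the line of integration across a vertical strip. -/
theorem integral_vertical_eq {f : ℂ → ℂ} {a c K : ℝ} (hac : a ≤ c)
    (hf : DifferentiableOn ℂ f {s | a ≤ s.re ∧ s.re ≤ c})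
    (hb : ∀ s : ℂ, a ≤ s.re → s.re ≤ c → ‖f s‖ ≤ K * (1 + s.im ^ 2)⁻¹) :
    ∫ t : ℝ, f (c + t * I) = ∫ t : ℝ, f (a + t * I) := by
  have hline : ∀ σ : ℝ, a ≤ σ → σ ≤ c → Integrable fun t : ℝ => f (σ + t * I) := fun σ h1 h2 =>
    integrable_vertical_of_bound (K := K)
      (continuous_vertical hf.continuousOn fun t => by simpa using ⟨h1, h2⟩)
      (fun t => by simpa using hb (σ + t * I) (by simpa using h1) (by simpa using h2))
  have hlim : ∀ σ : ℝ, a ≤ σ → σ ≤ c →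
      Tendsto (fun T : ℝ => ∫ t in (-T)..T, f (σ + t * I)) atTop
        (𝓝 (∫ t : ℝ, f (σ + t * I))) := fun σ h1 h2 =>
    intervalIntegral_tendsto_integral (hline σ h1 h2) tendsto_neg_atTop_atBot tendsto_id
  have hK0 : Tendsto (fun T : ℝ => K * (1 + T ^ 2)⁻¹ * |c - a|) atTop (𝓝 0) := by
    have h1 : Tendsto (fun T : ℝ => (1 + T ^ 2)⁻¹) atTop (𝓝 0) :=
      tendsto_inv_atTop_zero.comp
        (tendsto_atTop_add_const_left _ _ (tendsto_pow_atTop (by norm_num)))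
    simpa using (h1.const_mul K).mul_const |c - a|
  have hhor : ∀ ε : ℝ, ε ^ 2 = 1 → Tendsto (fun T : ℝ => ∫ x in a..c, f (x + ((ε * T : ℝ) : ℂ) * I))
      atTop (𝓝 0) := fun ε hε => by
    refine squeeze_zero_norm (fun T => ?_) hK0
    refine intervalIntegral.norm_integral_le_of_norm_le_const fun x hx => ?_
    rw [uIoc_of_le hac] at hx
    have := hb (x + ((ε * T : ℝ) : ℂ) * I) (by simpa using hx.1.le) (by simpa using hx.2)
    simpa [mul_pow, hε] using this
  have hrect : ∀ T : ℝ, (∫ x in a..c, f (x + (((-1) * T : ℝ) : ℂ) * I)) -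
      (∫ x in a..c, f (x + ((1 * T : ℝ) : ℂ) * I)) + I • (∫ t in (-T)..T, f (c + t * I)) -
      I • (∫ t in (-T)..T, f (a + t * I)) = 0 := fun T => by
    have h := integral_boundary_rect_eq_zero_of_differentiableOn f (a + ((-T : ℝ) : ℂ) * I)
      (c + (T : ℂ) * I) (hf.mono fun s hs => by
        rw [mem_reProdIm] at hs
        have h1 := hs.1
        simp only [add_re, ofReal_re, mul_re, I_re, mul_zero, ofReal_im, I_im, mul_one, sub_self,
          add_zero] at h1
        rw [uIcc_of_le hac] at h1
        exact h1)
    simpa using h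
  have h0 := (((hhor (-1) (by norm_num)).sub (hhor 1 (by norm_num))).add
    ((hlim c hac le_rfl).const_smul I)).sub ((hlim a le_rfl hac).const_smul I)
  simp only [hrect] at h0
  have h1 := tendsto_nhds_unique h0 tendsto_const_nhds
  simp only [sub_self, zero_add, smul_eq_mul, ← mul_sub] at h1
  have h2 := (mul_eq_zero.1 h1).resolve_left I_ne_zero
  exact sub_eq_zero.1 h2

end ContourShift

/-! ### Finite differences of iterated primitives -/

section Differences

open MeasureTheory Set Complex

/-- The `m`-th difference of an `m`-fold primitive is an average: upper bound. -/
theorem fwdDiff_iterate_le {f : ℕ → ℝ → ℝ} {δ : ℝ} (hδ : 0 ≤ δ)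
    (hf_int : ∀ j a b, IntervalIntegrable (f j) volume a b)
    (hrel : ∀ j a b, f (j + 1) b - f (j + 1) a = ∫ v in a..b, f j v) (m : ℕ) {y U : ℝ}
    (hU : ∀ v ∈ Icc y (y + m * δ), f 0 v ≤ U) :
    (fwdDiff δ)^[m] (f m) y ≤ δ ^ m * U := by
  induction m generalizing f U with
  | zero => simpa using hU y (by simp)
  | succ m ih =>
    rw [Function.iterate_succ_apply]
    -- Differencing the chain of primitives gives a chain one step shorter, whose bottom function is
    -- the integral of `f 0` over [v, v + δ], hence at most δ U.
    have h := ih (f := fun j => fwdDiff δ (f (j + 1))) (U := δ * U)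
      (fun j a b => by
        have h1 : IntervalIntegrable (fun v => f (j + 1) (v + δ)) volume a b := by
          have := (hf_int (j + 1) (a + δ) (b + δ)).comp_add_right δ
          simpa using this
        exact h1.sub (hf_int (j + 1) a b))
      (fun j a b => by
        simp only [fwdDiff]
        have h1 : IntervalIntegrable (fun v => f (j + 1) (v + δ)) volume a b := by
          have := (hf_int (j + 1) (a + δ) (b + δ)).comp_add_right δ
          simpa using this
        rw [intervalIntegral.integral_sub h1 (hf_int (j + 1) a b),
          intervalIntegral.integral_comp_add_right, ← hrel, ← hrel]
        ring)
      (fun v hv => by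
        simp only [fwdDiff]
        rw [hrel]
        have h1 := intervalIntegral.integral_mono_on (by linarith) (hf_int 0 v (v + δ))
          (intervalIntegrable_const (c := U)) (fun w hw => hU w ⟨hv.1.trans hw.1, by
            push_cast
            linarith [hw.2, hv.2]⟩)
        simpa using h1)
    rw [pow_succ, mul_assoc]
    exact h

theorem fwdDiff_iterate_neg (δ : ℝ) (f : ℝ → ℝ) (m : ℕ) (y : ℝ) :
    (fwdDiff δ)^[m] (fun v => -f v) y = -(fwdDiff δ)^[m] f y := by
  have := congrFun (fwdDiff_iter_const_smul δ (-1 : ℝ) f m) y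
  simp only [Pi.smul_apply, smul_eq_mul, neg_one_mul] at this
  have he : (fun v => -f v) = (-1 : ℝ) • f := by funext v; simp
  rw [he, this]

theorem le_fwdDiff_iterate {f : ℕ → ℝ → ℝ} {δ : ℝ} (hδ : 0 ≤ δ)
    (hf_int : ∀ j a b, IntervalIntegrable (f j) volume a b)
    (hrel : ∀ j a b, f (j + 1) b - f (j + 1) a = ∫ v in a..b, f j v) (m : ℕ) {y U : ℝ}
    (hU : ∀ v ∈ Icc y (y + m * δ), U ≤ f 0 v) :
    δ ^ m * U ≤ (fwdDiff δ)^[m] (f m) y := by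
  have h := fwdDiff_iterate_le (f := fun j v => -f j v) hδ (fun j a b => (hf_int j a b).neg)
    (fun j a b => by rw [intervalIntegral.integral_neg, ← hrel]; ring) m (y := y) (U := -U)
    (fun v hv => neg_le_neg (hU v hv))
  rw [fwdDiff_iterate_neg] at h
  linarith

theorem fwdDiff_iterate_re (δ : ℝ) (f : ℝ → ℂ) (m : ℕ) (y : ℝ) :
    (fwdDiff δ)^[m] (fun v => (f v).re) y = ((fwdDiff δ)^[m] f y).re := by
  induction m generalizing f with
  | zero => rfl
  | succ m ih =>
    rw [Function.iterate_succ_apply, Function.iterate_succ_apply, ← ih]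
    rfl

theorem fwdDiff_iterate_integral_exp (σ δ : ℝ) (m : ℕ) {G : ℝ → ℂ}
    (hG : Integrable G) (y : ℝ) :
    (fwdDiff δ)^[m] (fun v : ℝ => ∫ t : ℝ, G t * cexp ((σ + t * I) * v)) y =
      ∫ t : ℝ, (cexp ((σ + t * I) * δ) - 1) ^ m * G t * cexp ((σ + t * I) * y) := by
  have hnorm : ∀ (v t : ℝ), ‖cexp ((σ + t * I) * v)‖ = Real.exp (σ * v) := fun v t => by
    rw [Complex.norm_exp]; simp
  have hI : ∀ {G : ℝ → ℂ}, Integrable G → ∀ v : ℝ,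
      Integrable fun t : ℝ => G t * cexp ((σ + t * I) * v) := fun {G} hG v =>
    hG.mul_bdd (c := Real.exp (σ * v)) (by fun_prop)
      (Filter.Eventually.of_forall fun t => (hnorm v t).le)
  induction m generalizing G with
  | zero => simp
  | succ m ih =>
    have hstep : fwdDiff δ (fun v : ℝ => ∫ t : ℝ, G t * cexp ((σ + t * I) * v)) =
        fun v : ℝ => ∫ t : ℝ, (cexp ((σ + t * I) * δ) - 1) * G t * cexp ((σ + t * I) * v) := by
      funext v
      simp only [fwdDiff]
      rw [← integral_sub (hI hG (v + δ)) (hI hG v)]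
      refine integral_congr_ae (Filter.Eventually.of_forall fun t => ?_)
      simp only
      rw [show (σ + t * I) * ((v + δ : ℝ) : ℂ) = (σ + t * I) * v + (σ + t * I) * δ by
        push_cast; ring, Complex.exp_add]
      ring
    have hG' : Integrable fun t : ℝ => (cexp ((σ + t * I) * δ) - 1) * G t := by
      have : (fun t : ℝ => (cexp ((σ + t * I) * δ) - 1) * G t) =
          fun t : ℝ => G t * cexp ((σ + t * I) * δ) - G t := by funext t; ring
      rw [this]
      exact (hI hG δ).sub hG
    rw [Function.iterate_succ_apply, hstep, ih hG']
    refine integral_congr_ae (Filter.Eventually.of_forall fun t => ?_)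
    simp only
    ring

/-- Interpolation between the bounds O(|z|) for small z and O(1) for large z; a fractional θ lets
the growth in t be tuned to just below divergence. -/
theorem norm_exp_sub_one_le_rpow {z : ℂ} (hz : z.re ≤ 1) {θ : ℝ} (h0 : 0 ≤ θ) (h1 : θ ≤ 1) :
    ‖cexp z - 1‖ ≤ 4 * ‖z‖ ^ θ := by
  rcases le_total ‖z‖ 1 with h | h
  · calc ‖cexp z - 1‖ ≤ 2 * ‖z‖ := Complex.norm_exp_sub_one_le h
      _ = 2 * ‖z‖ ^ (1 : ℝ) := by rw [Real.rpow_one]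
      _ ≤ 2 * ‖z‖ ^ θ := by
          gcongr 2 * ?_
          exact Real.rpow_le_rpow_of_exponent_ge_of_imp (norm_nonneg _) h h1
            (fun _ h => absurd h (by norm_num))
      _ ≤ 4 * ‖z‖ ^ θ := by
          have : 0 ≤ ‖z‖ ^ θ := by positivity
          linarith
  · calc ‖cexp z - 1‖ ≤ ‖cexp z‖ + 1 := by simpa using norm_sub_le (cexp z) 1
      _ ≤ 4 * 1 := by
          rw [Complex.norm_exp]
          have h2 := Real.exp_le_exp.2 hz
          have h3 := Real.exp_one_lt_d9
          linarith
      _ ≤ 4 * ‖z‖ ^ θ := by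
          gcongr
          exact Real.one_le_rpow h h0

end Differences

/-! ### From contour integrals to pointwise bounds -/

section Smoothing

open MeasureTheory Set Complex

/-- Iterated primitives of a function whose Laplace transform is `g(s) / s` are given by an integral
of `g` over a line inside the strip where `g` is holomorphic. -/
theorem iterate_primitive_eq_integral {b c σ K : ℝ} {k : ℕ} {E : ℝ → ℂ} {g : ℂ → ℂ} (hb : 0 < b)
    (hbc : b < c) (hσ : 0 < σ) (hσ1 : σ ≤ 1) (hσc : σ ≤ c) (hE : ExpGrowth b E)
    (hlap : ∀ t : ℝ, laplace E (c + t * I) = g (c + t * I) / (c + t * I))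
    (hg : DifferentiableOn ℂ g {s | σ ≤ s.re ∧ s.re ≤ c}) (hK : 0 ≤ K)
    (hgb : ∀ s : ℂ, σ ≤ s.re → s.re ≤ c → ‖g s‖ ≤ K * ‖s‖ ^ k) :
    Integrable (fun t : ℝ => g (σ + t * I) / (σ + t * I) ^ (k + 2)) ∧
    ∀ y : ℝ, primitive^[k + 1] E y = 1 / (2 * Real.pi) *
      ∫ t : ℝ, g (σ + t * I) / (σ + t * I) ^ (k + 2) * cexp ((σ + t * I) * y) := by
  have hne : ∀ s : ℂ, σ ≤ s.re → s ≠ 0 := fun s hs h => by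
    rw [h, zero_re] at hs; linarith
  have hsq : ∀ s : ℂ, σ ≤ s.re → σ ^ 2 * (1 + s.im ^ 2) ≤ ‖s‖ ^ 2 := fun s hs => by
    rw [← Complex.normSq_eq_norm_sq, Complex.normSq_apply]
    nlinarith [sq_nonneg s.im, mul_nonneg (sub_nonneg.2 hσ1) (sq_nonneg s.im),
      mul_self_le_mul_self hσ.le hs, mul_le_mul_of_nonneg_left hσ1 hσ.le]
  set G : ℂ → ℂ := fun s => g s / s ^ (k + 2) with hG
  have hGd : DifferentiableOn ℂ G {s | σ ≤ s.re ∧ s.re ≤ c} :=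
    hg.div (by fun_prop) fun s hs => pow_ne_zero _ (hne s hs.1)
  have hGb : ∀ s : ℂ, σ ≤ s.re → s.re ≤ c → ‖G s‖ ≤ K / σ ^ 2 * (1 + s.im ^ 2)⁻¹ :=
    fun s h1 h2 => by
      have hs0 : 0 < ‖s‖ := norm_pos_iff.2 (hne s h1)
      have h4 : 0 < 1 + s.im ^ 2 := by positivity
      simp only [hG]
      rw [norm_div, norm_pow]
      calc ‖g s‖ / ‖s‖ ^ (k + 2) ≤ K * ‖s‖ ^ k / ‖s‖ ^ (k + 2) := by gcongr; exact hgb s h1 h2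
        _ = K / ‖s‖ ^ 2 := by rw [pow_add]; field_simp
        _ ≤ K / (σ ^ 2 * (1 + s.im ^ 2)) := by gcongr; exact hsq s h1
        _ = _ := by field_simp
  have hline : ∀ τ : ℝ, σ ≤ τ → τ ≤ c → Integrable fun t : ℝ => G (τ + t * I) := fun τ h1 h2 =>
    integrable_vertical_of_bound (K := K / σ ^ 2)
      (continuous_vertical hGd.continuousOn fun t => by simpa using ⟨h1, h2⟩)
      (fun t => by simpa using hGb (τ + t * I) (by simpa using h1) (by simpa using h2))
  refine ⟨hline σ le_rfl hσc, fun y => ?_⟩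
  have hlapm : ∀ t : ℝ, laplace (primitive^[k + 1] E) (c + t * I) = G (c + t * I) := fun t => by
    rw [hE.laplace_iterate_primitive hb (by simpa using hbc), hlap, div_div, ← pow_succ']
  have hcont : Continuous (primitive^[k + 1] E) := by
    rw [Function.iterate_succ']
    exact (hE.iterate_primitive hb k).continuous_primitive hb
  have hinv := (hE.iterate_primitive hb (k + 1)).laplace_inversion hcont hbc
    (by simp_rw [hlapm]; exact hline c hσc le_rfl) y
  simp_rw [hlapm] at hinv
  rw [hinv]
  congr 1
  refine integral_vertical_eq (f := fun s => G s * cexp (s * y))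
    (K := K / σ ^ 2 * Real.exp (c * |y|)) hσc (hGd.mul (by fun_prop)) fun s h1 h2 => ?_
  have h3 : ‖cexp (s * y)‖ ≤ Real.exp (c * |y|) := by
    rw [Complex.norm_exp]
    refine Real.exp_le_exp.2 ?_
    have h4 : (s * y).re = s.re * y := by simp
    rw [h4]
    calc s.re * y ≤ s.re * |y| := mul_le_mul_of_nonneg_left (le_abs_self y) (by linarith)
      _ ≤ c * |y| := mul_le_mul_of_nonneg_right h2 (abs_nonneg y)
  rw [norm_mul]
  calc ‖G s‖ * ‖cexp (s * y)‖ ≤ K / σ ^ 2 * (1 + s.im ^ 2)⁻¹ * Real.exp (c * |y|) := by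
        gcongr
        exact hGb s h1 h2
    _ = _ := by ring

/-- The crude strip bound (exponent k) only justifies moving the contour to Re s = σ; the size of
the result comes from the sharper bound (exponent κ) on that line. Differencing multiplies the
integrand by (exp(sδ) - 1)^(k+1). -/
theorem norm_fwdDiff_iterate_primitive_le {b c σ K K' κ η : ℝ} {k : ℕ} {E : ℝ → ℂ} {g : ℂ → ℂ}
    (hb : 0 < b) (hbc : b < c) (hσ : 0 < σ) (hσ1 : σ ≤ 1) (hσc : σ ≤ c) (hE : ExpGrowth b E)
    (hlap : ∀ t : ℝ, laplace E (c + t * I) = g (c + t * I) / (c + t * I))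
    (hg : DifferentiableOn ℂ g {s | σ ≤ s.re ∧ s.re ≤ c}) (hK : 0 ≤ K)
    (hgb : ∀ s : ℂ, σ ≤ s.re → s.re ≤ c → ‖g s‖ ≤ K * ‖s‖ ^ k) (hK' : 0 ≤ K')
    (hgσ : ∀ t : ℝ, ‖g (σ + t * I)‖ ≤ K' * (1 + |t|) ^ κ) (hκ : 0 ≤ κ) (hη : 0 < η)
    (hκη : κ + η ≤ k + 1) :
    ∃ C : ℝ, 0 ≤ C ∧ ∀ δ : ℝ, 0 < δ → δ ≤ 1 → ∀ y : ℝ,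
      ‖(fwdDiff δ)^[k + 1] (primitive^[k + 1] E) y‖ ≤
        δ ^ (k + 1) * (C * δ ^ (-(κ + η)) * Real.exp (σ * y)) := by
  obtain ⟨hGi, hform⟩ := iterate_primitive_eq_integral hb hbc hσ hσ1 hσc hE hlap hg hK hgb
  set J : ℝ := ∫ t : ℝ, (1 + ‖t‖) ^ (-(1 + η)) with hJ
  have hJi : Integrable fun t : ℝ => (1 + ‖t‖) ^ (-(1 + η)) :=
    integrable_one_add_norm (by simp; linarith)
  have hJ0 : 0 ≤ J := integral_nonneg fun t => by positivity
  set B : ℝ := 4 ^ (k + 1) * K' * (σ / 2) ^ (-(1 + κ + η)) with hB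
  have hB0 : 0 ≤ B := by positivity
  refine ⟨1 / (2 * Real.pi) * (B * J), by positivity, fun δ hδ hδ1 y => ?_⟩
  have hfun : primitive^[k + 1] E = ((1 / (2 * Real.pi) : ℂ)) • fun y : ℝ =>
      ∫ t : ℝ, g (σ + t * I) / (σ + t * I) ^ (k + 2) * cexp ((σ + t * I) * y) := by
    funext y; rw [hform y]; rfl
  rw [hfun, fwdDiff_iter_const_smul, Pi.smul_apply, fwdDiff_iterate_integral_exp σ δ _ hGi,
    norm_smul]
  -- Bounding the differencing factor by a multiple of |sδ|^β leaves an integrand of order (1 +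
  -- |t|)^(-(1+η)), which is just integrable, and saves δ^β.
  set β : ℝ := (k : ℝ) + 1 - (κ + η) with hβ
  have hβ0 : 0 ≤ β := by linarith
  have hk1 : (0 : ℝ) < (k : ℝ) + 1 := by positivity
  have hpt : ∀ t : ℝ, ‖(cexp ((σ + t * I) * δ) - 1) ^ (k + 1) *
      (g (σ + t * I) / (σ + t * I) ^ (k + 2)) * cexp ((σ + t * I) * y)‖ ≤
      B * δ ^ β * Real.exp (σ * y) * (1 + ‖t‖) ^ (-(1 + η)) := fun t => by
    set s : ℂ := σ + t * I with hs
    have hre : s.re = σ := by simp [hs]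
    have him : s.im = t := by simp [hs]
    have hs1 : σ ≤ ‖s‖ := by
      have := Complex.re_le_norm s; rwa [hre] at this
    have hs2 : |t| ≤ ‖s‖ := by
      have := Complex.abs_im_le_norm s; rwa [him] at this
    have hs0 : 0 < ‖s‖ := by linarith
    have ht0 : 0 < 1 + |t| := by positivity
    have hlow : σ / 2 * (1 + |t|) ≤ ‖s‖ := by
      have : σ * |t| ≤ 1 * |t| := mul_le_mul_of_nonneg_right hσ1 (abs_nonneg t)
      linarith
    have h1 : ‖cexp (s * δ) - 1‖ ^ (k + 1) ≤ 4 ^ (k + 1) * (δ ^ β * ‖s‖ ^ β) := by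
      have h2 := norm_exp_sub_one_le_rpow (z := s * δ) (θ := β / (k + 1))
        (by
          have : (s * δ).re = σ * δ := by simp [hre]
          rw [this]; nlinarith)
        (by positivity) (by rw [div_le_one hk1]; linarith)
      rw [norm_mul, Complex.norm_real, Real.norm_of_nonneg hδ.le] at h2
      calc ‖cexp (s * δ) - 1‖ ^ (k + 1) ≤ (4 * (‖s‖ * δ) ^ (β / (k + 1))) ^ (k + 1) := by gcongr
        _ = 4 ^ (k + 1) * (δ ^ β * ‖s‖ ^ β) := by
            rw [mul_pow, ← Real.rpow_natCast ((‖s‖ * δ) ^ (β / (k + 1))),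
              ← Real.rpow_mul (by positivity)]
            have : β / ((k : ℝ) + 1) * ((k + 1 : ℕ) : ℝ) = β := by push_cast; field_simp
            rw [this, Real.mul_rpow hs0.le hδ.le]; ring
    have h3 : ‖cexp (s * y)‖ = Real.exp (σ * y) := by
      rw [Complex.norm_exp]; simp [hre]
    have h4 : ‖s‖ ^ β / ‖s‖ ^ (k + 2) ≤ (σ / 2) ^ (-(1 + κ + η)) * (1 + |t|) ^ (-(1 + κ + η)) := by
      rw [← Real.mul_rpow (by positivity) ht0.le, ← Real.rpow_natCast, ← Real.rpow_sub hs0]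
      have : β - ((k + 2 : ℕ) : ℝ) = -(1 + κ + η) := by rw [hβ]; push_cast; ring
      rw [this]
      exact Real.rpow_le_rpow_of_nonpos (by positivity) hlow (by linarith)
    rw [norm_mul, norm_mul, norm_div, norm_pow, norm_pow, h3, Real.norm_eq_abs]
    calc ‖cexp (s * δ) - 1‖ ^ (k + 1) * (‖g s‖ / ‖s‖ ^ (k + 2)) * Real.exp (σ * y)
        ≤ 4 ^ (k + 1) * (δ ^ β * ‖s‖ ^ β) * (K' * (1 + |t|) ^ κ / ‖s‖ ^ (k + 2)) *
            Real.exp (σ * y) := by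
          gcongr
          exact hgσ t
      _ = 4 ^ (k + 1) * K' * δ ^ β * (1 + |t|) ^ κ * Real.exp (σ * y) *
            (‖s‖ ^ β / ‖s‖ ^ (k + 2)) := by ring
      _ ≤ 4 ^ (k + 1) * K' * δ ^ β * (1 + |t|) ^ κ * Real.exp (σ * y) *
            ((σ / 2) ^ (-(1 + κ + η)) * (1 + |t|) ^ (-(1 + κ + η))) := by gcongr
      _ = B * δ ^ β * Real.exp (σ * y) * ((1 + |t|) ^ κ * (1 + |t|) ^ (-(1 + κ + η))) := by
          rw [hB]; ring
      _ = _ := by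
          rw [← Real.rpow_add ht0, show κ + -(1 + κ + η) = -(1 + η) by ring]
  have hf_int := norm_integral_le_of_norm_le
    (hJi.const_mul (B * δ ^ β * Real.exp (σ * y))) (Filter.Eventually.of_forall hpt)
  rw [integral_const_mul] at hf_int
  have hc : ‖(1 / (2 * Real.pi) : ℂ)‖ = 1 / (2 * Real.pi) := by
    rw [norm_div, norm_mul, Complex.norm_real, Real.norm_of_nonneg Real.pi_pos.le]; simp
  rw [hc]
  have hδβ : δ ^ β = δ ^ (k + 1) * δ ^ (-(κ + η)) := by
    rw [← Real.rpow_natCast, ← Real.rpow_add hδ, hβ]; push_cast; rfl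
  calc 1 / (2 * Real.pi) * _
      ≤ 1 / (2 * Real.pi) * (B * δ ^ β * Real.exp (σ * y) * J) := by gcongr
    _ = _ := by rw [hδβ]; ring

/-- A function that increases, up to a smooth main term, is controlled by the differences of its
iterated primitives. -/
theorem abs_re_le_of_fwdDiff_bound {A : ℝ → ℝ} (hA : Monotone A) {M : ℝ → ℂ} {b : ℝ} (hb : 0 < b)
    (hE : ExpGrowth b fun y => (A y : ℂ) - M y) {m : ℕ} {δ : ℝ} (hδ : 0 < δ) {y V R : ℝ}
    (hV : ∀ v ∈ Icc (y - m * δ) (y + m * δ), |(M v).re - (M y).re| ≤ V)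
    (hR : ∀ v ∈ Icc (y - m * δ) y,
      ‖(fwdDiff δ)^[m] (primitive^[m] fun y => (A y : ℂ) - M y) v‖ ≤ δ ^ m * R) :
    |A y - (M y).re| ≤ V + R := by
  set f : ℕ → ℝ → ℝ := fun j v => (primitive^[j] (fun y => (A y : ℂ) - M y) v).re with hf
  have hEj := fun j => hE.iterate_primitive hb j
  have hf_int : ∀ j a b, IntervalIntegrable (f j) volume a b := fun j a c => by
    have h := (hEj j).intervalIntegrable hb a c
    exact ⟨h.1.re, h.2.re⟩
  have hrel : ∀ j a b, f (j + 1) b - f (j + 1) a = ∫ v in a..b, f j v := fun j a c => by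
    have h := congrArg Complex.re ((hEj j).primitive_sub hb a c)
    simp only [hf, Function.iterate_succ_apply']
    rw [sub_re] at h
    rw [h]
    exact ((Complex.reCLM.intervalIntegral_comp_comm ((hEj j).intervalIntegrable hb a c))).symm
  have hf0 : ∀ v, f 0 v = A v - (M v).re := fun v => by simp [hf]
  have hδm : 0 ≤ (m : ℝ) * δ := by positivity
  have hpow : 0 < δ ^ m := by positivity
  have hre : ∀ v, |(fwdDiff δ)^[m] (f m) v| ≤
      ‖(fwdDiff δ)^[m] (primitive^[m] fun y => (A y : ℂ) - M y) v‖ := fun v => by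
    simp only [hf]
    rw [fwdDiff_iterate_re]
    exact Complex.abs_re_le_norm _
  rw [abs_le]
  constructor
  -- Lower bound: average over [y - mδ, y], where A v ≤ A y. The upper bound below averages over [y,
  -- y + mδ] in the same way.
  · have h1 := fwdDiff_iterate_le hδ.le hf_int hrel m (y := y - m * δ)
      (U := A y - (M y).re + V) fun v hv => by
        rw [sub_add_cancel] at hv
        rw [hf0]
        have h2 := hA hv.2
        have h3 := abs_le.1 (hV v ⟨hv.1, by linarith [hv.2]⟩)
        linarith [h3.1]
    have h2 := (neg_le_of_abs_le ((hre (y - m * δ)).trans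
      (hR (y - m * δ) ⟨le_rfl, by linarith⟩))).trans h1
    have h3 : δ ^ m * (-R) ≤ δ ^ m * (A y - (M y).re + V) := by linarith
    have := le_of_mul_le_mul_left h3 hpow
    linarith
  · have h1 := le_fwdDiff_iterate hδ.le hf_int hrel m (y := y)
      (U := A y - (M y).re - V) fun v hv => by
        rw [hf0]
        have h2 := hA hv.1
        have h3 := abs_le.1 (hV v ⟨by linarith [hv.1], hv.2⟩)
        linarith [h3.2]
    have h2 := h1.trans (le_of_abs_le ((hre y).trans (hR y ⟨by linarith, le_rfl⟩)))
    have := le_of_mul_le_mul_left h2 hpow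
    linarith

end Smoothing

/-! ### The summatory function of `(r + 1) ^ ω(n)` -/

section Summatory

open MeasureTheory Set Complex

/-- The summatory function of `(r + 1) ^ ω(n)` in the variable `log x`. -/
noncomputable def logSummatory (r : ℕ) (y : ℝ) : ℝ :=
  ∑ n ∈ Finset.Icc 1 ⌊Real.exp y⌋₊, (omegaPow (r + 1) n : ℝ)

theorem omegaPow_cast_nonneg (k n : ℕ) : (0 : ℝ) ≤ omegaPow k n := by
  exact_mod_cast omegaPow_nonneg k n

theorem monotone_logSummatory (r : ℕ) : Monotone (logSummatory r) := fun _ _ hxy =>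
  Finset.sum_le_sum_of_subset_of_nonneg
    (Finset.Icc_subset_Icc_right (Nat.floor_le_floor (Real.exp_le_exp.2 hxy)))
    fun n _ _ => omegaPow_cast_nonneg _ n

/-- Rankin's trick: insert (x/n)^b ≥ 1 and extend the sum to the convergent Dirichlet series at b.
-/
theorem exists_sum_omegaPow_le (r : ℕ) {b : ℝ} (hb : 1 < b) :
    ∃ C : ℝ, 0 ≤ C ∧ ∀ x : ℝ, 0 ≤ x →
      ∑ n ∈ Finset.Icc 1 ⌊x⌋₊, (omegaPow (r + 1) n : ℝ) ≤ C * x ^ b := by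
  have hs : Summable fun n : ℕ => (omegaPow (r + 1) n : ℝ) * (n : ℝ) ^ (-b) := by
    have h := (LSeriesHasSum_omegaPow r (s := b) (by simpa using hb)).LSeriesSummable.norm
    refine h.congr fun n => ?_
    rw [LSeries.norm_term_eq]
    rcases eq_or_ne n 0 with rfl | hn
    · simp
    · rw [if_neg hn, Real.rpow_neg (by positivity), div_eq_mul_inv]
      congr 1
      simp only [Complex.norm_intCast]
      exact abs_of_nonneg (omegaPow_cast_nonneg _ n)
  refine ⟨∑' n : ℕ, (omegaPow (r + 1) n : ℝ) * (n : ℝ) ^ (-b),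
    tsum_nonneg fun n => mul_nonneg (omegaPow_cast_nonneg _ n) (by positivity), fun x hx => ?_⟩
  calc ∑ n ∈ Finset.Icc 1 ⌊x⌋₊, (omegaPow (r + 1) n : ℝ)
      ≤ ∑ n ∈ Finset.Icc 1 ⌊x⌋₊, (omegaPow (r + 1) n : ℝ) * (n : ℝ) ^ (-b) * x ^ b := by
        refine Finset.sum_le_sum fun n hn => ?_
        rw [Finset.mem_Icc] at hn
        have hn0 : (0 : ℝ) < n := by exact_mod_cast hn.1
        have hnx : (n : ℝ) ≤ x := (Nat.le_floor_iff hx).1 hn.2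
        rw [mul_assoc]
        refine le_mul_of_one_le_right (omegaPow_cast_nonneg _ n) ?_
        rw [Real.rpow_neg hn0.le, inv_mul_eq_div, ← Real.div_rpow hx hn0.le]
        exact Real.one_le_rpow ((one_le_div hn0).2 hnx) (by linarith)
    _ ≤ _ := by
        rw [← Finset.sum_mul]
        refine mul_le_mul_of_nonneg_right (hs.sum_le_tsum _ fun n _ => ?_) (by positivity)
        exact mul_nonneg (omegaPow_cast_nonneg _ n) (by positivity)

theorem logSummatory_of_neg (r : ℕ) {y : ℝ} (hy : y < 0) : logSummatory r y = 0 := by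
  have : ⌊Real.exp y⌋₊ = 0 := Nat.floor_eq_zero.2 (by simpa using hy)
  simp [logSummatory, this]

theorem expGrowth_logSummatory (r : ℕ) {b : ℝ} (hb : 1 < b) :
    ExpGrowth b fun y => (logSummatory r y : ℂ) := by
  obtain ⟨C, hC, h⟩ := exists_sum_omegaPow_le r hb
  refine ⟨(Complex.measurable_ofReal.comp
    (monotone_logSummatory r).measurable).aestronglyMeasurable,
    fun y hy => by rw [logSummatory_of_neg r hy, ofReal_zero], C, hC, fun y => ?_⟩
  have h0 : 0 ≤ logSummatory r y := Finset.sum_nonneg fun n _ => omegaPow_cast_nonneg _ n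
  rw [Complex.norm_real, Real.norm_of_nonneg h0, mul_comm b y, Real.exp_mul]
  exact h _ (Real.exp_pos y).le

/-- Abel summation expresses the Dirichlet series as s times a Mellin integral of the summatory
function; the substitution x = e^y makes that a Laplace transform. -/
theorem laplace_logSummatory (r : ℕ) {s : ℂ} (hs : 1 < s.re) :
    laplace (fun y => (logSummatory r y : ℂ)) s =
      riemannZeta s ^ (r + 1) * quotientSeries r s / s := by
  obtain ⟨b, hb1, hbs⟩ := exists_between hs
  obtain ⟨C, hC, h⟩ := exists_sum_omegaPow_le r hb1
  have hs0 : s ≠ 0 := by rintro rfl; simp at hs; linarith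
  have hL := LSeries_eq_mul_integral_of_nonneg (fun n => (omegaPow (r + 1) n : ℝ))
    (r := b) (by linarith) hbs
    (Asymptotics.IsBigO.of_bound C (Filter.Eventually.of_forall fun n => by
      have h1 := h n (by positivity)
      rw [Nat.floor_natCast] at h1
      rwa [Real.norm_of_nonneg (Finset.sum_nonneg fun n _ => omegaPow_cast_nonneg _ n),
        Real.norm_of_nonneg (by positivity)]))
    (fun n => omegaPow_cast_nonneg _ n)
  have hF : LSeries (fun n => ((omegaPow (r + 1) n : ℝ) : ℂ)) s =
      riemannZeta s ^ (r + 1) * quotientSeries r s := by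
    have := (LSeriesHasSum_omegaPow r hs).LSeries_eq
    simpa using this
  have himage : Real.exp '' Ioi 0 = Ioi 1 := by
    ext x
    constructor
    · rintro ⟨y, hy, rfl⟩
      exact Real.one_lt_exp_iff.2 hy
    · intro hx
      exact ⟨Real.log x, Real.log_pos hx, Real.exp_log (lt_trans one_pos hx)⟩
  rw [hF, ← himage, integral_image_eq_integral_abs_deriv_smul measurableSet_Ioi
    (fun y _ => (Real.hasDerivAt_exp y).hasDerivWithinAt) Real.exp_injective.injOn] at hL
  rw [eq_div_iff hs0, hL, mul_comm]
  congr 1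
  rw [laplace, ← setIntegral_eq_integral_of_forall_compl_eq_zero (s := Ici (0 : ℝ))
    (fun y hy => by rw [logSummatory_of_neg r (by simpa using hy)]; simp),
    integral_Ici_eq_integral_Ioi]
  refine setIntegral_congr_fun measurableSet_Ioi fun y _ => ?_
  simp only [logSummatory]
  have hc : (Real.exp y : ℂ) ^ (-(s + 1)) = cexp (-(s + 1) * y) := by
    rw [cpow_def_of_ne_zero (by exact_mod_cast (Real.exp_pos y).ne'), ← ofReal_log
      (Real.exp_pos y).le, Real.log_exp, mul_comm]
  rw [abs_of_pos (Real.exp_pos y), Complex.real_smul, hc, mul_left_comm, ofReal_exp,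
    ← Complex.exp_add]
  push_cast
  congr 2
  ring

end Summatory

/-! ### The main term -/

section MainTerm

open MeasureTheory Set Complex Polynomial

/-- The density `v ^ i / i!` on the positive half-line. -/
noncomputable def powDensity (i : ℕ) : ℝ → ℂ :=
  (Ici (0 : ℝ)).indicator fun v => (v : ℂ) ^ i / (i.factorial : ℂ)

theorem expGrowth_powDensity_zero {b : ℝ} (hb : 0 < b) : ExpGrowth b (powDensity 0) := by
  refine ⟨?_, fun y hy => indicator_of_notMem (by simpa using hy) _, 1, zero_le_one, fun y => ?_⟩
  · exact (Measurable.indicator (by fun_prop) measurableSet_Ici).aestronglyMeasurable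
  · by_cases hy : 0 ≤ y
    · rw [powDensity, indicator_of_mem (mem_Ici.2 hy)]
      simpa using mul_nonneg hb.le hy
    · rw [powDensity, indicator_of_notMem (by simpa using hy), norm_zero]
      positivity

theorem laplace_powDensity_zero {s : ℂ} (hs : 0 < s.re) : laplace (powDensity 0) s = 1 / s := by
  have h : (fun y : ℝ => powDensity 0 y * cexp (-(s * y))) =
      (Ici (0 : ℝ)).indicator fun y : ℝ => cexp (-s * y) := by
    funext y
    by_cases hy : 0 ≤ y
    · simp [powDensity, hy]
    · simp [powDensity, hy]
  rw [laplace, h, integral_indicator measurableSet_Ici, integral_Ici_eq_integral_Ioi,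
    integral_exp_mul_complex_Ioi (by simpa using hs)]
  simp

theorem primitive_powDensity {b : ℝ} (hb : 0 < b) {i : ℕ} (h : ExpGrowth b (powDensity i)) :
    primitive (powDensity i) = powDensity (i + 1) := by
  funext y
  by_cases hy : 0 ≤ y
  · have h0 := h.primitive_sub hb 0 y
    rw [primitive_eq_zero h.zero le_rfl, sub_zero] at h0
    rw [h0, powDensity, powDensity, indicator_of_mem (mem_Ici.2 hy)]
    have : ∫ v in (0 : ℝ)..y, (Ici (0 : ℝ)).indicator
        (fun v : ℝ => (v : ℂ) ^ i / (i.factorial : ℂ)) v =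
        ∫ v in (0 : ℝ)..y, ((v ^ i / i.factorial : ℝ) : ℂ) := by
      refine intervalIntegral.integral_congr fun v hv => ?_
      rw [uIcc_of_le hy] at hv
      rw [indicator_of_mem (mem_Ici.2 hv.1)]
      push_cast; rfl
    rw [this, intervalIntegral.integral_ofReal, intervalIntegral.integral_div, integral_pow,
      Nat.factorial_succ]
    push_cast
    rw [zero_pow i.succ_ne_zero, sub_zero, div_div]
  · rw [primitive_eq_zero h.zero (le_of_not_ge hy), powDensity,
      indicator_of_notMem (by simpa using hy)]

theorem powDensity_eq_iterate (i : ℕ) : powDensity i = primitive^[i] (powDensity 0) := by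
  induction i with
  | zero => rfl
  | succ i ih =>
    rw [Function.iterate_succ_apply', ← ih, primitive_powDensity one_pos]
    rw [ih]
    exact (expGrowth_powDensity_zero one_pos).iterate_primitive one_pos i

theorem expGrowth_powDensity {b : ℝ} (hb : 0 < b) (i : ℕ) : ExpGrowth b (powDensity i) := by
  rw [powDensity_eq_iterate]
  exact (expGrowth_powDensity_zero hb).iterate_primitive hb i

theorem laplace_powDensity (i : ℕ) {s : ℂ} (hs : 0 < s.re) :
    laplace (powDensity i) s = 1 / s ^ (i + 1) := by
  obtain ⟨b, hb, hbs⟩ := exists_between hs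
  rw [powDensity_eq_iterate, (expGrowth_powDensity_zero hb).laplace_iterate_primitive hb hbs,
    laplace_powDensity_zero hs, div_div, pow_succ']

/-- The density of the main term: `exp v` times a polynomial on the positive half-line. -/
noncomputable def mainDensity (a : ℕ → ℂ) (n : ℕ) (v : ℝ) : ℂ :=
  ∑ i ∈ Finset.range n, a i * (Real.exp v * powDensity i v)

theorem expGrowth_mainDensity (a : ℕ → ℂ) (n : ℕ) {b : ℝ} (hb : 1 < b) :
    ExpGrowth b (mainDensity a n) := by
  have key := fun i => expGrowth_powDensity (sub_pos.2 hb) i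
  choose C hC hbd using fun i => (key i).bound
  refine ⟨?_, fun y hy => ?_, ∑ i ∈ Finset.range n, ‖a i‖ * C i,
    Finset.sum_nonneg fun i _ => mul_nonneg (norm_nonneg _) (hC i), fun y => ?_⟩
  · exact Finset.aestronglyMeasurable_fun_sum _ fun i _ =>
      AEStronglyMeasurable.const_mul (AEStronglyMeasurable.mul (by fun_prop) (key i).meas) _
  · exact Finset.sum_eq_zero fun i _ => by rw [(key i).zero y hy]; simp
  · rw [Finset.sum_mul]
    refine norm_sum_le_of_le _ fun i _ => ?_
    rw [norm_mul, norm_mul, mul_assoc, norm_real, Real.norm_of_nonneg (Real.exp_pos y).le]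
    refine mul_le_mul_of_nonneg_left ?_ (norm_nonneg _)
    calc Real.exp y * ‖powDensity i y‖ ≤ Real.exp y * (C i * Real.exp ((b - 1) * y)) := by
          gcongr; exact hbd i y
      _ = C i * Real.exp (b * y) := by
          rw [mul_left_comm, ← Real.exp_add]; congr 2; ring

theorem laplace_mainDensity (a : ℕ → ℂ) (n : ℕ) {s : ℂ} (hs : 1 < s.re) :
    laplace (mainDensity a n) s = ∑ i ∈ Finset.range n, a i / (s - 1) ^ (i + 1) := by
  have hs' : 0 < (s - 1).re := by simpa using hs
  obtain ⟨b, hb, hbs⟩ := exists_between hs'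
  have h : ∀ y : ℝ, mainDensity a n y * cexp (-(s * y)) =
      ∑ i ∈ Finset.range n, a i * (powDensity i y * cexp (-((s - 1) * y))) := fun y => by
    rw [mainDensity, Finset.sum_mul]
    refine Finset.sum_congr rfl fun i _ => ?_
    rw [show -((s - 1) * y) = y + -(s * y) by ring, Complex.exp_add, ofReal_exp]
    ring
  rw [laplace]
  simp only [h]
  rw [integral_finsetSum _ fun i _ => ((expGrowth_powDensity hb i).integrable hbs).const_mul _]
  refine Finset.sum_congr rfl fun i _ => ?_
  rw [integral_const_mul, ← laplace, laplace_powDensity i hs', mul_one_div]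

/-- Invert 1 + d/dX by the finite alternating sum of derivatives of Q. Because (e^v P)' = e^v (P +
P'), this integrates e^v Q explicitly. -/
theorem exists_add_derivative_eq {Q : ℝ[X]} (hQ : Q ≠ 0) :
    ∃ P : ℝ[X], P + derivative P = Q ∧ P.natDegree = Q.natDegree ∧
      P.leadingCoeff = Q.leadingCoeff := by
  have key : ∀ n : ℕ, (∑ j ∈ Finset.range n, (-1 : ℝ[X]) ^ j * derivative^[j] Q) +
      derivative (∑ j ∈ Finset.range n, (-1 : ℝ[X]) ^ j * derivative^[j] Q) =
      Q - (-1) ^ n * derivative^[n] Q := fun n => by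
    induction n with
    | zero => simp
    | succ n ih =>
      have hd : derivative ((-1 : ℝ[X]) ^ n * derivative^[n] Q) =
          (-1) ^ n * derivative^[n + 1] Q := by
        rw [show (-1 : ℝ[X]) ^ n = C ((-1) ^ n) by simp, derivative_C_mul,
          Function.iterate_succ_apply']
      rw [Finset.sum_range_succ, derivative_add, hd, add_add_add_comm, ih]
      ring
  have h := key (Q.natDegree + 1)
  rw [iterate_derivative_eq_zero (Nat.lt_succ_self _), mul_zero, sub_zero] at h
  refine ⟨_, h, ?_, ?_⟩ <;>
  set P := ∑ j ∈ Finset.range (Q.natDegree + 1), (-1 : ℝ[X]) ^ j * derivative^[j] Q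
  all_goals
    have hP : P ≠ 0 := fun h0 => hQ (by rw [← h, h0]; simp)
    have hlt := degree_derivative_lt hP
    rw [← h]
  · exact (natDegree_eq_of_degree_eq (degree_add_eq_left_of_degree_lt hlt)).symm
  · exact (leadingCoeff_add_of_degree_lt' hlt).symm

theorem re_primitive_mainDensity (a : ℕ → ℂ) (n : ℕ) {P : ℝ[X]}
    (hP : P + derivative P =
      ∑ i ∈ Finset.range n, C ((a i).re / i.factorial) * X ^ i) {y : ℝ} (hy : 0 ≤ y) :
    (primitive (mainDensity a n) y).re = Real.exp y * P.eval y - P.eval 0 := by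
  have hm := expGrowth_mainDensity a n one_lt_two
  have h0 := hm.primitive_sub two_pos 0 y
  rw [primitive_eq_zero hm.zero le_rfl, sub_zero] at h0
  have hre : (∫ v in (0 : ℝ)..y, mainDensity a n v).re =
      ∫ v in (0 : ℝ)..y, (mainDensity a n v).re :=
    (Complex.reCLM.intervalIntegral_comp_comm (hm.intervalIntegrable two_pos 0 y)).symm
  have hcongr : ∫ v in (0 : ℝ)..y, (mainDensity a n v).re =
      ∫ v in (0 : ℝ)..y, (Real.exp v * P.eval v + Real.exp v * (derivative P).eval v) := by
    refine intervalIntegral.integral_congr fun v hv => ?_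
    rw [uIcc_of_le hy] at hv
    rw [← mul_add, ← eval_add, hP, eval_finsetSum, Finset.mul_sum, mainDensity, re_sum]
    refine Finset.sum_congr rfl fun i _ => ?_
    rw [powDensity, indicator_of_mem (mem_Ici.2 hv.1)]
    have : (Real.exp v : ℂ) * ((v : ℂ) ^ i / (i.factorial : ℂ)) =
        ((Real.exp v * (v ^ i / i.factorial) : ℝ) : ℂ) := by push_cast; rfl
    rw [this, re_mul_ofReal]
    simp
    ring
  have hf_int := intervalIntegral.integral_eq_sub_of_hasDerivAt (a := 0) (b := y)
    (f := fun v => Real.exp v * P.eval v)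
    (fun v _ => (Real.hasDerivAt_exp v).mul (P.hasDerivAt v))
    (Continuous.intervalIntegrable (by fun_prop) _ _)
  rw [h0, hre, hcongr, hf_int]
  simp

end MainTerm

/-! ### Removing the pole -/

section Pole

open Set Complex

/-- The Taylor remainders of `φ` at `1`. -/
noncomputable def taylorRem (φ : ℂ → ℂ) (j : ℕ) : ℂ → ℂ := (fun f => dslope f 1)^[j] φ

theorem taylorRem_succ (φ : ℂ → ℂ) (j : ℕ) :
    taylorRem φ (j + 1) = dslope (taylorRem φ j) 1 := Function.iterate_succ_apply' _ _ _

theorem eq_sum_add_taylorRem (φ : ℂ → ℂ) (n : ℕ) (s : ℂ) :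
    φ s = ∑ j ∈ Finset.range n, taylorRem φ j 1 * (s - 1) ^ j + (s - 1) ^ n * taylorRem φ n s := by
  induction n with
  | zero => simp [taylorRem]
  | succ n ih =>
    have h := sub_smul_dslope (taylorRem φ n) 1 s
    rw [← taylorRem_succ, smul_eq_mul] at h
    rw [ih, Finset.sum_range_succ, pow_succ, mul_assoc, h]
    ring

theorem differentiableOn_taylorRem {φ : ℂ → ℂ} {U : Set ℂ} (hU : U ∈ nhds (1 : ℂ))
    (hφ : DifferentiableOn ℂ φ U) (n : ℕ) : DifferentiableOn ℂ (taylorRem φ n) U := by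
  induction n with
  | zero => exact hφ
  | succ n ih => rw [taylorRem_succ]; exact (Complex.differentiableOn_dslope hU).2 ih

/-- `(s - 1) ^ (r + 1)` times the Dirichlet series of `(r + 1) ^ ω(n)`. -/
noncomputable def regularSeries (r : ℕ) (s : ℂ) : ℂ :=
  riemannZeta₁ s ^ (r + 1) * quotientSeries r s

theorem differentiableOn_regularSeries (r : ℕ) :
    DifferentiableOn ℂ (regularSeries r) {s | 1 / 2 < s.re} :=
  (differentiable_riemannZeta₁.pow _).differentiableOn.mul (differentiableOn_quotientSeries r)

/-- Coefficient of `(s - 1) ^ (-(i + 1))` in the Laurent expansion of the Dirichlet series of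
`(r + 1) ^ ω(n)` at `1`, for `i ≤ r`. -/
noncomputable def polarCoeff (r i : ℕ) : ℂ := taylorRem (regularSeries r) (r - i) 1

theorem polarCoeff_self (r : ℕ) :
    polarCoeff r r = ((∏' p : Nat.Primes, eulerFactor r p : ℝ) : ℂ) := by
  rw [polarCoeff, Nat.sub_self, ← quotientSeries_one]
  simp [taylorRem, regularSeries, riemannZeta₁_one]

/-- The Dirichlet series of `(r + 1) ^ ω(n)` minus its polar part at `1`. -/
noncomputable def regularPart (r : ℕ) : ℂ → ℂ := taylorRem (regularSeries r) (r + 1)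

theorem differentiableOn_regularPart (r : ℕ) :
    DifferentiableOn ℂ (regularPart r) {s | 1 / 2 < s.re} :=
  differentiableOn_taylorRem ((isOpen_half_plane _).mem_nhds (by norm_num))
    (differentiableOn_regularSeries r) _

theorem regularPart_eq (r : ℕ) {s : ℂ} (hs : s ≠ 1) :
    regularPart r s = riemannZeta s ^ (r + 1) * quotientSeries r s -
      ∑ i ∈ Finset.range (r + 1), polarCoeff r i / (s - 1) ^ (i + 1) := by
  have h1 : s - 1 ≠ 0 := sub_ne_zero.2 hs
  have h := eq_sum_add_taylorRem (regularSeries r) (r + 1) s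
  rw [← Finset.sum_range_reflect] at h
  have hz : riemannZeta s ^ (r + 1) * quotientSeries r s =
      regularSeries r s / (s - 1) ^ (r + 1) := by
    rw [regularSeries, riemannZeta_eq_inv_sub_mul hs, mul_pow, inv_pow]
    field_simp
  rw [hz, h, add_div, mul_div_cancel_left₀ _ (pow_ne_zero _ h1), Finset.sum_div, add_sub_right_comm,
    ← Finset.sum_sub_distrib, Finset.sum_eq_zero, zero_add, regularPart]
  intro i hi
  have hi' : i ≤ r := Nat.lt_succ_iff.1 (Finset.mem_range.1 hi)
  rw [show r + 1 - 1 - i = r - i by omega, polarCoeff, sub_eq_zero,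
    div_eq_div_iff (pow_ne_zero _ h1) (pow_ne_zero _ h1), mul_assoc, ← pow_add]
  congr 2
  omega

theorem exists_norm_regularPart_le_zeta (r : ℕ) {σ : ℝ} (hσ : 1 / 2 < σ) :
    ∃ A B : ℝ, 0 ≤ A ∧ 0 ≤ B ∧ ∀ s : ℂ, σ ≤ s.re → 1 ≤ |s.im| →
      ‖regularPart r s‖ ≤ A * ‖riemannZeta s‖ ^ (r + 1) + B := by
  obtain ⟨C, hC, hH⟩ := exists_norm_quotientSeries_le r hσ
  refine ⟨C, ∑ i ∈ Finset.range (r + 1), ‖polarCoeff r i‖, hC, by positivity,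
    fun s hs him => ?_⟩
  have h1 : 1 ≤ ‖s - 1‖ := him.trans (by simpa using abs_im_le_norm (s - 1))
  rw [regularPart_eq r (by rintro rfl; simp at him; linarith)]
  refine (norm_sub_le _ _).trans (add_le_add ?_ (norm_sum_le_of_le _ fun i _ => ?_))
  · rw [norm_mul, norm_pow, mul_comm]
    gcongr
    exact hH s hs
  · rw [norm_div, norm_pow]
    exact div_le_self (norm_nonneg _) (one_le_pow₀ h1)

theorem exists_norm_regularPart_le_of_abs_im_le (r : ℕ) {σ : ℝ} (hσ : 1 / 2 < σ) (c : ℝ) :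
    ∃ D : ℝ, 0 ≤ D ∧ ∀ s : ℂ, σ ≤ s.re → s.re ≤ c → |s.im| ≤ 1 → ‖regularPart r s‖ ≤ D := by
  have hK : IsCompact (Icc σ c ×ℂ Icc (-1 : ℝ) 1) := isCompact_Icc.reProdIm isCompact_Icc
  obtain ⟨D, hD⟩ := hK.exists_bound_of_continuousOn
    ((differentiableOn_regularPart r).continuousOn.mono fun s hs => hσ.trans_le hs.1.1)
  exact ⟨max D 0, le_max_right _ _, fun s h1 h2 h3 =>
    (hD s ⟨⟨h1, h2⟩, abs_le.1 h3⟩).trans (le_max_left _ _)⟩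

/-- A crude bound from |ζ(s)| ≤ 8|s| away from the real axis and compactness near it. Its exponent r
+ 1 dictates the use of r + 2 primitives. -/
theorem exists_norm_regularPart_le_strip (r : ℕ) {σ : ℝ} (hσ : 1 / 2 < σ) (c : ℝ) :
    ∃ K : ℝ, 0 ≤ K ∧ ∀ s : ℂ, σ ≤ s.re → s.re ≤ c → ‖regularPart r s‖ ≤ K * ‖s‖ ^ (r + 1) := by
  obtain ⟨A, B, hA, hB, h1⟩ := exists_norm_regularPart_le_zeta r hσ
  obtain ⟨D, hD, h2⟩ := exists_norm_regularPart_le_of_abs_im_le r hσ c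
  have hσ0 : 0 < σ := by linarith
  refine ⟨A * 8 ^ (r + 1) + B + D / σ ^ (r + 1), by positivity, fun s hs hsc => ?_⟩
  rcases le_total 1 |s.im| with him | him
  · have hz := norm_riemannZeta_le_of_one_le_abs_im (hσ.trans_le hs) him
    have hs1 : 1 ≤ ‖s‖ ^ (r + 1) := one_le_pow₀ (him.trans (abs_im_le_norm s))
    calc ‖regularPart r s‖ ≤ A * (8 * ‖s‖) ^ (r + 1) + B * ‖s‖ ^ (r + 1) := by
          refine (h1 s hs him).trans (add_le_add ?_ (le_mul_of_one_le_right hB hs1))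
          gcongr
      _ = (A * 8 ^ (r + 1) + B) * ‖s‖ ^ (r + 1) := by rw [mul_pow]; ring
      _ ≤ _ := by
          refine mul_le_mul_of_nonneg_right (le_add_of_nonneg_right ?_) (by positivity)
          positivity
  · have hs1 : σ ^ (r + 1) ≤ ‖s‖ ^ (r + 1) := by
      gcongr
      exact hs.trans (re_le_norm s)
    calc ‖regularPart r s‖ ≤ D := h2 s hs hsc him
      _ = D / σ ^ (r + 1) * σ ^ (r + 1) := by field_simp
      _ ≤ (A * 8 ^ (r + 1) + B + D / σ ^ (r + 1)) * ‖s‖ ^ (r + 1) := by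
          refine mul_le_mul (le_add_of_nonneg_left (by positivity)) hs1 (by positivity)
            (by positivity)

theorem exists_norm_regularPart_le_line (r : ℕ) {σ : ℝ} (hσ : 1 / 2 < σ) (hσ1 : σ < 1) :
    ∃ K : ℝ, 0 ≤ K ∧ ∀ t : ℝ, ‖regularPart r (σ + t * I)‖ ≤
      K * (1 + |t|) ^ (((r : ℝ) + 1) / 6) := by
  obtain ⟨A, B, hA, hB, h1⟩ := exists_norm_regularPart_le_zeta r hσ
  obtain ⟨D, hD, h2⟩ := exists_norm_regularPart_le_of_abs_im_le r hσ 1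
  obtain ⟨C, hC, h3⟩ := exists_norm_riemannZeta_le hσ hσ1
  refine ⟨A * C ^ (r + 1) + B + D, by positivity, fun t => ?_⟩
  have ht : 1 ≤ 1 + |t| := le_add_of_nonneg_right (abs_nonneg t)
  have hT : 1 ≤ (1 + |t|) ^ (((r : ℝ) + 1) / 6) := Real.one_le_rpow ht (by positivity)
  have hpow : ((1 + |t|) ^ (1 / 6 : ℝ)) ^ (r + 1) = (1 + |t|) ^ (((r : ℝ) + 1) / 6) := by
    rw [← Real.rpow_natCast, ← Real.rpow_mul (by positivity)]
    congr 1; push_cast; ring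
  have hre : ((σ : ℂ) + t * I).re = σ := by simp
  have him : ((σ : ℂ) + t * I).im = t := by simp
  rcases le_total 1 |t| with h | h
  · calc ‖regularPart r (σ + t * I)‖
        ≤ A * (C * (1 + |t|) ^ (1 / 6 : ℝ)) ^ (r + 1) + B * (1 + |t|) ^ (((r : ℝ) + 1) / 6) := by
          refine (h1 _ hre.ge (by rwa [him])).trans
            (add_le_add ?_ (le_mul_of_one_le_right hB hT))
          gcongr
          exact h3 t
      _ = (A * C ^ (r + 1) + B) * (1 + |t|) ^ (((r : ℝ) + 1) / 6) := by
          rw [mul_pow, hpow]; ring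
      _ ≤ _ := mul_le_mul_of_nonneg_right (le_add_of_nonneg_right hD) (by positivity)
  · calc ‖regularPart r (σ + t * I)‖ ≤ D := h2 _ hre.ge (hre.trans_le hσ1.le) (by rwa [him])
      _ ≤ (A * C ^ (r + 1) + B + D) * (1 + |t|) ^ (((r : ℝ) + 1) / 6) := by
          refine (le_add_of_nonneg_left (by positivity)).trans
            (le_mul_of_one_le_right (by positivity) hT)

/-- The Laplace transform of the error term. -/
theorem laplace_logSummatory_sub (r : ℕ) {s : ℂ} (hs : 1 < s.re) :
    laplace (fun y => (logSummatory r y : ℂ) -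
      primitive (mainDensity (polarCoeff r) (r + 1)) y) s = regularPart r s / s := by
  obtain ⟨b, hb, hbs⟩ := exists_between hs
  have hb0 : 0 < b := by linarith
  have hm := expGrowth_mainDensity (polarCoeff r) (r + 1) hb
  rw [(expGrowth_logSummatory r hb).laplace_sub (hm.primitive hb0) hbs, laplace_logSummatory r hs,
    hm.laplace_primitive hb0 hbs, laplace_mainDensity _ _ hs,
    regularPart_eq r (by rintro rfl; simp at hs), sub_div]

end Pole

/-! ### The asymptotic formula -/

section Asymptotic

open MeasureTheory Set Complex Polynomial

theorem eulerFactor_pos (r : ℕ) (p : Nat.Primes) : 0 < eulerFactor r p := by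
  have hp : (1 : ℝ) < (p : ℕ) := by exact_mod_cast p.2.one_lt
  have h1 : 0 < 1 - 1 / ((p : ℕ) : ℝ) := by
    rw [sub_pos, div_lt_one (by linarith)]; exact hp
  have h2 : 0 < ((p : ℕ) : ℝ) - 1 := sub_pos.2 hp
  unfold eulerFactor
  positivity

/-- The local polynomial is 1 + X² Q(X), so the deviation from 1 at X = 1/p is O(p^(-2)). -/
theorem summable_eulerFactor_sub_one (r : ℕ) :
    Summable fun p : Nat.Primes => eulerFactor r p - 1 := by
  set Q := (localPoly r).divX.divX with hQ
  have hL : localPoly r = Q * X ^ 2 + 1 := by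
    have h1 := divX_mul_X_add (localPoly r)
    have h2 := divX_mul_X_add (localPoly r).divX
    rw [coeff_divX, zero_add, localPoly_coeff_one, C_0, add_zero] at h2
    rw [localPoly_coeff_zero, C_1] at h1
    calc localPoly r = (localPoly r).divX * X + 1 := h1.symm
      _ = Q * X * X + 1 := by rw [hQ, h2]
      _ = Q * X ^ 2 + 1 := by ring
  obtain ⟨D, hD⟩ := (isCompact_Icc (a := (0 : ℝ)) (b := 1)).exists_bound_of_continuousOn
    (f := fun x : ℝ => aeval x Q) (Polynomial.continuous_aeval Q).continuousOn
  have hs : Summable fun p : Nat.Primes => D * (((p : ℕ) : ℝ)⁻¹ ^ 2) := by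
    refine Summable.mul_left _ ?_
    have := (Real.summable_nat_pow_inv (p := 2)).2 one_lt_two
    simp only [inv_pow]
    exact this.comp_injective Subtype.val_injective
  refine hs.of_norm_bounded fun p => ?_
  have hp : (1 : ℝ) ≤ (p : ℕ) := by exact_mod_cast p.2.one_lt.le
  rw [← localPoly_eval_inv_prime, hL]
  simp only [map_add, map_mul, map_pow, aeval_X, map_one, add_sub_cancel_right, norm_mul]
  rw [Real.norm_of_nonneg (by positivity : (0 : ℝ) ≤ ((p : ℕ) : ℝ)⁻¹ ^ 2)]
  gcongr
  exact hD _ ⟨by positivity, inv_le_one_of_one_le₀ hp⟩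

/-- Needed for the degree to be exactly r: convergence of the logarithms excludes the limit 0. -/
theorem tprod_eulerFactor_ne_zero (r : ℕ) : ∏' p : Nat.Primes, eulerFactor r p ≠ 0 := by
  have h := Real.summable_log_one_add_of_summable (summable_eulerFactor_sub_one r)
  simp only [add_sub_cancel] at h
  rw [← Real.rexp_tsum_eq_tprod (eulerFactor_pos r) h]
  exact (Real.exp_pos _).ne'

theorem ExpGrowth.abs_re_primitive_sub_le {b C : ℝ} (hb : 0 < b) {f : ℝ → ℂ} (hf : ExpGrowth b f)
    (hC : 0 ≤ C) (hbd : ∀ y, ‖f y‖ ≤ C * Real.exp (b * y)) {v y d : ℝ}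
    (hv : v ∈ Icc (y - d) (y + d)) :
    |(_root_.primitive f v).re - (_root_.primitive f y).re| ≤ d * (C * Real.exp (b * (y + d))) := by
  have hd : |v - y| ≤ d := abs_sub_le_iff.2 ⟨by linarith [hv.2], by linarith [hv.1]⟩
  have hd0 : 0 ≤ d := (abs_nonneg _).trans hd
  rw [← sub_re, hf.primitive_sub hb y v]
  refine (abs_re_le_norm _).trans ?_
  calc ‖∫ u in y..v, f u‖ ≤ C * Real.exp (b * (y + d)) * |v - y| := by
        refine intervalIntegral.norm_integral_le_of_norm_le_const fun u hu => (hbd u).trans ?_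
        have hu : u ≤ y + d := (uIoc_subset_uIcc hu).2.trans (sup_le (by linarith) hv.2)
        gcongr
    _ ≤ d * (C * Real.exp (b * (y + d))) := by
        rw [mul_comm]; gcongr

theorem exists_abs_logSummatory_sub_le (r : ℕ) {ε : ℝ} (hε : 0 < ε) :
    ∃ C : ℝ, 0 ≤ C ∧ ∀ y : ℝ, 0 ≤ y →
      |logSummatory r y - (primitive (mainDensity (polarCoeff r) (r + 1)) y).re| ≤
        C * Real.exp ((1 - 3 / ((r : ℝ) + 7) + ε) * y) := by
  -- The exponents lose at most (1 + ρ)e ≤ 2e ≤ ε, and e ≤ 1/4 keeps the line Re s = 1/2 + e to the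
  -- left of 1.
  set e := min (ε / 2) (1 / 4) with he
  have he0 : 0 < e := by positivity
  have heε : e ≤ ε / 2 := min_le_left _ _
  have he4 : e ≤ 1 / 4 := min_le_right _ _
  set ρ : ℝ := 3 / ((r : ℝ) + 7) with hρ
  have hr0 : (0 : ℝ) ≤ r := Nat.cast_nonneg r
  have hρ0 : 0 < ρ := by positivity
  have hρ1 : ρ ≤ 1 := by rw [hρ, div_le_one (by positivity)]; linarith
  -- The balance of contour error against smoothing error that determines ρ.
  have hρκ : ρ * (((r : ℝ) + 1) / 6) + 1 / 2 = 1 - ρ := by rw [hρ]; field_simp; ring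
  have hb : (1 : ℝ) < 1 + e := by linarith
  have hσ : 1 / 2 < 1 / 2 + e := by linarith
  set M := mainDensity (polarCoeff r) (r + 1) with hM
  have hm : ExpGrowth (1 + e) M := expGrowth_mainDensity _ _ hb
  obtain ⟨D, hD, hMb⟩ := hm.bound
  have hE : ExpGrowth (1 + e) fun y => (logSummatory r y : ℂ) - primitive M y :=
    (expGrowth_logSummatory r hb).sub (hm.primitive (by linarith))
  obtain ⟨K, hK, hgb⟩ := exists_norm_regularPart_le_strip r hσ 3
  obtain ⟨K', hK', hgσ⟩ := exists_norm_regularPart_le_line r hσ (by linarith)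
  obtain ⟨C, hC, hbound⟩ := norm_fwdDiff_iterate_primitive_le (b := 1 + e) (c := 3)
    (σ := 1 / 2 + e) (k := r + 1) (κ := ((r : ℝ) + 1) / 6) (η := e) (g := regularPart r)
    (by linarith) (by linarith) (by linarith) (by linarith) (by linarith) hE
    (fun t => laplace_logSummatory_sub r (by simp))
    ((differentiableOn_regularPart r).mono fun s hs => hσ.trans_le hs.1)
    hK hgb hK' hgσ (by positivity) he0 (by push_cast; linarith)
  set m : ℕ := r + 1 + 1 with hmdef
  refine ⟨m * (D * Real.exp ((1 + e) * m)) + C, by positivity, fun y hy => ?_⟩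
  set δ := Real.exp (-(ρ * y)) with hδ
  have hδ0 : 0 < δ := Real.exp_pos _
  have hδ1 : δ ≤ 1 := Real.exp_le_one_iff.2 (neg_nonpos.2 (by positivity))
  have hmain := abs_re_le_of_fwdDiff_bound (M := primitive M) (m := m) (y := y)
    (monotone_logSummatory r) (by linarith) hE hδ0
    (V := m * δ * (D * Real.exp ((1 + e) * (y + m * δ))))
    (R := C * δ ^ (-(((r : ℝ) + 1) / 6 + e)) * Real.exp ((1 / 2 + e) * y))
    (fun v hv => hm.abs_re_primitive_sub_le (by linarith) hD hMb hv)
    (fun v hv => (hbound δ hδ0 hδ1 v).trans (by gcongr; exact hv.2))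
  refine hmain.trans ((add_le_add ?_ ?_).trans_eq (add_mul _ C _).symm)
  · calc m * δ * (D * Real.exp ((1 + e) * (y + m * δ)))
        ≤ m * δ * (D * Real.exp ((1 + e) * (y + m * 1))) := by gcongr
      _ = m * (D * Real.exp ((1 + e) * m)) * Real.exp ((1 - ρ + e) * y) := by
        have : (1 + e) * (y + m * 1) = (1 + e) * m + (1 + e) * y := by ring
        rw [this, Real.exp_add, show (1 - ρ + e) * y = -(ρ * y) + (1 + e) * y by ring,
          Real.exp_add]
        ring
      _ ≤ _ := by gcongr; linarith
  · rw [mul_assoc, hδ, ← Real.exp_mul, ← Real.exp_add]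
    gcongr
    have : -(ρ * y) * -(((r : ℝ) + 1) / 6 + e) + (1 / 2 + e) * y =
        (ρ * (((r : ℝ) + 1) / 6) + 1 / 2 + (1 + ρ) * e) * y := by ring
    rw [this, hρκ]
    gcongr
    nlinarith

end Asymptotic

theorem corollary1p5 (r : ℕ) (hr : 2 ≤ r) :
    Multipliable (eulerFactor r) ∧
    ∃ P : Polynomial ℝ,
      P.natDegree = r ∧
      P.leadingCoeff = 1 / (r.factorial : ℝ) * ∏' p : Nat.Primes, eulerFactor r p ∧
      ∀ ε : ℝ, 0 < ε →
        Asymptotics.IsBigO Filter.atTop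
          (fun x : ℝ => (moebiusSqFloorSum r x : ℝ) - x * P.eval (Real.log x))
          (fun x : ℝ => x ^ (1 - 3 / ((r : ℝ) + 7) + ε)) := by
  refine ⟨(hasProd_eulerFactor r).multipliable, ?_⟩
  -- A polar term a/(s - 1)^(i+1) is the transform of a e^v v^i/i!, so e^v Q(v) is the density of
  -- the main term. Real parts suffice because the summatory function is real.
  set Q : Polynomial ℝ := ∑ i ∈ Finset.range (r + 1),
    Polynomial.C ((polarCoeff r i).re / i.factorial) * Polynomial.X ^ i with hQ
  have hcoeff : Q.coeff r = 1 / (r.factorial : ℝ) * ∏' p : Nat.Primes, eulerFactor r p := by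
    rw [hQ, Polynomial.finsetSum_coeff, Finset.sum_eq_single r]
    · rw [Polynomial.coeff_C_mul_X_pow, if_pos rfl, polarCoeff_self, Complex.ofReal_re]
      ring
    · intro i _ hi
      rw [Polynomial.coeff_C_mul_X_pow, if_neg hi.symm]
    · simp
  have hcoeff0 : Q.coeff r ≠ 0 := by
    rw [hcoeff]
    exact mul_ne_zero (by positivity) (tprod_eulerFactor_ne_zero r)
  have hdeg : Q.natDegree = r := by
    refine Polynomial.natDegree_eq_of_le_of_coeff_ne_zero ?_ hcoeff0
    refine Polynomial.natDegree_sum_le_of_forall_le _ _ fun i hi => ?_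
    exact (Polynomial.natDegree_C_mul_X_pow_le _ _).trans
      (Nat.lt_succ_iff.1 (Finset.mem_range.1 hi))
  obtain ⟨P, hP, hPdeg, hPlead⟩ := exists_add_derivative_eq (Q := Q)
    (fun h => hcoeff0 (by rw [h, Polynomial.coeff_zero]))
  refine ⟨P, hPdeg.trans hdeg, ?_, fun ε hε => ?_⟩
  · rw [hPlead, Polynomial.leadingCoeff, hdeg, hcoeff]
  obtain ⟨C, hC, hbound⟩ := exists_abs_logSummatory_sub_le r hε
  -- Integrating the density from 0 leaves the constant -P(0); it is absorbed since the exponent of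
  -- x is nonnegative and x ≥ 1.
  refine Asymptotics.IsBigO.of_bound (C + |P.eval 0|) ?_
  filter_upwards [Filter.eventually_ge_atTop (1 : ℝ)] with x hx
  have hx0 : 0 < x := by linarith
  have hy : 0 ≤ Real.log x := Real.log_nonneg hx
  have h := hbound _ hy
  rw [re_primitive_mainDensity _ _ hP hy, Real.exp_log hx0, logSummatory, Real.exp_log hx0] at h
  have hrpow : x ^ (1 - 3 / ((r : ℝ) + 7) + ε) =
      Real.exp ((1 - 3 / ((r : ℝ) + 7) + ε) * Real.log x) := by
    rw [Real.rpow_def_of_pos hx0, mul_comm]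
  have hρ1 : 3 / ((r : ℝ) + 7) ≤ 1 := by
    rw [div_le_one (by positivity)]
    linarith [(Nat.cast_nonneg r : (0 : ℝ) ≤ r)]
  have h1 : 1 ≤ x ^ (1 - 3 / ((r : ℝ) + 7) + ε) := Real.one_le_rpow hx (by linarith)
  rw [← hrpow] at h
  have hsum : (moebiusSqFloorSum r x : ℝ) =
      ∑ n ∈ Finset.Icc 1 ⌊x⌋₊, (omegaPow (r + 1) n : ℝ) := by
    rw [moebiusSqFloorSum_eq r hx0.le]; push_cast; rfl
  rw [hsum, Real.norm_of_nonneg (by positivity : 0 ≤ x ^ (1 - 3 / ((r : ℝ) + 7) + ε)),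
    Real.norm_eq_abs, add_mul]
  set S := ∑ n ∈ Finset.Icc 1 ⌊x⌋₊, (omegaPow (r + 1) n : ℝ)
  calc |S - x * P.eval (Real.log x)|
      = |(S - (x * P.eval (Real.log x) - P.eval 0)) - P.eval 0| := by congr 1; ring
    _ ≤ _ := (abs_sub _ _).trans (add_le_add h (le_mul_of_one_le_right (abs_nonneg _) h1))
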